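/- Let $\mathcal Y=\{1,\dots,l\}$ and $\mathcal Z=\mathbb R$. Let $\Omega_1\subset\mathbb R^{m_1}$ and $\Omega_2\subset\mathbb R^{m_2}$ be bounded domains (open and connected). For $\vec\varepsilon\in\Omega_1$ let $\Pi^{\vec\varepsilon}=(\pi^{\vec\varepsilon}_{ij})$ be an $l\times l$ stochastic matrix whose entries are real analytic in $\vec\varepsilon$, with a stationary probability vector $\pi^{\vec\varepsilon}$; for $\vec\theta\in\Omega_2$ and $y\in\mathcal Y$ let $q^{\vec\theta}(\cdot|y)$ be a probability density on $\mathcal Z$, such that $q^{\vec\theta}(z|y)$ is real analytic in $\vec\theta$ for each $(y,z)$. Let $Y$ be the stationary Markov chain with transition matrix $\Pi^{\vec\varepsilon}$ and initial vector $\pi^{\vec\varepsilon}$, and let $Z$ be the output of the memoryless channel with densities $q^{\vec\theta}(z|y)$ and input $Y$, so that $(Z_{-n},\dots,Z_0)$ has the density $$p(z_{-n}^0)=\sum_{y_{-n}^0\in\mathcal Y^{n+1}}\pi^{\vec\varepsilon}_{y_{-n}}\prod_{i=-n}^{-1}\pi^{\vec\varepsilon}_{y_iy_{i+1}}\prod_{i=-n}^{0}q^{\vec\theta}(z_i|y_i).$$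 Its entropy rate is $H(Z)=\lim_{n\to\infty}\frac1{n+1}H(Z_{-n}^0)$, where $H(Z_{-n}^0)=-\int_{\mathcal Z^{n+1}}p(z_{-n}^0)\log p(z_{-n}^0)\,dz_{-n}^0$. Fix $(\vec\varepsilon_0,\vec\theta_0)\in\Omega_1\times\Omega_2$, and let $B(r)$ be the open ball of radius $r$ around $\vec\theta_0$ in $\mathbb C^{m_2}$. Complex analytic extensions in $\vec\theta$ of real analytic functions are denoted by the same symbols. Assume: (a) all entries of $\Pi^{\vec\varepsilon_0}$ are positive; (b) $q^{\vec\theta_0}(z|y)>0$ for all $y\in\mathcal Y$, $z\in\mathcal Z$; (c) there is $r>0$ such that, for all $(y,z)$, $q^{\vec\theta}(z|y)$ extends analytically to $\vec\theta\in B(r)$; for each $y$ the extension is jointly continuous on $\mathcal Z\times B(r)$; and the integrals $\int\breve q\,dz$, $\int\breve q\log\hat q\,dz$, $\int\breve q\log\breve q\,dz$ are all finite (absolutely convergent), where $\breve q(z)=\sup_{y,\,\vec\theta\in B(r)}|q^{\vec\theta}(z|y)|$ and $\hat q(z)=\inf_{y,\,\vec\theta\in B(r)}|q^{\vec\theta}(z|y)|$;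 (d) for some $I\in\mathcal Y$: (i) there is $r>0$ such that for every $j$ the family $\{\vec\theta\mapsto q^{\vec\theta}(z|j)/q^{\vec\theta}(z|I)\}_{z\in\mathcal Z}$ is equicontinuous on $B(r)$; and (ii) there is $r>0$ such that for each $z$ the real function $\log q^{\vec\theta}(z|I)$ extends analytically to $B(r)$, and $\int_{\mathcal Z}\sup_{\vec\theta\in B(r)}|q^{\vec\theta}(z|j)\log q^{\vec\theta}(z|I)|\,dz<\infty$ for all $j$. Suppose in addition that, for the same $I$, there is $r>0$ such that for every $\varepsilon>0$ there is a compact $\Sigma\subset\mathcal Z$ with $$\left|\frac{q^{\vec\theta}(z|j)}{q^{\vec\theta}(z|I)}\right|\le\varepsilon\qquad\text{for all }z\notin\Sigma,\ j\ne I,\ \vec\theta\in B(r).\tag{$*$}$$ Then $H(Z)$ exists for all $(\vec\varepsilon,\vec\theta)$ in a neighborhood of $(\vec\varepsilon_0,\vec\theta_0)$, with all $H(Z_{-n}^0)$ finite, and is jointly real analytic in $(\vec\varepsilon,\vec\theta)$ at $(\vec\varepsilon_0,\vec\theta_0)$. This applies to the additive Gaussian channel $q(z|i)=\frac1{\sqrt{2\pi}\,\sigma_i}e^{-(z-\mu_i)^2/(2\sigma_i^2)}$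 with channel parameters $(\sigma_1,\mu_1,\dots,\sigma_l,\mu_l)$: at every parameter with all $\sigma_i>0$ and some $\sigma_I$ strictly larger than all the other $\sigma_j$, conditions (c), (d) and $(*)$ hold with this $I$, and so, if all entries of $\Pi^{\vec\varepsilon_0}$ are positive, $H(Z)$ is jointly analytic in $\vec\varepsilon$ and $(\sigma_1,\mu_1,\dots,\sigma_l,\mu_l)$ around $(\vec\varepsilon_0,(\sigma_1,\mu_1,\dots,\sigma_l,\mu_l))$. -/

import Mathlib

open MeasureTheory Filter Topology Metric
open scoped ENNReal

noncomputable section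

namespace HiddenMarkov

/-! ### The hidden Markov chain and its entropy rate

The input alphabet is `Fin l`, the output alphabet is `ℝ`. -/

/-- `P` is a stochastic matrix. -/
def IsStochastic {l : ℕ} (P : Fin l → Fin l → ℝ) : Prop :=
  (∀ i j, 0 ≤ P i j) ∧ ∀ i, ∑ j, P i j = 1

/-- `v` is a stationary probability vector of `P`. -/
def IsStationary {l : ℕ} (P : Fin l → Fin l → ℝ) (v : Fin l → ℝ) : Prop :=
  (∀ i, 0 ≤ v i) ∧ ∑ i, v i = 1 ∧ ∀ j, ∑ i, v i * P i j = v j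

/-- `f` is a probability density function on `ℝ`. -/
def IsProbDensity (f : ℝ → ℝ) : Prop :=
  Measurable f ∧ (∀ z, 0 ≤ f z) ∧ ∫⁻ z, ENNReal.ofReal (f z) = 1

/-- The joint probability density of `n + 1` consecutive outputs of the memoryless channel with
transition densities `q y z = q(z|y)`, fed with the stationary Markov chain with transition
matrix `P` and stationary vector `v`: the sum over all input paths. -/
def blockDensity {l : ℕ} (P : Fin l → Fin l → ℝ) (v : Fin l → ℝ) (q : Fin l → ℝ → ℝ) (n : ℕ)
    (z : Fin (n + 1) → ℝ) : ℝ :=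
  ∑ y : Fin (n + 1) → Fin l,
    (v (y 0) * ∏ k : Fin n, P (y k.castSucc) (y k.succ)) * ∏ k : Fin (n + 1), q (y k) (z k)

/-- The differential entropy of `n + 1` consecutive outputs. -/
def blockEntropy {l : ℕ} (P : Fin l → Fin l → ℝ) (v : Fin l → ℝ) (q : Fin l → ℝ → ℝ)
    (n : ℕ) : ℝ :=
  -∫ z : Fin (n + 1) → ℝ, blockDensity P v q n z * Real.log (blockDensity P v q n z)

/-- The entropy rate of the output process exists and equals `h`: all block entropies are
(absolutely convergent) finite integrals, and the normalized block entropies converge to `h`. -/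
def HasEntropyRate {l : ℕ} (P : Fin l → Fin l → ℝ) (v : Fin l → ℝ) (q : Fin l → ℝ → ℝ)
    (h : ℝ) : Prop :=
  (∀ n : ℕ, Integrable (fun z : Fin (n + 1) → ℝ =>
      blockDensity P v q n z * Real.log (blockDensity P v q n z))) ∧
    Tendsto (fun n : ℕ => 1 / ((n : ℝ) + 1) * blockEntropy P v q n) atTop (𝓝 h)

/-- Around `(ε₀, θ₀)` the entropy rate exists and is a jointly (real) analytic function of the
input parameter `ε` and of the channel parameter `θ`. -/
def EntropyRateAnalyticAt {l : ℕ} {ι₁ ι₂ : Type} [Fintype ι₁] [Fintype ι₂]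
    (P : EuclideanSpace ℝ ι₁ → Fin l → Fin l → ℝ) (v : EuclideanSpace ℝ ι₁ → Fin l → ℝ)
    (q : EuclideanSpace ℝ ι₂ → Fin l → ℝ → ℝ)
    (ε₀ : EuclideanSpace ℝ ι₁) (θ₀ : EuclideanSpace ℝ ι₂) : Prop :=
  ∃ H : EuclideanSpace ℝ ι₁ × EuclideanSpace ℝ ι₂ → ℝ,
    AnalyticAt ℝ H (ε₀, θ₀) ∧
      ∀ᶠ x in 𝓝 (ε₀, θ₀), HasEntropyRate (P x.1) (v x.1) (q x.2) (H x)

/-! ### Complexified channel densities and the regularity conditions -/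

/-- The inclusion of real parameter space in complex parameter space. -/
def toComplex {ι : Type} (θ : EuclideanSpace ℝ ι) : EuclideanSpace ℂ ι :=
  WithLp.toLp 2 fun i => (θ i : ℂ)

/-- On the ball of radius `r` around `θ₀` in complex parameter space, `G` is a complex analytic
extension of the real function `g`. -/
def IsComplexExtension {ι : Type} [Fintype ι] (g : EuclideanSpace ℝ ι → ℝ)
    (G : EuclideanSpace ℂ ι → ℂ) (θ₀ : EuclideanSpace ℝ ι) (r : ℝ) : Prop :=
  AnalyticOnNhd ℂ G (ball (toComplex θ₀) r) ∧
    ∀ θ : EuclideanSpace ℝ ι, toComplex θ ∈ ball (toComplex θ₀) r → G (toComplex θ) = (g θ : ℂ)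

/-- The supremum of `|q^θ(z|y)|` over all `y` and all complex `θ` in the `r`-ball around `θ₀`. -/
def supDensity {l : ℕ} {ι : Type} [Fintype ι] (Q : EuclideanSpace ℂ ι → Fin l → ℝ → ℂ)
    (θ₀ : EuclideanSpace ℝ ι) (r : ℝ) (z : ℝ) : ℝ≥0∞ :=
  ⨆ y : Fin l, ⨆ θ ∈ ball (toComplex θ₀) r, ‖Q θ y z‖ₑ

/-- The infimum of `|q^θ(z|y)|` over all `y` and all complex `θ` in the `r`-ball around `θ₀`. -/
def infDensity {l : ℕ} {ι : Type} [Fintype ι] (Q : EuclideanSpace ℂ ι → Fin l → ℝ → ℂ)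
    (θ₀ : EuclideanSpace ℝ ι) (r : ℝ) (z : ℝ) : ℝ≥0∞ :=
  ⨅ y : Fin l, ⨅ θ ∈ ball (toComplex θ₀) r, ‖Q θ y z‖ₑ

/-- Condition (c): on some complex ball around `θ₀`, `Q` is the complex analytic extension of the
density family `q`, it is jointly continuous in `(z, θ)`, and the three integrals of `q̆`,
`q̆ log q̂` and `q̆ log q̆` are finite (`q̆` the supremum and `q̂` the infimum above; the logarithm
is the extended one, so that `log 0 = -∞`). -/
def ConditionC {l : ℕ} {ι : Type} [Fintype ι] (q : EuclideanSpace ℝ ι → Fin l → ℝ → ℝ)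
    (Q : EuclideanSpace ℂ ι → Fin l → ℝ → ℂ) (θ₀ : EuclideanSpace ℝ ι) : Prop :=
  ∃ r : ℝ, 0 < r ∧
    (∀ y z, IsComplexExtension (fun θ => q θ y z) (fun θ => Q θ y z) θ₀ r) ∧
    (∀ y, ContinuousOn (fun p : ℝ × EuclideanSpace ℂ ι => Q p.2 y p.1)
      (Set.univ ×ˢ ball (toComplex θ₀) r)) ∧
    ∫⁻ z, supDensity Q θ₀ r z < ∞ ∧
    ∫⁻ z, supDensity Q θ₀ r z * (ENNReal.log (infDensity Q θ₀ r z)).abs < ∞ ∧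
    ∫⁻ z, supDensity Q θ₀ r z * (ENNReal.log (supDensity Q θ₀ r z)).abs < ∞

/-- Condition (d), for the column `I`. (i) The ratios `q^θ(z|j) / q^θ(z|I)`, indexed by `z`, are
equicontinuous in `θ` on some complex ball around `θ₀`. (ii) On some complex ball around `θ₀`,
each `log q^θ(z|I)` has a complex analytic extension `L`, for which
`sup_θ |q^θ(z|j) log q^θ(z|I)|` has a finite integral. -/
def ConditionD {l : ℕ} {ι : Type} [Fintype ι] (q : EuclideanSpace ℝ ι → Fin l → ℝ → ℝ)
    (Q : EuclideanSpace ℂ ι → Fin l → ℝ → ℂ) (θ₀ : EuclideanSpace ℝ ι) (I : Fin l) : Prop :=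
  (∃ r : ℝ, 0 < r ∧ ∀ j,
    EquicontinuousOn (fun (z : ℝ) (θ : EuclideanSpace ℂ ι) => Q θ j z / Q θ I z)
      (ball (toComplex θ₀) r)) ∧
  (∃ r : ℝ, 0 < r ∧ ∃ L : EuclideanSpace ℂ ι → ℝ → ℂ,
    (∀ z, IsComplexExtension (fun θ => Real.log (q θ I z)) (fun θ => L θ z) θ₀ r) ∧
    ∀ j, ∫⁻ z, (⨆ θ ∈ ball (toComplex θ₀) r, ‖Q θ j z * L θ z‖ₑ) < ∞)

/-- The column `I` dominates all the others, uniformly on a complex ball around `θ₀`. -/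
def ColumnDominates {l : ℕ} {ι : Type} [Fintype ι] (Q : EuclideanSpace ℂ ι → Fin l → ℝ → ℂ)
    (θ₀ : EuclideanSpace ℝ ι) (I : Fin l) : Prop :=
  ∃ r : ℝ, 0 < r ∧ ∀ δ : ℝ, 0 < δ → ∃ S : Set ℝ, IsCompact S ∧
    ∀ z ∉ S, ∀ j ≠ I, ∀ θ ∈ ball (toComplex θ₀) r, ‖Q θ j z / Q θ I z‖ ≤ δ

/-! ### Gaussian channels -/

/-- The additive Gaussian channel, with parameters `σᵢ = θ (inl i)` and `μᵢ = θ (inr i)`. -/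
def gaussianChannel {l : ℕ} (θ : EuclideanSpace ℝ (Fin l ⊕ Fin l)) (i : Fin l) (z : ℝ) : ℝ :=
  1 / (Real.sqrt (2 * Real.pi) * θ (Sum.inl i)) *
    Real.exp (-(z - θ (Sum.inr i)) ^ 2 / (2 * θ (Sum.inl i) ^ 2))

end HiddenMarkov

end

/-! ### Osgood's lemma -/

section Osgood

open Complex

/-! By the chain rule and Cesàro averaging, the entropy rate is minus the limit of the integrals of
p(z_0,…,z_n) log p(z_n | z_0,…,z_{n-1}). These integrals extend to complex parameters near the real
one. The point is that they converge there uniformly, with geometrically small increments; a uniform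
limit of holomorphic functions is holomorphic.

The conditional density depends on the past only through the projective class of the vector `orbit`,
produced from the initial weights by the matrices with entries Q_i(z) P_ik. Division by Q_I(z) does
not change that class and gives the entries (Q_i/Q_I)(z) P_ik. Equicontinuity keeps these close to
their real values uniformly in z, domination by column I bounds the real ratios q_i/q_I by some M,
and row I is just row I of P, hence bounded below for every z. So the real matrices satisfy a
Doeblin minorization uniform in z, and it survives small complex perturbations: vectors close to a
complex multiple of a positive vector stay so (`NearPositive.step`), and two such orbits approach
each other projectively at the rate 1 - p^6/4 (`ProjClose.step`, `NearPositive.projClose_orbit`).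
The logarithm of the conditional density is log Q_I plus the logarithm of a weighted mean of ratios
that stays in a right half-plane, so it forgets the remote past exponentially fast
(`IsClose.norm_logRatio_sub_le`).

A complexified density no longer has total mass one, but the integral of its modulus grows at most
like A^(2n), with A close to 1 near the real parameter. Normalization of Q_j and invariance of v
persist for complex parameters, so consecutive integrals differ only by the effect of forgetting one
output (`norm_integral_entropyIntegrand_sub_le`), which is of order (A²(1 - p^6/4))^n. This is
summable for A close to 1 (`exists_analyticOnNhd_limit`).

On the input side the complex parameter is the transition matrix itself, normalized to row sums one;
its stationary vector is a rational function of the entries (`exists_complex_stationary`). For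
Gaussian channels the log densities are quadratic polynomials in z with analytic coefficients, and a
strictly largest variance means strictly slowest decay; every condition follows from the resulting
quadratic bounds (`exists_gaussianPhase_bounds`). -/

lemma torusMap_mem_closedBall {n : ℕ} (c : Fin n → ℂ) {R : ℝ} (hR : 0 < R) (θ : Fin n → ℝ) :
    torusMap c (fun _ => R) θ ∈ closedBall c R := by
  rw [mem_closedBall, dist_pi_le_iff hR.le]
  intro i
  simp [torusMap, dist_eq_norm, abs_of_pos hR]

lemma continuous_torusMap {n : ℕ} (c : Fin n → ℂ) (R : Fin n → ℝ) : Continuous (torusMap c R) := by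
  unfold torusMap; fun_prop

lemma continuous_torusMap_apply {n : ℕ} (c : Fin n → ℂ) (R : Fin n → ℝ) (i : Fin n) :
    Continuous fun θ => torusMap c R θ i :=
  (continuous_apply i).comp (continuous_torusMap c R)

lemma torusMap_ne {n : ℕ} (c : Fin n → ℂ) {R : ℝ} (hR : 0 < R) (θ : Fin n → ℝ) (i : Fin n)
    {w : ℂ} (hw : w ∈ ball (c i) R) : torusMap c (fun _ => R) θ i - w ≠ 0 := by
  intro h
  rw [sub_eq_zero] at h
  rw [← h, mem_ball, dist_eq_norm] at hw
  simp [torusMap, abs_of_pos hR] at hw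

lemma cons_mem_closedBall {n : ℕ} {c : Fin (n + 1) → ℂ} {R : ℝ} (hR : 0 < R) {x : ℂ}
    {y : Fin n → ℂ} (hx : x ∈ closedBall (c 0) R) (hy : y ∈ closedBall (c ∘ Fin.succ) R) :
    (Fin.cons x y : Fin (n + 1) → ℂ) ∈ closedBall c R := by
  rw [mem_closedBall, dist_pi_le_iff hR.le] at *
  intro i
  refine Fin.cases ?_ (fun j => ?_) i
  · simpa using hx
  · simpa using hy j

/-- The Cauchy integral formula on a polydisc for a continuous separately holomorphic function. -/
theorem torusIntegral_cauchy {n : ℕ} : ∀ {f : (Fin n → ℂ) → ℂ} {c : Fin n → ℂ} {R : ℝ},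
    0 < R → ContinuousOn f (closedBall c R) →
    (∀ x ∈ closedBall c R, ∀ i, DifferentiableAt ℂ (fun t => f (Function.update x i t)) (x i)) →
    ∀ w ∈ ball c R,
    torusIntegral (fun x => (∏ i, (x i - w i)⁻¹) * f x) c (fun _ => R)
      = (2 * Real.pi * I) ^ n * f w := by
  induction n with
  | zero =>
    intro f c R hR hf hd w hw
    simp [Subsingleton.elim c w]
  | succ n ih =>
    intro f c R hR hf hd w hw
    have hwi : ∀ i, w i ∈ ball (c i) R := by
      rw [ball_pi _ hR] at hw; exact fun i => hw i (Set.mem_univ i)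
    have hint : TorusIntegrable (fun x : Fin (n+1) → ℂ => (∏ i, (x i - w i)⁻¹) * f x) c
        (fun _ => R) := by
      refine ContinuousOn.integrableOn_compact isCompact_Icc (Continuous.continuousOn ?_)
      refine Continuous.mul ?_ ?_
      · refine continuous_finsetProd _ fun i _ => Continuous.inv₀ ?_ fun θ => ?_
        · exact (continuous_torusMap_apply c _ i).sub continuous_const
        · exact torusMap_ne c hR θ i (hwi i)
      · exact hf.comp_continuous (continuous_torusMap c _) fun θ => torusMap_mem_closedBall c hR θ
    rw [torusIntegral_succ hint]
    have hwt : w ∘ Fin.succ ∈ ball (c ∘ Fin.succ) R := by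
      rw [ball_pi _ hR]; exact fun i _ => hwi i.succ
    -- For a fixed first coordinate the inner integral is an instance of the induction hypothesis.
    -- What remains is the Cauchy formula in the first coordinate alone.
    have key : ∀ x ∈ sphere (c 0) R,
        torusIntegral (fun y : Fin n → ℂ => (∏ i, ((Fin.cons x y : Fin (n+1) → ℂ) i - w i)⁻¹)
          * f (Fin.cons x y)) (c ∘ Fin.succ) (fun _ => R) =
        (x - w 0)⁻¹ * ((2 * Real.pi * I) ^ n * f (Fin.cons x (w ∘ Fin.succ))) := by
      intro x hx
      have hxc := sphere_subset_closedBall hx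
      have := ih (f := fun y => f (Fin.cons x y)) (c := c ∘ Fin.succ) hR
        (hf.comp (by fun_prop) fun y hy => cons_mem_closedBall hR hxc hy)
        (fun y hy i => by
          have := hd _ (cons_mem_closedBall hR hxc hy) i.succ
          simpa [← Fin.cons_update] using this) _ hwt
      rw [← this, ← torusIntegral_const_mul]
      congr 1
      ext y
      rw [Fin.prod_univ_succ]
      simp [mul_assoc]
    change circleIntegral (fun x => torusIntegral (fun y : Fin n → ℂ =>
      (∏ i, ((Fin.cons x y : Fin (n+1) → ℂ) i - w i)⁻¹) * f (Fin.cons x y)) (c ∘ Fin.succ)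
      (fun _ => R)) (c 0) R = _
    rw [circleIntegral.integral_congr hR.le key]
    have hcons : ∀ x, (Fin.cons x (w ∘ Fin.succ) : Fin (n+1) → ℂ) = Function.update w 0 x := by
      intro x; ext i; refine Fin.cases ?_ (fun j => ?_) i <;> simp
    have h1 := circleIntegral_sub_inv_smul_of_differentiable_on_off_countable
      (f := fun x => (2 * Real.pi * I) ^ n * f (Fin.cons x (w ∘ Fin.succ))) (c := c 0) (R := R)
      (w := w 0) Set.countable_empty (hwi 0)
      (continuousOn_const.mul (hf.comp (by fun_prop) fun x hx =>
        cons_mem_closedBall hR hx (ball_subset_closedBall hwt)))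
      (fun x hx => by
        have := hd _ (cons_mem_closedBall hR (ball_subset_closedBall hx.1)
          (ball_subset_closedBall hwt)) 0
        simp only [Fin.cons_zero, hcons, Function.update_idem] at this ⊢
        exact this.const_mul _)
    simp only [smul_eq_mul] at h1 ⊢
    rw [h1]
    have : (Fin.cons (w 0) (w ∘ Fin.succ) : Fin (n+1) → ℂ) = w := by rw [hcons]; simp
    rw [this]; ring

/-- **Osgood's lemma** on `ℂⁿ`, at the center of a polydisc. -/
theorem analyticAt_pi_of_separately {n : ℕ} {f : (Fin n → ℂ) → ℂ} {c : Fin n → ℂ} {R : ℝ}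
    (hR : 0 < R) (hf : ContinuousOn f (closedBall c R))
    (hd : ∀ x ∈ closedBall c R, ∀ i,
      DifferentiableAt ℂ (fun t => f (Function.update x i t)) (x i)) :
    AnalyticAt ℂ f c := by
  let K : Set (Fin n → ℝ) := Set.Icc 0 (fun _ => 2 * Real.pi)
  have : CompactSpace K := isCompact_iff_compactSpace.1 isCompact_Icc
  let a : Fin n → C(K, ℂ) := fun i => ⟨fun θ => torusMap c (fun _ => R) θ i,
    (continuous_torusMap_apply c (fun _ => R) i).comp continuous_subtype_val⟩
  let g : C(K, ℂ) := ⟨fun θ => (∏ i, (R : ℂ) * exp ((θ : Fin n → ℝ) i * I) * I)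
      * f (torusMap c (fun _ => R) θ), by
    refine Continuous.mul (continuous_finsetProd _ fun i _ => ?_) ?_
    · have : Continuous fun θ : K => (θ : Fin n → ℝ) i :=
        (continuous_apply i).comp continuous_subtype_val
      exact (continuous_const.mul (Complex.continuous_exp.comp
        ((Complex.continuous_ofReal.comp this).mul continuous_const))).mul continuous_const
    exact hf.comp_continuous ((continuous_torusMap c _).comp continuous_subtype_val)
      fun θ => torusMap_mem_closedBall c hR θ⟩
  let μ : Measure K := Measure.comap Subtype.val volume
  have hKm : MeasurableSet K := measurableSet_Icc
  have hμ : IsFiniteMeasure μ := ⟨by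
    rw [Measure.comap_apply _ Subtype.val_injective (fun s hs => hKm.subtype_image hs) _ .univ]
    simpa using isCompact_Icc.measure_lt_top⟩
  have hint : ∀ φ : C(K, ℂ), Integrable φ μ := fun φ =>
    Integrable.of_bound φ.continuous.aestronglyMeasurable ‖φ‖ (ae_of_all _ φ.norm_coe_le_norm)
  let J : C(K, ℂ) →L[ℂ] ℂ := LinearMap.mkContinuous
    { toFun := fun φ => ∫ θ, φ θ ∂μ
      map_add' := fun φ ψ => integral_add (hint φ) (hint ψ)
      map_smul' := fun z φ => integral_const_mul z _ } (μ.real Set.univ) fun φ => by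
    rw [mul_comm]
    exact norm_integral_le_of_norm_le_const (ae_of_all _ φ.norm_coe_le_norm)
  have hJ : ∀ φ : C(K, ℂ), J φ = ∫ θ, φ θ ∂μ := fun φ => rfl
  -- The denominators of the Cauchy kernel, as elements of the Banach algebra `C(K, ℂ)`. They are
  -- affine in `w`, inversion in a Banach algebra is analytic, and `J` is continuous linear; so the
  -- Cauchy integral is analytic in `w` without any power series computation.
  let k : Fin n → (Fin n → ℂ) → C(K, ℂ) := fun i w => a i - algebraMap ℂ C(K, ℂ) (w i)
  have hk : ∀ i, ∀ w ∈ ball c R, IsUnit (k i w) := by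
    intro i w hw
    rw [ball_pi _ hR] at hw
    rw [ContinuousMap.isUnit_iff_forall_ne_zero]
    intro θ
    exact torusMap_ne c hR θ i (hw i (Set.mem_univ i))
  have han : AnalyticAt ℂ (fun w => J ((∏ i, Ring.inverse (k i w)) * g)) c := by
    refine (J.analyticAt _).comp ?_
    refine AnalyticAt.mul ?_ analyticAt_const
    refine Finset.analyticAt_fun_prod _ fun i _ => ?_
    have h1 : AnalyticAt ℂ (k i) c := by
      refine analyticAt_const.sub ?_
      exact ((Algebra.linearMap ℂ C(K, ℂ)).mkContinuous ‖(1 : C(K,ℂ))‖ (fun z => by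
        rw [Algebra.linearMap_apply, Algebra.algebraMap_eq_smul_one, mul_comm]
        exact norm_smul_le _ _) ∘L
          (ContinuousLinearMap.proj (R := ℂ) (φ := fun _ : Fin n => ℂ) i)).analyticAt c
    have h2 := analyticAt_inverse (𝕜 := ℂ) (hk i c (mem_ball_self hR)).unit
    exact AnalyticAt.comp (g := Ring.inverse) (f := k i) h2 h1
  have heq : ∀ w ∈ ball c R, J ((∏ i, Ring.inverse (k i w)) * g)
      = (2 * Real.pi * I) ^ n * f w := by
    intro w hw
    rw [← torusIntegral_cauchy hR hf hd w hw, hJ, torusIntegral,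
      ← integral_subtype_comap hKm]
    congr 1
    ext θ
    have h2 : ∀ i, (Ring.inverse (k i w) : C(K, ℂ)) θ
        = (torusMap c (fun _ => R) θ i - w i)⁻¹ := by
      intro i
      have h3 := Ring.mul_inverse_cancel _ (hk i w hw)
      have h4 := congrArg (fun φ : C(K, ℂ) => φ θ) h3
      simp only [ContinuousMap.mul_apply, ContinuousMap.one_apply] at h4
      exact eq_inv_of_mul_eq_one_right h4
    simp only [ContinuousMap.mul_apply, ContinuousMap.prod_apply, h2, smul_eq_mul]
    have h6 : g θ = (∏ i, (R : ℂ) * exp ((θ : Fin n → ℝ) i * I) * I)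
      * f (torusMap c (fun _ => R) θ) := rfl
    rw [h6]
    ring
  have h5 : AnalyticAt ℂ (fun w => ((2 * Real.pi * I : ℂ) ^ n)⁻¹ *
      J ((∏ i, Ring.inverse (k i w)) * g)) c := analyticAt_const.mul han
  refine h5.congr ?_
  filter_upwards [ball_mem_nhds c hR] with w hw
  rw [heq w hw, inv_mul_cancel_left₀]
  simp [Real.pi_ne_zero]

variable {E : Type*} [NormedAddCommGroup E] [NormedSpace ℂ E] [FiniteDimensional ℂ E]

/-- **Osgood's lemma**: a continuous function on an open subset of a finite dimensional complex
space that is holomorphic on complex lines is analytic. -/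
theorem analyticOnNhd_of_continuousOn_of_lines {f : E → ℂ} {U : Set E} (hU : IsOpen U)
    (hf : ContinuousOn f U)
    (hd : ∀ x ∈ U, ∀ h : E, DifferentiableAt ℂ (fun t : ℂ => f (x + t • h)) 0) :
    AnalyticOnNhd ℂ f U := by
  intro x hx
  let e : E ≃L[ℂ] (Fin (Module.finrank ℂ E) → ℂ) :=
    ContinuousLinearEquiv.ofFinrankEq (by simp)
  have hUe : IsOpen (e.symm ⁻¹' U) := hU.preimage e.symm.continuous
  obtain ⟨R, hR, hRU⟩ := nhds_basis_closedBall.mem_iff.1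
    (hUe.mem_nhds (show e x ∈ e.symm ⁻¹' U by simpa using hx))
  have h1 : AnalyticAt ℂ (f ∘ e.symm) (e x) := by
    refine analyticAt_pi_of_separately hR
      (hf.comp e.symm.continuous.continuousOn fun y hy => hRU hy) ?_
    intro y hy i
    have h2 := hd (e.symm y) (hRU hy) (e.symm (Pi.single i 1))
    have h3 : DifferentiableAt ℂ (fun t : ℂ => t - y i) (y i) := by fun_prop
    have h4 := DifferentiableAt.comp (f := fun t : ℂ => t - y i)
      (g := fun t : ℂ => f (e.symm y + t • e.symm (Pi.single i 1))) (y i)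
      (by simpa using h2) h3
    refine h4.congr_of_eventuallyEq (Eventually.of_forall fun t => ?_)
    simp only [Function.comp_apply]
    rw [← e.symm.map_smul, ← e.symm.map_add]
    congr 2
    ext j
    by_cases hj : j = i
    · subst hj; simp
    · simp [hj]
  have h5 := h1.comp (e.toContinuousLinearMap.analyticAt x)
  refine h5.congr (Eventually.of_forall fun y => ?_)
  simp

/-- A uniform limit of analytic functions of several complex variables is analytic. -/
theorem analyticOnNhd_of_tendstoUniformlyOn {F : ℕ → E → ℂ} {f : E → ℂ} {U : Set E}
    (hU : IsOpen U) (hF : ∀ n, AnalyticOnNhd ℂ (F n) U)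
    (hlim : TendstoUniformlyOn F f atTop U) : AnalyticOnNhd ℂ f U := by
  refine analyticOnNhd_of_continuousOn_of_lines hU
    (hlim.continuousOn (Eventually.of_forall fun n => (hF n).continuousOn).frequently) ?_
  intro x hx h
  have hc : Continuous fun t : ℂ => x + t • h := by fun_prop
  have hV : IsOpen ((fun t : ℂ => x + t • h) ⁻¹' U) := hU.preimage hc
  have h0 : (0 : ℂ) ∈ (fun t : ℂ => x + t • h) ⁻¹' U := by simpa using hx
  have h1 : TendstoUniformlyOn (fun n t => F n (x + t • h)) (fun t => f (x + t • h)) atTop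
      ((fun t : ℂ => x + t • h) ⁻¹' U) := hlim.comp _
  refine (h1.tendstoLocallyUniformlyOn.differentiableOn (Eventually.of_forall fun n => ?_)
    hV).differentiableAt (hV.mem_nhds h0)
  exact (hF n).differentiableOn.comp (by fun_prop) fun t ht => ht

end Osgood

/-! ### Holomorphy of integrals depending on a parameter -/

section ParametricIntegral

variable {α : Type*} [MeasurableSpace α] {μ : Measure α}

/-- The integral of a dominated family of holomorphic functions is holomorphic. -/
theorem differentiableOn_integral_of_dominated {G : ℂ → α → ℂ} {U : Set ℂ} (hU : IsOpen U)
    (hm : ∀ z ∈ U, AEStronglyMeasurable (G z) μ)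
    (hd : ∀ a, DifferentiableOn ℂ (fun z => G z a) U) {D : α → ℝ} (hD : Integrable D μ)
    (hb : ∀ z ∈ U, ∀ a, ‖G z a‖ ≤ D a) :
    DifferentiableOn ℂ (fun z => ∫ a, G z a ∂μ) U := by
  intro z₀ hz₀
  obtain ⟨r, hr, hrU⟩ := nhds_basis_closedBall.mem_iff.1 (hU.mem_nhds hz₀)
  have hr2 : 0 < r / 2 := by positivity
  have hsub : ∀ z ∈ ball z₀ (r / 2), closedBall z (r / 2) ⊆ U := fun z hz =>
    (closedBall_subset_closedBall' (by rw [mem_ball] at hz; linarith)).trans hrU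
  have hzU : ∀ z ∈ ball z₀ (r / 2), z ∈ U := fun z hz =>
    hsub z hz (mem_closedBall_self hr2.le)
  have hda : ∀ a, ∀ z ∈ ball z₀ (r / 2), HasDerivAt (fun z => G z a) (deriv (fun z => G z a) z) z :=
    fun a z hz => ((hd a).differentiableAt (hU.mem_nhds (hzU z hz))).hasDerivAt
  -- A sequence that avoids `z₀` and stays within `r / 2` of it. The derivative at `z₀` is the
  -- pointwise limit of the difference quotients along it, hence measurable in `a`.
  have hseq : Tendsto (fun k : ℕ => z₀ + ((r / 2 * (1 / ((k : ℝ) + 2)) : ℝ) : ℂ)) atTop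
      (𝓝[≠] z₀) := by
    refine tendsto_nhdsWithin_iff.2 ⟨?_, Eventually.of_forall fun k => ?_⟩
    · have h1 : Tendsto (fun k : ℕ => (1 : ℝ) / ((k : ℝ) + 2)) atTop (𝓝 0) := by
        have := (tendsto_one_div_add_atTop_nhds_zero_nat (𝕜 := ℝ)).comp (tendsto_add_atTop_nat 1)
        refine this.congr fun k => ?_
        simp only [Function.comp_apply]; push_cast; ring_nf
      have h2 := ((Complex.continuous_ofReal.tendsto _).comp (h1.const_mul (r / 2))).const_add z₀
      simpa using! h2
    · have : (0 : ℝ) < r / 2 * (1 / ((k : ℝ) + 2)) := by positivity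
      simpa using (Complex.ofReal_ne_zero.2 this.ne')
  have hF' : AEStronglyMeasurable (fun a => deriv (fun z => G z a) z₀) μ := by
    refine aestronglyMeasurable_of_tendsto_ae atTop
      (f := fun (k : ℕ) a => slope (fun z => G z a) z₀
        (z₀ + ((r / 2 * (1 / ((k : ℝ) + 2)) : ℝ) : ℂ))) (fun k => ?_)
      (ae_of_all _ fun a => ?_)
    · simp only [slope, vsub_eq_sub]
      refine AEStronglyMeasurable.const_smul (𝕜 := ℂ) (((hm _ (hrU ?_)).sub (hm _ hz₀))) _
      have h0 : (0 : ℝ) < 1 / ((k : ℝ) + 2) := by positivity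
      have h1 : 1 / ((k : ℝ) + 2) ≤ 1 := by
        rw [div_le_one (by positivity)]; have := Nat.cast_nonneg (α := ℝ) k; linarith
      rw [mem_closedBall, dist_eq_norm, add_sub_cancel_left, Complex.norm_real,
        Real.norm_of_nonneg (by positivity)]
      nlinarith
    · exact ((hda a z₀ (mem_ball_self hr2)).tendsto_slope).comp hseq
  refine (hasDerivAt_integral_of_dominated_loc_of_deriv_le (bound := fun a => D a / (r / 2))
    (ball_mem_nhds z₀ hr2) ?_ ?_ hF' ?_ (hD.div_const _)
    (ae_of_all _ hda)).2.differentiableAt.differentiableWithinAt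
  · filter_upwards [ball_mem_nhds z₀ hr2] with z hz using hm z (hzU z hz)
  · exact hD.mono' (hm z₀ hz₀) (ae_of_all _ (hb z₀ hz₀))
  -- Cauchy's estimate on the circle of radius `r / 2` turns the bound on the functions into a bound
  -- on their derivatives.
  · refine ae_of_all _ fun a z hz => ?_
    refine Complex.norm_deriv_le_of_forall_mem_sphere_norm_le hr2 ?_ fun w hw =>
      hb w (hsub z hz (sphere_subset_closedBall hw)) a
    refine DifferentiableOn.diffContOnCl ((hd a).mono ?_)
    rw [closure_ball _ hr2.ne']
    exact hsub z hz

variable {E : Type*} [NormedAddCommGroup E] [NormedSpace ℂ E] [FiniteDimensional ℂ E]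

/-- The integral of a dominated family of analytic functions of several complex variables is
analytic. -/
theorem analyticOnNhd_integral_of_dominated {G : E → α → ℂ} {U : Set E} (hU : IsOpen U)
    (hm : ∀ x ∈ U, AEStronglyMeasurable (G x) μ)
    (hd : ∀ a, DifferentiableOn ℂ (fun x => G x a) U) {D : α → ℝ} (hD : Integrable D μ)
    (hb : ∀ x ∈ U, ∀ a, ‖G x a‖ ≤ D a) :
    AnalyticOnNhd ℂ (fun x => ∫ a, G x a ∂μ) U := by
  refine analyticOnNhd_of_continuousOn_of_lines hU ?_ ?_
  · exact continuousOn_of_dominated hm (fun x hx => ae_of_all _ (hb x hx)) hD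
      (ae_of_all _ fun a => (hd a).continuousOn)
  · intro x hx h
    have hV : IsOpen ((fun t : ℂ => x + t • h) ⁻¹' U) := hU.preimage (by fun_prop)
    have h0 : (0 : ℂ) ∈ (fun t : ℂ => x + t • h) ⁻¹' U := by simpa using hx
    exact (differentiableOn_integral_of_dominated hV (fun t ht => hm _ ht)
      (fun a => (hd a).comp (by fun_prop) fun t ht => ht) hD
      (fun t ht => hb _ ht)).differentiableAt (hV.mem_nhds h0)

end ParametricIntegral

/-! ### Uniqueness of complexifications -/

namespace HiddenMarkov

@[simp] lemma toComplex_apply {ι : Type} (θ : EuclideanSpace ℝ ι) (i : ι) : toComplex θ i = (θ i : ℂ) := rfl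

variable {ι : Type} [Fintype ι]

lemma norm_toComplex_sub (θ θ' : EuclideanSpace ℝ ι) :
    ‖toComplex θ - toComplex θ'‖ = ‖θ - θ'‖ := by
  rw [EuclideanSpace.norm_eq, EuclideanSpace.norm_eq]
  congr 1
  refine Finset.sum_congr rfl fun i _ => ?_
  simp only [PiLp.sub_apply, toComplex_apply]
  rw [← Complex.ofReal_sub, Complex.norm_real]

lemma toComplex_mem_ball {θ θ₀ : EuclideanSpace ℝ ι} {r : ℝ} :
    toComplex θ ∈ ball (toComplex θ₀) r ↔ θ ∈ ball θ₀ r := by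
  rw [mem_ball, mem_ball, dist_eq_norm, dist_eq_norm, norm_toComplex_sub]

/-- A holomorphic function on a ball around a real point that vanishes at the real points of the
ball vanishes. -/
theorem eq_zero_of_forall_toComplex {G : EuclideanSpace ℂ ι → ℂ} {θ₀ : EuclideanSpace ℝ ι} {r : ℝ}
    (hG : DifferentiableOn ℂ G (ball (toComplex θ₀) r))
    (h0 : ∀ θ, toComplex θ ∈ ball (toComplex θ₀) r → G (toComplex θ) = 0) :
    ∀ w ∈ ball (toComplex θ₀) r, G w = 0 := by
  intro w hw
  let a : EuclideanSpace ℝ ι := WithLp.toLp 2 fun i => (w i).re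
  let b : EuclideanSpace ℝ ι := WithLp.toLp 2 fun i => (w i).im
  -- The complex line through `w = a + i b` in the direction `b`: real `t` give real points, and `t
  -- = i` gives `w`. Its intersection with the ball is convex and contains `t = 0`, because `a` is
  -- no farther from the real center than `w`. So the one-variable identity theorem applies.
  let φ : ℂ → EuclideanSpace ℂ ι := fun t => toComplex a + t • toComplex b
  have hφ : Differentiable ℂ φ := by fun_prop
  let V : Set ℂ := φ ⁻¹' ball (toComplex θ₀) r
  have hV : IsOpen V := isOpen_ball.preimage hφ.continuous
  have hVc : IsPreconnected V := by
    refine Convex.isPreconnected ?_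
    intro s hs t ht α β hα hβ hαβ
    have hc := convex_ball (toComplex θ₀) r hs ht hα hβ hαβ
    have : φ (α • s + β • t) = α • φ s + β • φ t := by
      simp only [φ]
      rw [smul_add, smul_add, add_smul, smul_assoc, smul_assoc, add_add_add_comm, ← add_smul, hαβ,
        one_smul]
    change φ _ ∈ ball (toComplex θ₀) r
    rwa [this]
  have hfφ : DifferentiableOn ℂ (fun t => G (φ t)) V := hG.comp hφ.differentiableOn fun t ht => ht
  have hreal : ∀ t : ℝ, φ t = toComplex (a + t • b) := by
    intro t; ext i; simp [φ]
  have h0V : (0 : ℂ) ∈ V := by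
    have h1 : ‖toComplex a - toComplex θ₀‖ ≤ ‖w - toComplex θ₀‖ := by
      rw [EuclideanSpace.norm_eq, EuclideanSpace.norm_eq]
      refine Real.sqrt_le_sqrt (Finset.sum_le_sum fun i _ => ?_)
      have : ((w - toComplex θ₀) i).re = a i - θ₀ i := by simp [a]
      have h2 : (toComplex a - toComplex θ₀) i = ((((w - toComplex θ₀) i).re : ℝ) : ℂ) := by
        rw [this]; simp
      rw [h2, Complex.norm_real, Real.norm_eq_abs]
      exact pow_le_pow_left₀ (abs_nonneg _) (Complex.abs_re_le_norm _) 2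
    rw [mem_ball, dist_eq_norm] at hw
    simpa [V, φ, dist_eq_norm] using h1.trans_lt hw
  have hfreq : ∃ᶠ t in 𝓝[≠] (0 : ℂ), G (φ t) = 0 := by
    have h1 : Tendsto (fun t : ℝ => (t : ℂ)) (𝓝[≠] 0) (𝓝[≠] 0) := by
      refine tendsto_nhdsWithin_iff.2 ⟨?_, ?_⟩
      · simpa using! (Complex.continuous_ofReal.tendsto 0).mono_left nhdsWithin_le_nhds
      · filter_upwards [self_mem_nhdsWithin] with t ht
        simpa using ht
    refine h1.frequently (Eventually.frequently ?_)
    have h2 : ∀ᶠ t : ℝ in 𝓝 0, (t : ℂ) ∈ V :=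
      Complex.continuous_ofReal.continuousAt (hV.mem_nhds (by simpa using h0V))
    filter_upwards [nhdsWithin_le_nhds h2] with t ht
    rw [hreal t]
    exact h0 _ (by simpa [V, hreal] using ht)
  have hz := (hfφ.analyticOnNhd hV).eqOn_zero_of_preconnected_of_frequently_eq_zero hVc h0V hfreq
  have hwφ : φ Complex.I = w := by
    ext i
    simp only [φ, PiLp.add_apply, PiLp.smul_apply, toComplex_apply, a, b, smul_eq_mul]
    rw [mul_comm, Complex.re_add_im]
  have hIV : Complex.I ∈ V := by simpa [V, hwφ] using hw
  simpa [hwφ] using hz hIV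

end HiddenMarkov

/-! ### Complex perturbations of positive matrices -/

namespace HiddenMarkov

variable {l : ℕ}

/-- Row vector times matrix. -/
def rowStep (m : Fin l → Fin l → ℂ) (y : Fin l → ℂ) (k : Fin l) : ℂ := ∑ i, y i * m i k

/-- `y` is, up to a complex factor, within relative distance `δ` of a real positive vector whose
entries have ratios at least `p`. -/
def NearPositive (p δ : ℝ) (y : Fin l → ℂ) : Prop :=
  ∃ (x : Fin l → ℝ) (c : ℂ), c ≠ 0 ∧ (∀ i, 0 < x i) ∧ (∀ i k, p * x i ≤ x k) ∧
    ∀ i, ‖y i - c * x i‖ ≤ δ * ‖c‖ * x i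

/-- Up to a complex factor, `y'` is within relative distance `t` of `y`. -/
def ProjClose (t : ℝ) (y y' : Fin l → ℂ) : Prop :=
  ∃ c : ℂ, c ≠ 0 ∧ ∀ i, ‖y' i - c * y i‖ ≤ t * ‖c‖ * ‖y i‖

/-- `m₀` is a nonnegative matrix with rows of oscillation at most `1 / p` whose row `I` is bounded
below by `p`, and `m` is a complex matrix at distance at most `η` from `m₀`. -/
structure IsPerturbation (p η : ℝ) (I : Fin l) (m₀ : Fin l → Fin l → ℝ)
    (m : Fin l → Fin l → ℂ) : Prop where
  nonneg : ∀ i k, 0 ≤ m₀ i k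
  ratio : ∀ i j k, p * m₀ i j ≤ m₀ i k
  row : ∀ k, p ≤ m₀ I k
  close : ∀ i k, ‖m i k - m₀ i k‖ ≤ η

variable {p δ η : ℝ} {I : Fin l} {m₀ : Fin l → Fin l → ℝ} {m : Fin l → Fin l → ℂ}

section Step

variable {x : Fin l → ℝ}

/-- The other rows may be arbitrarily small, so row `I` alone has to supply the lower bound. -/
lemma IsPerturbation.sum_ge (hm : IsPerturbation p η I m₀ m) (hx : ∀ i, 0 < x i) (k : Fin l) :
    x I * p ≤ ∑ i, x i * m₀ i k :=
  (mul_le_mul_of_nonneg_left (hm.row k) (hx I).le).trans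
    (Finset.single_le_sum (f := fun i => x i * m₀ i k)
      (fun i _ => mul_nonneg (hx i).le (hm.nonneg i k)) (Finset.mem_univ I))

lemma IsPerturbation.sum_pos (hm : IsPerturbation p η I m₀ m) (hp : 0 < p) (hx : ∀ i, 0 < x i)
    (k : Fin l) : 0 < ∑ i, x i * m₀ i k :=
  (mul_pos (hx I) hp).trans_le (hm.sum_ge hx k)

lemma IsPerturbation.sum_ratio (hm : IsPerturbation p η I m₀ m) (hx : ∀ i, 0 < x i)
    (j k : Fin l) : p * ∑ i, x i * m₀ i j ≤ ∑ i, x i * m₀ i k := by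
  rw [Finset.mul_sum]
  refine Finset.sum_le_sum fun i _ => ?_
  have := mul_le_mul_of_nonneg_left (hm.ratio i j k) (hx i).le
  linarith

/-- Sums of a vector with ratios at least `p`. -/
lemma sum_le_of_ratio (hxp : ∀ i k, p * x i ≤ x k) : p * ∑ i, x i ≤ l * x I := by
  rw [Finset.mul_sum]
  refine (Finset.sum_le_sum fun i _ => hxp i I).trans ?_
  simp

/-- Averages with respect to the columns of a positive matrix contract to a common center. -/
lemma IsPerturbation.norm_average_sub_le (hm : IsPerturbation p η I m₀ m) (hp : 0 < p)
    (hx : ∀ i, 0 < x i) {e : Fin l → ℂ} {r : ℝ} (he : ∀ i, ‖e i‖ ≤ r) :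
    ∃ a : ℂ, ‖a‖ ≤ r ∧ ∀ k, ‖∑ i, e i * (x i * m₀ i k : ℝ) - (p ^ 2 : ℝ) * a *
      (∑ i, x i * m₀ i k : ℝ)‖ ≤ r * ((1 - p ^ 2) * ∑ i, x i * m₀ i k) := by
  set X : Fin l → ℝ := fun k => ∑ i, x i * m₀ i k with hX
  have hXpos : ∀ k, 0 < X k := hm.sum_pos hp hx
  have hw : ∀ i k, 0 ≤ x i * m₀ i k := fun i k => mul_nonneg (hx i).le (hm.nonneg i k)
  -- Doeblin's argument with the average over column `I` as the common center. The normalized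
  -- weights of any column `k` are at least `p ^ 2` times those of column `I`, one factor `p` coming
  -- from the entries and one from the normalizations `X`. The remaining weights have mass `1 - p ^
  -- 2`.
  refine ⟨∑ i, e i * (x i * m₀ i I / X I : ℝ), ?_, fun k => ?_⟩
  · calc _ ≤ ∑ i, r * (x i * m₀ i I / X I) := by
          refine norm_sum_le_of_le _ fun i _ => ?_
          rw [norm_mul, Complex.norm_real, Real.norm_of_nonneg (div_nonneg (hw i I) (hXpos I).le)]
          exact mul_le_mul_of_nonneg_right (he i) (div_nonneg (hw i I) (hXpos I).le)
      _ = r := by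
          rw [← Finset.mul_sum, ← Finset.sum_div, div_self (hXpos I).ne', mul_one]
  · have hb : ∀ i, 0 ≤ x i * m₀ i k - p ^ 2 * (x i * m₀ i I / X I) * X k := by
      intro i
      have h1 : p * X k ≤ X I := hm.sum_ratio hx k I
      have h2 : p * (x i * m₀ i I) ≤ x i * m₀ i k := by
        have := mul_le_mul_of_nonneg_left (hm.ratio i I k) (hx i).le
        linarith
      have h3 : p ^ 2 * (x i * m₀ i I / X I) * X k = p * (x i * m₀ i I) * (p * X k / X I) := by
        ring
      have h4 : p * X k / X I ≤ 1 := (div_le_one (hXpos I)).2 h1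
      have h5 := mul_le_mul_of_nonneg_left h4 (mul_nonneg hp.le (hw i I))
      rw [h3]; linarith
    have hsum : ∑ i, (x i * m₀ i k - p ^ 2 * (x i * m₀ i I / X I) * X k) = (1 - p ^ 2) * X k := by
      rw [Finset.sum_sub_distrib, ← Finset.sum_mul, ← Finset.mul_sum, ← Finset.sum_div,
        div_self (hXpos I).ne']
      ring
    have heq : ∑ i, e i * (x i * m₀ i k : ℝ) - (p ^ 2 : ℝ) * (∑ i, e i * (x i * m₀ i I / X I : ℝ)) *
        (X k : ℝ) = ∑ i, e i * ((x i * m₀ i k - p ^ 2 * (x i * m₀ i I / X I) * X k : ℝ) : ℂ) := by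
      rw [Finset.mul_sum, Finset.sum_mul, ← Finset.sum_sub_distrib]
      refine Finset.sum_congr rfl fun i _ => ?_
      push_cast; ring
    change ‖∑ i, e i * (x i * m₀ i k : ℝ) - (p ^ 2 : ℝ) * (∑ i, e i * (x i * m₀ i I / X I : ℝ)) *
        (X k : ℝ)‖ ≤ r * ((1 - p ^ 2) * X k)
    rw [heq, ← hsum, Finset.mul_sum]
    refine norm_sum_le_of_le _ fun i _ => ?_
    rw [norm_mul, Complex.norm_real, Real.norm_of_nonneg (hb i)]
    exact mul_le_mul_of_nonneg_right (he i) (hb i)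

variable {y : Fin l → ℂ} {c : ℂ}

lemma norm_le_of_near (hy : ∀ i, ‖y i - c * x i‖ ≤ δ * ‖c‖ * x i) (hx : ∀ i, 0 < x i)
    (i : Fin l) : ‖y i‖ ≤ (1 + δ) * ‖c‖ * x i := by
  have h1 := norm_add_le (y i - c * x i) (c * x i)
  rw [sub_add_cancel, norm_mul, Complex.norm_real, Real.norm_of_nonneg (hx i).le] at h1
  linarith [hy i]

lemma le_norm_of_near (hy : ∀ i, ‖y i - c * x i‖ ≤ δ * ‖c‖ * x i) (hx : ∀ i, 0 < x i)
    (i : Fin l) : (1 - δ) * ‖c‖ * x i ≤ ‖y i‖ := by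
  have h1 := norm_sub_norm_le (c * x i) (y i)
  rw [norm_sub_rev, norm_mul, Complex.norm_real, Real.norm_of_nonneg (hx i).le] at h1
  linarith [hy i]

/-- The perturbation of the matrix is small relative to the image of a near positive vector. -/
lemma IsPerturbation.sum_error_le (hm : IsPerturbation p η I m₀ m) (hp : 0 < p) (hη : 0 ≤ η)
    (hδ : δ ≤ 1 / 2) (hηδ : 3 * η * l ≤ δ * p ^ 4)
    (hx : ∀ i, 0 < x i) (hxp : ∀ i k, p * x i ≤ x k)
    (hy : ∀ i, ‖y i - c * x i‖ ≤ δ * ‖c‖ * x i) (k : Fin l) :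
    ∑ i, ‖y i‖ * ‖m i k - m₀ i k‖ ≤ ‖c‖ * (δ * p ^ 2 / 2) * ∑ i, x i * m₀ i k := by
  have h1 : ∑ i, ‖y i‖ * ‖m i k - m₀ i k‖ ≤ ∑ i, (3 / 2 * ‖c‖ * x i) * η := by
    refine Finset.sum_le_sum fun i _ => mul_le_mul ?_ (hm.close i k) (norm_nonneg _) ?_
    · refine (norm_le_of_near hy hx i).trans ?_
      have := mul_nonneg (norm_nonneg c) (hx i).le
      nlinarith
    · have := mul_nonneg (norm_nonneg c) (hx i).le
      nlinarith
  rw [← Finset.sum_mul, ← Finset.mul_sum] at h1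
  refine h1.trans ?_
  have h2 : p * ∑ i, x i ≤ l * x I := sum_le_of_ratio hxp
  have h3 := hm.sum_ge hx k
  set X := ∑ i, x i * m₀ i k
  have hXI := hx I
  -- The factor `p ^ 2` avoids divisions: one `p` compares the sum of `x` with `l * x I`, the other
  -- compares `x I` with `X` through row `I`.
  have h4 : p ^ 2 * (3 * η * ∑ i, x i) ≤ p ^ 2 * (δ * p ^ 2 * X) := by
    calc p ^ 2 * (3 * η * ∑ i, x i) = 3 * η * p * (p * ∑ i, x i) := by ring
      _ ≤ 3 * η * p * (l * x I) := mul_le_mul_of_nonneg_left h2 (by positivity)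
      _ = (3 * η * l) * (x I * p) := by ring
      _ ≤ (δ * p ^ 4) * (x I * p) := mul_le_mul_of_nonneg_right hηδ (by positivity)
      _ ≤ (δ * p ^ 4) * X := by
          refine mul_le_mul_of_nonneg_left h3 (le_trans ?_ hηδ)
          positivity
      _ = _ := by ring
  have h5 := le_of_mul_le_mul_left h4 (by positivity)
  have h6 := mul_le_mul_of_nonneg_left h5 (norm_nonneg c)
  nlinarith

end Step

/-- Near positive vectors are mapped to near positive vectors. -/
theorem NearPositive.step (hm : IsPerturbation p η I m₀ m) (hp : 0 < p) (hp1 : p ≤ 1) (hη : 0 ≤ η)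
    (hδ0 : 0 < δ) (hδ : δ ≤ 1 / 2) (hηδ : 3 * η * l ≤ δ * p ^ 4) {y : Fin l → ℂ}
    (hy : NearPositive p δ y) : NearPositive p δ (rowStep m y) := by
  obtain ⟨x, c, hc, hx, hxp, hy⟩ := hy
  have hc0 := norm_pos_iff.2 hc
  have hp2 : p ^ 2 ≤ 1 := pow_le_one₀ hp.le hp1
  set e : Fin l → ℂ := fun i => (y i - c * x i) / x i with he
  have hx' : ∀ i, (x i : ℂ) ≠ 0 := fun i => Complex.ofReal_ne_zero.2 (hx i).ne'
  have her : ∀ i, ‖e i‖ ≤ δ * ‖c‖ := by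
    intro i
    rw [he]
    simp only [norm_div, Complex.norm_real, Real.norm_of_nonneg (hx i).le]
    rw [div_le_iff₀ (hx i)]
    exact hy i
  obtain ⟨a, ha, hak⟩ := hm.norm_average_sub_le hp hx her
  have hcn : (1 - p ^ 2 / 2) * ‖c‖ ≤ ‖c + (p ^ 2 : ℝ) * a‖ := by
    have h1 := norm_sub_norm_le c (-((p ^ 2 : ℝ) * a))
    rw [sub_neg_eq_add, norm_neg, norm_mul, Complex.norm_real,
      Real.norm_of_nonneg (by positivity)] at h1
    have h2 : p ^ 2 * ‖a‖ ≤ p ^ 2 * (1 / 2 * ‖c‖) :=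
      mul_le_mul_of_nonneg_left (ha.trans (mul_le_mul_of_nonneg_right hδ hc0.le)) (by positivity)
    linarith
  -- The new complex factor absorbs the common part of the averaged relative errors. The error left
  -- over is `(1 - p ^ 2) δ ‖c‖` from averaging plus `p ^ 2 δ ‖c‖ / 2` from the perturbation, which
  -- is at most `δ` times the norm of the new factor by `hcn`.
  refine ⟨fun k => ∑ i, x i * m₀ i k, c + (p ^ 2 : ℝ) * a, ?_, hm.sum_pos hp hx,
    hm.sum_ratio hx, fun k => ?_⟩
  · rw [← norm_pos_iff]
    refine lt_of_lt_of_le (mul_pos ?_ hc0) hcn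
    linarith
  · have hX := hm.sum_pos hp hx k
    have heq : rowStep m y k - (c + (p ^ 2 : ℝ) * a) * ((∑ i, x i * m₀ i k : ℝ) : ℂ) =
        (∑ i, e i * (x i * m₀ i k : ℝ) - (p ^ 2 : ℝ) * a * (∑ i, x i * m₀ i k : ℝ)) +
        ∑ i, y i * (m i k - m₀ i k) := by
      have h1 : ∀ i, y i = c * x i + e i * x i := by
        intro i; rw [he]; simp only; rw [div_mul_cancel₀ _ (hx' i)]; ring
      have h2 : rowStep m y k = ∑ i, y i * (m i k - m₀ i k) + c * ((∑ i, x i * m₀ i k : ℝ) : ℂ)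
          + ∑ i, e i * (x i * m₀ i k : ℝ) := by
        rw [rowStep]
        push_cast
        rw [Finset.mul_sum, ← Finset.sum_add_distrib, ← Finset.sum_add_distrib]
        refine Finset.sum_congr rfl fun i _ => ?_
        have : y i * m i k = y i * (m i k - m₀ i k) + y i * m₀ i k := by ring
        rw [this]
        nth_rewrite 2 [h1 i]
        ring
      rw [h2]; ring
    rw [heq]
    refine (norm_add_le _ _).trans ?_
    have h3 := hm.sum_error_le hp hη hδ hηδ hx hxp hy k
    have h4 : ‖∑ i, y i * (m i k - m₀ i k)‖ ≤ ∑ i, ‖y i‖ * ‖m i k - m₀ i k‖ :=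
      norm_sum_le_of_le _ fun i _ => (norm_mul _ _).le
    have h5 := mul_le_mul_of_nonneg_right (mul_le_mul_of_nonneg_left hcn hδ0.le) hX.le
    have h6 := hak k
    nlinarith

/-- The projective distance between two orbits contracts. -/
theorem ProjClose.step (hm : IsPerturbation p η I m₀ m) (hp : 0 < p) (hp1 : p ≤ 1) (hη : 0 ≤ η)
    (hδ0 : 0 < δ) {σ t : ℝ} (hσ : 0 < σ) (hσ1 : σ ≤ 1) (hδ : 16 * δ ≤ p ^ 2 * σ)
    (hηδ : 3 * η * l ≤ δ * p ^ 4) {y y' : Fin l → ℂ}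
    (hy : NearPositive p δ y) (ht0 : 0 ≤ t) (ht : t ≤ 1 - σ) (h : ProjClose t y y') :
    ProjClose ((1 - p ^ 2 * σ / 2) * t) (rowStep m y) (rowStep m y') := by
  obtain ⟨x, b, hb, hx, hxp, hy⟩ := hy
  obtain ⟨c, hc, hcy⟩ := h
  have hc0 := norm_pos_iff.2 hc
  have hb0 := norm_pos_iff.2 hb
  have hp2 : p ^ 2 ≤ 1 := pow_le_one₀ hp.le hp1
  have hpσ : p ^ 2 * σ ≤ 1 := mul_le_one₀ hp2 hσ.le hσ1
  have hδ2 : δ ≤ 1 / 2 := by linarith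
  have hyn : ∀ i, 0 < ‖y i‖ := fun i =>
    lt_of_lt_of_le (mul_pos (mul_pos (by linarith) hb0) (hx i)) (le_norm_of_near hy hx i)
  have hyi : ∀ i, y i ≠ 0 := fun i => norm_pos_iff.1 (hyn i)
  -- The errors are taken relative to `y`, but averaged with the positive weights `x i * m₀ i k`;
  -- `err` below measures the price of replacing the complex weights `y i * m i k` by `b` times
  -- these.
  set e : Fin l → ℂ := fun i => (y' i - c * y i) / y i with he
  have her : ∀ i, ‖e i‖ ≤ t * ‖c‖ := by
    intro i
    rw [he]
    simp only [norm_div]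
    rw [div_le_iff₀ (hyn i)]
    exact hcy i
  obtain ⟨a, ha, hak⟩ := hm.norm_average_sub_le hp hx her
  -- Here `t ≤ 1 - σ` is essential: the ideal contraction factor `(1 - p ^ 2) / (1 - p ^ 2 * t)`
  -- tends to 1 as `t` tends to 1, and the `σ` term keeps the denominator strictly above the
  -- numerator.
  have hcn : (1 - p ^ 2 + p ^ 2 * σ) * ‖c‖ ≤ ‖c + (p ^ 2 : ℝ) * a‖ := by
    have h1 := norm_sub_norm_le c (-((p ^ 2 : ℝ) * a))
    rw [sub_neg_eq_add, norm_neg, norm_mul, Complex.norm_real,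
      Real.norm_of_nonneg (by positivity)] at h1
    have h2 : p ^ 2 * ‖a‖ ≤ p ^ 2 * ((1 - σ) * ‖c‖) :=
      mul_le_mul_of_nonneg_left (ha.trans (mul_le_mul_of_nonneg_right ht hc0.le)) (by positivity)
    linarith
  refine ⟨c + (p ^ 2 : ℝ) * a, ?_, fun k => ?_⟩
  · rw [← norm_pos_iff]
    refine lt_of_lt_of_le (mul_pos ?_ hc0) hcn
    have : 0 < p ^ 2 * σ := by positivity
    linarith
  · have hX := hm.sum_pos hp hx k
    set X := ∑ i, x i * m₀ i k with hXdef
    set err : Fin l → ℂ := fun i => y i * m i k - b * (x i * m₀ i k : ℝ) with herr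
    have herr_le : ∑ i, ‖err i‖ ≤ 2 * δ * ‖b‖ * X := by
      have h1 : ∀ i, ‖err i‖ ≤ δ * ‖b‖ * (x i * m₀ i k) + ‖y i‖ * ‖m i k - m₀ i k‖ := by
        intro i
        have : err i = (y i - b * x i) * m₀ i k + y i * (m i k - m₀ i k) := by
          rw [herr]; push_cast; ring
        rw [this]
        refine (norm_add_le _ _).trans ?_
        rw [norm_mul, norm_mul, Complex.norm_real, Real.norm_of_nonneg (hm.nonneg i k)]
        have := mul_le_mul_of_nonneg_right (hy i) (hm.nonneg i k)
        linarith
      have h2 := Finset.sum_le_sum (s := Finset.univ) fun i _ => h1 i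
      rw [Finset.sum_add_distrib, ← Finset.mul_sum] at h2
      have h3 := hm.sum_error_le hp hη hδ2 hηδ hx hxp hy k
      have h4 : ‖b‖ * (δ * p ^ 2 / 2) * X ≤ δ * ‖b‖ * X := by
        refine mul_le_mul_of_nonneg_right ?_ hX.le
        have := mul_nonneg hb0.le hδ0.le
        nlinarith
      linarith
    have hstep : rowStep m y k = b * X + ∑ i, err i := by
      rw [rowStep, herr, Finset.sum_sub_distrib, hXdef]
      push_cast
      rw [Finset.mul_sum]; ring
    have heq : rowStep m y' k - (c + (p ^ 2 : ℝ) * a) * rowStep m y k =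
        b * (∑ i, e i * (x i * m₀ i k : ℝ) - (p ^ 2 : ℝ) * a * (X : ℝ)) + ∑ i, e i * err i
          - (p ^ 2 : ℝ) * a * ∑ i, err i := by
      have h1 : ∀ i, y' i = c * y i + e i * y i := by
        intro i; rw [he]; simp only; rw [div_mul_cancel₀ _ (hyi i)]; ring
      have h2 : rowStep m y' k = c * rowStep m y k + b * ∑ i, e i * (x i * m₀ i k : ℝ) +
          ∑ i, e i * err i := by
        rw [rowStep, rowStep, Finset.mul_sum, Finset.mul_sum, ← Finset.sum_add_distrib,
          ← Finset.sum_add_distrib]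
        refine Finset.sum_congr rfl fun i _ => ?_
        rw [h1 i, herr]
        push_cast
        ring
      rw [h2, add_mul, hstep]; ring
    rw [heq]
    have hE : ‖∑ i, err i‖ ≤ 2 * δ * ‖b‖ * X := (norm_sum_le _ _).trans herr_le
    have h1 : ‖b * (∑ i, e i * (x i * m₀ i k : ℝ) - (p ^ 2 : ℝ) * a * (X : ℝ))‖ ≤
        ‖b‖ * (t * ‖c‖ * ((1 - p ^ 2) * X)) := by
      rw [norm_mul]; exact mul_le_mul_of_nonneg_left (hak k) hb0.le
    have h2 : ‖∑ i, e i * err i‖ ≤ t * ‖c‖ * (2 * δ * ‖b‖ * X) := by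
      refine le_trans (norm_sum_le_of_le (n := fun i => t * ‖c‖ * ‖err i‖) _ fun i _ => ?_) ?_
      · rw [norm_mul]; exact mul_le_mul_of_nonneg_right (her i) (norm_nonneg _)
      · rw [← Finset.mul_sum]
        exact mul_le_mul_of_nonneg_left herr_le (by positivity)
    have h3 : ‖(p ^ 2 : ℝ) * a * ∑ i, err i‖ ≤ t * ‖c‖ * (2 * δ * ‖b‖ * X) := by
      rw [norm_mul, norm_mul, Complex.norm_real, Real.norm_of_nonneg (by positivity)]
      refine mul_le_mul ?_ hE (norm_nonneg _) (by positivity)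
      have := mul_le_mul_of_nonneg_right hp2 (norm_nonneg a)
      linarith
    have hlow : (1 - 2 * δ) * (‖b‖ * X) ≤ ‖rowStep m y k‖ := by
      have h4 := norm_sub_norm_le (b * X : ℂ) (-∑ i, err i)
      rw [sub_neg_eq_add, norm_neg, norm_mul, Complex.norm_real, Real.norm_of_nonneg hX.le,
        ← hstep] at h4
      linarith
    have hup := (norm_sub_le _ _).trans (add_le_add ((norm_add_le _ _).trans (add_le_add h1 h2)) h3)
    refine hup.trans ?_
    -- Left: contraction by `1 - p ^ 2` plus two error terms of relative size `2 * δ`. Right: the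
    -- claimed factor times the lower bounds for the new center and for `rowStep m y k`. Since `4 *
    -- δ ≤ p ^ 2 * σ / 4`, the gain `p ^ 2 * σ` pays both for the errors and for the factor `1 - p ^
    -- 2 * σ / 2`.
    have hnum : 1 - p ^ 2 + 4 * δ ≤
        (1 - p ^ 2 * σ / 2) * ((1 - p ^ 2 + p ^ 2 * σ) * (1 - 2 * δ)) := by
      set κ := p ^ 2
      set τ := κ * σ with hτ
      have hτκ : τ ≤ κ := by
        rw [hτ]; exact mul_le_of_le_one_right (by positivity) hσ1
      have hτ0 : 0 ≤ τ := by positivity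
      have hq : 1 - κ + 7 / 8 * τ ≤ (1 - κ + τ) * (1 - 2 * δ) := by nlinarith
      have hq2 : 1 - κ + 4 * δ ≤ (1 - τ / 2) * (1 - κ + 7 / 8 * τ) := by nlinarith
      exact hq2.trans (mul_le_mul_of_nonneg_left hq (by linarith))
    have hA : 0 ≤ t * ‖c‖ * (‖b‖ * X) := by positivity
    calc ‖b‖ * (t * ‖c‖ * ((1 - p ^ 2) * X)) + t * ‖c‖ * (2 * δ * ‖b‖ * X)
          + t * ‖c‖ * (2 * δ * ‖b‖ * X) = (1 - p ^ 2 + 4 * δ) * (t * ‖c‖ * (‖b‖ * X)) := by ring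
      _ ≤ ((1 - p ^ 2 * σ / 2) * ((1 - p ^ 2 + p ^ 2 * σ) * (1 - 2 * δ))) *
          (t * ‖c‖ * (‖b‖ * X)) := mul_le_mul_of_nonneg_right hnum hA
      _ = ((1 - p ^ 2 * σ / 2) * t) * ((1 - p ^ 2 + p ^ 2 * σ) * ‖c‖) *
          ((1 - 2 * δ) * (‖b‖ * X)) := by ring
      _ ≤ _ := by
          have h0 : 0 ≤ (1 - p ^ 2 * σ / 2) * t := mul_nonneg (by linarith) ht0
          have h9 : 0 ≤ p ^ 2 * σ := by positivity
          refine mul_le_mul (mul_le_mul_of_nonneg_left hcn h0) hlow ?_ ?_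
          · exact mul_nonneg (by linarith) (by positivity)
          · exact mul_nonneg h0 (norm_nonneg _)

/-- Two near positive vectors are projectively close, at a distance bounded away from one. -/
theorem NearPositive.projClose (hp : 0 < p) (hp1 : p ≤ 1) (hδ0 : 0 < δ) (hδ : 6 * δ ≤ p ^ 4)
    (I : Fin l) {y y' : Fin l → ℂ}
    (hy : NearPositive p δ y) (hy' : NearPositive p δ y') : ProjClose (1 - p ^ 4 / 2) y y' := by
  obtain ⟨x, c, hc, hx, hxp, hy⟩ := hy
  obtain ⟨x', c', hc', hx', hxp', hy'⟩ := hy'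
  have hc0 := norm_pos_iff.2 hc
  have hc0' := norm_pos_iff.2 hc'
  have hp4 : p ^ 4 ≤ 1 := pow_le_one₀ hp.le hp1
  -- This scaling makes `b * x` dominate `x'` in every coordinate, while the ratio bounds on both
  -- vectors still give `p ^ 4 * (b * x) ≤ x'`. So `x'` is within relative distance `1 - p ^ 4` of
  -- `b * x`; half of the margin `p ^ 4` is spent on the complex errors.
  set b : ℝ := x' I / x I / p ^ 2 with hb
  have hb0 : 0 < b := div_pos (div_pos (hx' I) (hx I)) (by positivity)
  have hbI : b * p ^ 2 * x I = x' I := by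
    have := (hx I).ne'
    rw [hb]; field_simp
  have hC : ‖c' / c * (b : ℂ)‖ = ‖c'‖ * b / ‖c‖ := by
    rw [norm_mul, norm_div, Complex.norm_real, Real.norm_of_nonneg hb0.le]; ring
  refine ⟨c' / c * b, ?_, fun i => ?_⟩
  · rw [← norm_pos_iff, hC]; positivity
  have hu1 : x' i ≤ b * x i := by
    have h1 := hxp' i I
    have h2 := hxp I i
    have h3 : p * x' i ≤ p * (b * x i) := by
      calc p * x' i ≤ x' I := h1
        _ = b * p * (p * x I) := by rw [← hbI]; ring
        _ ≤ b * p * x i := mul_le_mul_of_nonneg_left h2 (by positivity)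
        _ = _ := by ring
    exact le_of_mul_le_mul_left h3 hp
  have hu2 : p ^ 4 * (b * x i) ≤ x' i := by
    calc p ^ 4 * (b * x i) = b * p ^ 3 * (p * x i) := by ring
      _ ≤ b * p ^ 3 * x I := mul_le_mul_of_nonneg_left (hxp i I) (by positivity)
      _ = p * x' I := by rw [← hbI]; ring
      _ ≤ x' i := hxp' I i
  have heq : y' i - c' / c * b * y i = (y' i - c' * x' i) - c' / c * b * (y i - c * x i) +
      c' * ((x' i - b * x i : ℝ) : ℂ) := by
    push_cast; field_simp; ring
  have h1 : ‖c' / c * (b : ℂ) * (y i - c * x i)‖ ≤ δ * (‖c'‖ * (b * x i)) := by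
    rw [norm_mul, hC]
    calc ‖c'‖ * b / ‖c‖ * ‖y i - c * x i‖ ≤ ‖c'‖ * b / ‖c‖ * (δ * ‖c‖ * x i) :=
          mul_le_mul_of_nonneg_left (hy i) (by positivity)
      _ = _ := by field_simp
  have h2 : ‖c' * ((x' i - b * x i : ℝ) : ℂ)‖ ≤ (1 - p ^ 4) * (‖c'‖ * (b * x i)) := by
    rw [norm_mul, Complex.norm_real, Real.norm_of_nonpos (by linarith)]
    have := mul_le_mul_of_nonneg_left hu2 hc0'.le
    nlinarith
  have h3 : ‖y' i - c' * x' i‖ ≤ δ * (‖c'‖ * (b * x i)) := by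
    refine (hy' i).trans ?_
    rw [mul_assoc]
    exact mul_le_mul_of_nonneg_left (mul_le_mul_of_nonneg_left hu1 hc0'.le) hδ0.le
  have h4 : (1 - δ) * (‖c'‖ * (b * x i)) ≤ ‖c' / c * (b : ℂ)‖ * ‖y i‖ := by
    rw [hC]
    calc (1 - δ) * (‖c'‖ * (b * x i)) = ‖c'‖ * b / ‖c‖ * ((1 - δ) * ‖c‖ * x i) := by field_simp
      _ ≤ _ := mul_le_mul_of_nonneg_left (le_norm_of_near hy hx i) (by positivity)
  rw [heq]
  have h5 := (norm_add_le _ _).trans (add_le_add ((norm_sub_le _ _).trans (add_le_add h3 h1)) h2)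
  refine h5.trans ?_
  rw [mul_assoc]
  have hA : 0 ≤ ‖c'‖ * (b * x i) := mul_nonneg hc0'.le (mul_nonneg hb0.le (hx i).le)
  have h6 : δ + δ + (1 - p ^ 4) ≤ (1 - p ^ 4 / 2) * (1 - δ) := by
    have : 0 ≤ p ^ 4 * δ := by positivity
    nlinarith
  calc _ = (δ + δ + (1 - p ^ 4)) * (‖c'‖ * (b * x i)) := by ring
    _ ≤ ((1 - p ^ 4 / 2) * (1 - δ)) * (‖c'‖ * (b * x i)) := mul_le_mul_of_nonneg_right h6 hA
    _ = (1 - p ^ 4 / 2) * ((1 - δ) * (‖c'‖ * (b * x i))) := by ring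
    _ ≤ _ := mul_le_mul_of_nonneg_left h4 (by linarith)

end HiddenMarkov

/-! ### Logarithms of weighted means of density ratios -/

namespace HiddenMarkov

variable {l : ℕ}

/-- The average of `R` with respect to the normalization of the weights `y`. -/
noncomputable def weightedMean (R y : Fin l → ℂ) : ℂ := (∑ j, y j * R j) / ∑ j, y j

variable {p δ η M : ℝ} {I : Fin l} {R₀ : Fin l → ℝ} {R y y' : Fin l → ℂ}

/-- The entries have nearly the same argument, so there is little cancellation: at least the
fraction `(1 - δ) / (1 + δ)` of the mass survives, which exceeds one half. -/
lemma NearPositive.norm_sum_ge (hδ : 8 * δ ≤ 1) (hy : NearPositive p δ y) :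
    1 / 2 * ∑ j, ‖y j‖ ≤ ‖∑ j, y j‖ := by
  obtain ⟨x, c, hc, hx, hxp, hy⟩ := hy
  have hN : 0 ≤ ∑ j, x j := Finset.sum_nonneg fun j _ => (hx j).le
  have h1 : ‖∑ j, (y j - c * x j)‖ ≤ δ * ‖c‖ * ∑ j, x j := by
    rw [Finset.mul_sum]; exact norm_sum_le_of_le _ fun j _ => hy j
  have h2 : ∑ j, ‖y j‖ ≤ (1 + δ) * ‖c‖ * ∑ j, x j := by
    rw [Finset.mul_sum]; exact Finset.sum_le_sum fun j _ => norm_le_of_near hy hx j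
  have h3 : ∑ j, y j = c * ((∑ j, x j : ℝ) : ℂ) + ∑ j, (y j - c * x j) := by
    push_cast; rw [Finset.mul_sum, ← Finset.sum_add_distrib]; simp
  have h4 := norm_sub_norm_le (c * ((∑ j, x j : ℝ) : ℂ)) (-∑ j, (y j - c * x j))
  rw [sub_neg_eq_add, norm_neg, norm_mul, Complex.norm_real, Real.norm_of_nonneg hN, ← h3] at h4
  have h5 := mul_nonneg (norm_nonneg c) hN
  nlinarith

lemma NearPositive.sum_norm_pos (hδ : 8 * δ ≤ 1) (I : Fin l) (hy : NearPositive p δ y) :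
    0 < ∑ j, ‖y j‖ := by
  obtain ⟨x, c, hc, hx, hxp, hy⟩ := hy
  refine Finset.sum_pos (fun j _ => ?_) ⟨I, Finset.mem_univ I⟩
  exact lt_of_lt_of_le (mul_pos (mul_pos (by linarith) (norm_pos_iff.2 hc)) (hx j))
    (le_norm_of_near hy hx j)

/-- For near positive weights, the weighted mean is close to a positive number that is bounded above
and below. -/
theorem NearPositive.weightedMean_near (hp : 0 < p) (hp1 : p ≤ 1) (hδ0 : 0 < δ) (hδ : 8 * δ ≤ 1)
    (hη : 0 ≤ η) (hηδ : 3 * η * l ≤ δ * p ^ 4) (hR0 : ∀ j, 0 ≤ R₀ j) (hRI : R₀ I = 1)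
    (hRM : ∀ j, R₀ j ≤ M) (hR : ∀ j, ‖R j - R₀ j‖ ≤ η) (hy : NearPositive p δ y) :
    ∃ a : ℝ, p / l ≤ a ∧ a ≤ M ∧ ‖weightedMean R y - a‖ ≤ a / 2 := by
  have hl : (0 : ℝ) < l := by exact_mod_cast (Nat.zero_le _).trans_lt I.2
  have hy0 := hy
  obtain ⟨x, c, hc, hx, hxp, hy⟩ := hy
  have hc0 := norm_pos_iff.2 hc
  set N := ∑ j, x j with hN
  set X := ∑ j, x j * R₀ j with hX
  have hNpos : 0 < N := Finset.sum_pos (fun j _ => hx j) ⟨I, Finset.mem_univ I⟩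
  have hXI : x I ≤ X := by
    have := Finset.single_le_sum (f := fun j => x j * R₀ j)
      (fun j _ => mul_nonneg (hx j).le (hR0 j)) (Finset.mem_univ I)
    simpa [hRI] using this
  have hXpos : 0 < X := (hx I).trans_le hXI
  have hNX : p * N ≤ l * X :=
    (sum_le_of_ratio hxp).trans (mul_le_mul_of_nonneg_left hXI hl.le)
  have hXM : X ≤ M * N := by
    rw [hX, hN, Finset.mul_sum]
    refine Finset.sum_le_sum fun j _ => ?_
    rw [mul_comm]; exact mul_le_mul_of_nonneg_right (hRM j) (hx j).le
  -- The center is the real weighted mean of `R₀` with weights `x`. The normalization `R₀ I = 1`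
  -- keeps it away from zero even if all other ratios vanish.
  refine ⟨X / N, ?_, ?_, ?_⟩
  · rw [div_le_div_iff₀ hl hNpos]; linarith
  · rwa [div_le_iff₀ hNpos]
  have hA : ‖∑ j, y j * R j - c * X‖ ≤ 2 * δ * ‖c‖ * X := by
    have h1 : ∑ j, y j * R j - c * X = ∑ j, ((y j - c * x j) * R₀ j + y j * (R j - R₀ j)) := by
      rw [hX]; push_cast; rw [Finset.mul_sum, ← Finset.sum_sub_distrib]
      exact Finset.sum_congr rfl fun j _ => by ring
    have h2 : ‖∑ j, ((y j - c * x j) * R₀ j + y j * (R j - R₀ j))‖ ≤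
        ∑ j, (δ * ‖c‖ * (x j * R₀ j) + 3 / 2 * ‖c‖ * η * x j) := by
      refine norm_sum_le_of_le _ fun j _ => (norm_add_le _ _).trans (add_le_add ?_ ?_)
      · rw [norm_mul, Complex.norm_real, Real.norm_of_nonneg (hR0 j), ← mul_assoc]
        exact mul_le_mul_of_nonneg_right (hy j) (hR0 j)
      · rw [norm_mul]
        have h3 : ‖y j‖ ≤ 3 / 2 * ‖c‖ * x j := (norm_le_of_near hy hx j).trans (by
          have := mul_nonneg hc0.le (hx j).le
          nlinarith)
        calc ‖y j‖ * ‖R j - R₀ j‖ ≤ (3 / 2 * ‖c‖ * x j) * η :=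
              mul_le_mul h3 (hR j) (norm_nonneg _)
                (mul_nonneg (by positivity) (hx j).le)
          _ = _ := by ring
    rw [Finset.sum_add_distrib (g := fun j => 3 / 2 * ‖c‖ * η * x j), ← Finset.mul_sum,
      ← Finset.mul_sum, ← hX, ← hN] at h2
    rw [h1]
    refine h2.trans ?_
    have h4 : p * (3 * η * N) ≤ p * (δ * X) := by
      calc p * (3 * η * N) = 3 * η * (p * N) := by ring
        _ ≤ 3 * η * (l * X) := mul_le_mul_of_nonneg_left hNX (by positivity)
        _ = 3 * η * l * X := by ring
        _ ≤ δ * p ^ 4 * X := mul_le_mul_of_nonneg_right hηδ hXpos.le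
        _ ≤ δ * p * X := by
            have : p ^ 4 ≤ p := pow_le_of_le_one hp.le hp1 (by norm_num)
            exact mul_le_mul_of_nonneg_right (mul_le_mul_of_nonneg_left this hδ0.le) hXpos.le
        _ = _ := by ring
    have h5 := mul_le_mul_of_nonneg_left (le_of_mul_le_mul_left h4 hp) hc0.le
    have h6 : 0 ≤ ‖c‖ * (δ * X) := by positivity
    nlinarith
  have hB : ‖∑ j, y j - c * N‖ ≤ δ * ‖c‖ * N := by
    have h1 : ∑ j, y j - c * N = ∑ j, (y j - c * x j) := by
      rw [hN]; push_cast; rw [Finset.mul_sum, ← Finset.sum_sub_distrib]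
    rw [h1, hN, Finset.mul_sum]; exact norm_sum_le_of_le _ fun j _ => hy j
  have hBlow : (1 - δ) * ‖c‖ * N ≤ ‖∑ j, y j‖ := by
    have h4 := norm_sub_norm_le (c * N : ℂ) (∑ j, y j)
    rw [norm_sub_rev, norm_mul, Complex.norm_real, Real.norm_of_nonneg hNpos.le] at h4
    linarith
  have hBpos : 0 < ‖∑ j, y j‖ :=
    lt_of_lt_of_le (mul_pos (mul_pos (by linarith) hc0) hNpos) hBlow
  have hB0 : ∑ j, y j ≠ 0 := norm_pos_iff.1 hBpos
  have hN0 : (N : ℂ) ≠ 0 := Complex.ofReal_ne_zero.2 hNpos.ne'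
  have heq : weightedMean R y - ((X / N : ℝ) : ℂ) =
      ((∑ j, y j * R j - c * X) - (X / N : ℝ) * (∑ j, y j - c * N)) / ∑ j, y j := by
    rw [weightedMean]; push_cast; field_simp; ring
  rw [heq, norm_div, div_le_iff₀ hBpos]
  refine (norm_sub_le _ _).trans ?_
  rw [norm_mul, Complex.norm_real, Real.norm_of_nonneg (by positivity)]
  have h7 : X / N * ‖∑ j, y j - c * N‖ ≤ δ * ‖c‖ * X := by
    calc _ ≤ X / N * (δ * ‖c‖ * N) := mul_le_mul_of_nonneg_left hB (by positivity)
      _ = _ := by field_simp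
  have h8 : (1 - δ) * ‖c‖ * X / 2 ≤ X / N / 2 * ‖∑ j, y j‖ := by
    calc (1 - δ) * ‖c‖ * X / 2 = X / N / 2 * ((1 - δ) * ‖c‖ * N) := by field_simp
      _ ≤ _ := mul_le_mul_of_nonneg_left hBlow (by positivity)
  -- The numerator contributes `2 * δ` and the denominator `δ`; the claim reduces to `3 * δ ≤ (1 -
  -- δ) / 2`.
  have h9 : 0 < ‖c‖ * X := by positivity
  nlinarith

/-- Mean value inequality on a half-plane, which is convex and where the derivative of the principal
logarithm has norm at most `a⁻¹`. -/
lemma norm_log_sub_log_le {a : ℝ} (ha : 0 < a) {s t : ℂ} (hs : a ≤ s.re) (ht : a ≤ t.re) :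
    ‖Complex.log s - Complex.log t‖ ≤ a⁻¹ * ‖s - t‖ := by
  have hconv : Convex ℝ {z : ℂ | a ≤ z.re} := convex_halfSpace_re_ge a
  refine hconv.norm_image_sub_le_of_norm_deriv_le (𝕜 := ℂ) (f := Complex.log) (fun z hz => ?_)
    (fun z hz => ?_) ht hs
  · exact (Complex.hasDerivAt_log (Or.inl (ha.trans_le hz))).differentiableAt
  · rw [(Complex.hasDerivAt_log (Or.inl (ha.trans_le hz))).deriv, norm_inv]
    exact inv_anti₀ ha ((show a ≤ z.re from hz).trans (Complex.re_le_norm z))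

lemma norm_log_le {a b : ℝ} (ha : 0 < a) {s : ℂ} (hs : a ≤ s.re) (hb : ‖s‖ ≤ b) (ha1 : a ≤ 1) :
    ‖Complex.log s‖ ≤ a⁻¹ * (b + 1) := by
  have h := norm_log_sub_log_le ha hs (t := 1) (by simpa using ha1)
  rw [Complex.log_one, sub_zero] at h
  refine h.trans (mul_le_mul_of_nonneg_left ((norm_sub_le _ _).trans ?_) (inv_pos.2 ha).le)
  simpa using hb

/-- The logarithm of the weighted mean is a Lipschitz function of the projective class of the
weights. -/
theorem NearPositive.norm_log_weightedMean_sub_le (hp : 0 < p) (hp1 : p ≤ 1) (hδ0 : 0 < δ)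
    (hδ : 8 * δ ≤ 1)
    (hη : 0 ≤ η) (hη1 : η ≤ 1) (hηδ : 3 * η * l ≤ δ * p ^ 4) (hR0 : ∀ j, 0 ≤ R₀ j) (hRI : R₀ I = 1)
    (hRM : ∀ j, R₀ j ≤ M) (hR : ∀ j, ‖R j - R₀ j‖ ≤ η) (hy : NearPositive p δ y)
    (hy' : NearPositive p δ y') {σ t : ℝ} (hσ : 0 < σ) (ht0 : 0 ≤ t) (ht : t ≤ 1 - σ)
    (h : ProjClose t y y') :
    ‖Complex.log (weightedMean R y') - Complex.log (weightedMean R y)‖ ≤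
      (p / (2 * l))⁻¹ * (8 * (M + 1) / σ) * t := by
  have hl : (0 : ℝ) < l := by exact_mod_cast (Nat.zero_le _).trans_lt I.2
  have hre : ∀ {y : Fin l → ℂ}, NearPositive p δ y → p / (2 * l) ≤ (weightedMean R y).re := by
    intro y hy
    obtain ⟨a, ha1, -, ha2⟩ := hy.weightedMean_near hp hp1 hδ0 hδ hη hηδ hR0 hRI hRM hR
    have h1 := Complex.abs_re_le_norm (weightedMean R y - a)
    rw [Complex.sub_re, Complex.ofReal_re] at h1
    have h2 := (abs_le.1 (h1.trans ha2)).1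
    have h3 : p / (2 * l) = p / l / 2 := by rw [div_div, mul_comm]
    rw [h3]; linarith
  refine (norm_log_sub_log_le (by positivity) (hre hy') (hre hy)).trans ?_
  rw [mul_assoc]
  refine mul_le_mul_of_nonneg_left ?_ (by positivity)
  obtain ⟨c, hc, hcy⟩ := h
  have hc0 := norm_pos_iff.2 hc
  set T := ∑ j, ‖y j‖ with hT
  have hTpos : 0 < T := hy.sum_norm_pos hδ I
  have hRn : ∀ j, ‖R j‖ ≤ M + 1 := by
    intro j
    have h1 := norm_add_le (R j - R₀ j) (R₀ j)
    rw [sub_add_cancel, Complex.norm_real, Real.norm_of_nonneg (hR0 j)] at h1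
    linarith [hRM j, hR j]
  have hM0 : 0 ≤ M + 1 := (norm_nonneg _).trans (hRn I)
  set e : Fin l → ℂ := fun j => y' j - c * y j with he
  have hE1 : ‖∑ j, e j * R j‖ ≤ t * ‖c‖ * T * (M + 1) := by
    have : t * ‖c‖ * T * (M + 1) = ∑ j, t * ‖c‖ * ‖y j‖ * (M + 1) := by
      rw [hT, Finset.mul_sum, Finset.sum_mul]
    rw [this]
    refine norm_sum_le_of_le _ fun j _ => ?_
    rw [norm_mul]
    exact mul_le_mul (hcy j) (hRn j) (norm_nonneg _) (by positivity)
  have hE2 : ‖∑ j, e j‖ ≤ t * ‖c‖ * T := by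
    rw [hT, Finset.mul_sum]; exact norm_sum_le_of_le _ fun j _ => hcy j
  have hA : ‖∑ j, y j * R j‖ ≤ T * (M + 1) := by
    rw [hT, Finset.sum_mul]
    refine norm_sum_le_of_le _ fun j _ => ?_
    rw [norm_mul]; exact mul_le_mul_of_nonneg_left (hRn j) (norm_nonneg _)
  have hB : ‖∑ j, y j‖ ≤ T := norm_sum_le _ _
  have hBl : 1 / 2 * T ≤ ‖∑ j, y j‖ := hy.norm_sum_ge hδ
  -- Since `t ≤ 1 - σ`, each entry of `y'` keeps at least the fraction `σ` of `‖c * y j‖`.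
  have hBl' : 1 / 2 * (‖c‖ * σ * T) ≤ ‖∑ j, y' j‖ := by
    refine le_trans (mul_le_mul_of_nonneg_left ?_ (by norm_num)) (hy'.norm_sum_ge hδ)
    rw [hT, Finset.mul_sum]
    refine Finset.sum_le_sum fun j _ => ?_
    have h1 := norm_sub_norm_le (c * y j) (y' j)
    rw [norm_sub_rev, norm_mul] at h1
    have h2 := hcy j
    have h3 : t * (‖c‖ * ‖y j‖) ≤ (1 - σ) * (‖c‖ * ‖y j‖) :=
      mul_le_mul_of_nonneg_right ht (by positivity)
    linarith
  have hBpos : 0 < ‖∑ j, y j‖ := lt_of_lt_of_le (by positivity) hBl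
  have hBpos' : 0 < ‖∑ j, y' j‖ := lt_of_lt_of_le (by positivity) hBl'
  have hB0 : ∑ j, y j ≠ 0 := norm_pos_iff.1 hBpos
  have hB0' : ∑ j, y' j ≠ 0 := norm_pos_iff.1 hBpos'
  have h1 : ∑ j, y' j * R j = c * ∑ j, y j * R j + ∑ j, e j * R j := by
    rw [Finset.mul_sum, ← Finset.sum_add_distrib]
    exact Finset.sum_congr rfl fun j _ => by rw [he]; ring
  have h2 : ∑ j, y' j = c * ∑ j, y j + ∑ j, e j := by
    rw [Finset.mul_sum, ← Finset.sum_add_distrib]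
    exact Finset.sum_congr rfl fun j _ => by rw [he]; ring
  -- The multiple `c` of `y` cancels in the cross product, so only terms containing the error `e`
  -- remain.
  have heq : weightedMean R y' - weightedMean R y =
      ((∑ j, e j * R j) * (∑ j, y j) - (∑ j, y j * R j) * ∑ j, e j) /
        ((∑ j, y' j) * ∑ j, y j) := by
    rw [weightedMean, weightedMean, div_sub_div _ _ hB0' hB0, h1]
    congr 1
    rw [h2]; ring
  rw [heq, norm_div, norm_mul (∑ j, y' j), div_le_iff₀ (mul_pos hBpos' hBpos)]
  refine (norm_sub_le _ _).trans ?_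
  rw [norm_mul, norm_mul]
  have h3 := mul_le_mul hE1 hB (norm_nonneg _) (by positivity)
  have h4 := mul_le_mul hA hE2 (norm_nonneg _) (by positivity)
  have h5 : 1 / 2 * (‖c‖ * σ * T) * (1 / 2 * T) ≤ ‖∑ j, y' j‖ * ‖∑ j, y j‖ :=
    mul_le_mul hBl' hBl (by positivity) (norm_nonneg _)
  calc _ ≤ t * ‖c‖ * T * (M + 1) * T + T * (M + 1) * (t * ‖c‖ * T) := add_le_add h3 h4
    _ = 8 * (M + 1) / σ * t * (1 / 2 * (‖c‖ * σ * T) * (1 / 2 * T)) := by field_simp; ring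
    _ ≤ _ := mul_le_mul_of_nonneg_left h5 (by positivity)

end HiddenMarkov

/-! ### Splitting off the first or the last coordinate of an integral -/

section Peel

variable {n : ℕ} {F : Type*} [NormedAddCommGroup F]

lemma measurePreserving_finCons (n : ℕ) :
    MeasurePreserving (fun p : ℝ × (Fin n → ℝ) => (Fin.cons p.1 p.2 : Fin (n + 1) → ℝ)) ∧
    MeasurableEmbedding (fun p : ℝ × (Fin n → ℝ) => (Fin.cons p.1 p.2 : Fin (n + 1) → ℝ)) := by
  have h := (volume_preserving_piFinSuccAbove (fun _ : Fin (n + 1) => ℝ) 0).symm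
  have he : ((MeasurableEquiv.piFinSuccAbove (fun _ : Fin (n + 1) => ℝ) 0).symm :
      ℝ × (Fin n → ℝ) → Fin (n + 1) → ℝ) = fun p => (Fin.cons p.1 p.2 : Fin (n + 1) → ℝ) := by
    ext p : 1
    rw [MeasurableEquiv.piFinSuccAbove_symm_apply]
    exact Fin.insertNth_zero' _ _
  rw [← he]
  exact ⟨h, MeasurableEquiv.measurableEmbedding _⟩

lemma measurePreserving_finSnoc (n : ℕ) :
    MeasurePreserving (fun p : ℝ × (Fin n → ℝ) => (Fin.snoc p.2 p.1 : Fin (n + 1) → ℝ)) ∧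
    MeasurableEmbedding (fun p : ℝ × (Fin n → ℝ) => (Fin.snoc p.2 p.1 : Fin (n + 1) → ℝ)) := by
  have h := (volume_preserving_piFinSuccAbove (fun _ : Fin (n + 1) => ℝ) (Fin.last n)).symm
  have hs : ∀ i, (Fin.last n).succAbove i = Fin.castSucc i := fun i => Fin.succAbove_last_apply i
  have he : ((MeasurableEquiv.piFinSuccAbove (fun _ : Fin (n + 1) => ℝ) (Fin.last n)).symm :
      ℝ × (Fin n → ℝ) → Fin (n + 1) → ℝ) = fun p => (Fin.snoc p.2 p.1 : Fin (n + 1) → ℝ) := by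
    ext p : 1
    rw [MeasurableEquiv.piFinSuccAbove_symm_apply]
    exact Fin.insertNth_last' _ _
  rw [← he]
  exact ⟨h, MeasurableEquiv.measurableEmbedding _⟩

lemma integral_finCons [NormedSpace ℝ F] (f : (Fin (n + 1) → ℝ) → F) :
    ∫ p : ℝ × (Fin n → ℝ), f (Fin.cons p.1 p.2) = ∫ z, f z :=
  (measurePreserving_finCons n).1.integral_comp (measurePreserving_finCons n).2 f

lemma integrable_finCons {f : (Fin (n + 1) → ℝ) → F} :
    Integrable (fun p : ℝ × (Fin n → ℝ) => f (Fin.cons p.1 p.2)) ↔ Integrable f :=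
  (measurePreserving_finCons n).1.integrable_comp_emb (measurePreserving_finCons n).2

lemma integral_finSnoc [NormedSpace ℝ F] (f : (Fin (n + 1) → ℝ) → F) :
    ∫ p : ℝ × (Fin n → ℝ), f (Fin.snoc p.2 p.1) = ∫ z, f z :=
  (measurePreserving_finSnoc n).1.integral_comp (measurePreserving_finSnoc n).2 f

lemma integrable_finSnoc {f : (Fin (n + 1) → ℝ) → F} :
    Integrable (fun p : ℝ × (Fin n → ℝ) => f (Fin.snoc p.2 p.1)) ↔ Integrable f :=
  (measurePreserving_finSnoc n).1.integrable_comp_emb (measurePreserving_finSnoc n).2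

lemma lintegral_finSnoc {f : (Fin (n + 1) → ℝ) → ℝ≥0∞} (hf : Measurable f) :
    ∫⁻ z, f z = ∫⁻ z : Fin n → ℝ, ∫⁻ a : ℝ, f (Fin.snoc z a) := by
  have h := (measurePreserving_finSnoc n)
  rw [← h.1.lintegral_comp_emb h.2, Measure.volume_eq_prod, lintegral_prod_symm]
  exact (hf.comp h.1.measurable).aemeasurable

end Peel

/-! ### Orbits of the channel matrices -/

namespace HiddenMarkov

variable {l n : ℕ}

/-- The unnormalized conditional law of the next input, after the outputs `z` and with initial
weights `y`. -/
def orbit (P : Fin l → Fin l → ℂ) (Q : Fin l → ℝ → ℂ) :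
    (n : ℕ) → (Fin n → ℝ) → (Fin l → ℂ) → Fin l → ℂ
  | 0, _, y => y
  | n + 1, z, y => rowStep (fun i k => Q i (z (Fin.last n)) * P i k) (orbit P Q n (Fin.init z) y)

/-- The (complexified) density of the outputs `z` with initial weights `y`. -/
def outDensity (P : Fin l → Fin l → ℂ) (Q : Fin l → ℝ → ℂ) (n : ℕ) (z : Fin (n + 1) → ℝ)
    (y : Fin l → ℂ) : ℂ :=
  ∑ k, orbit P Q n (Fin.init z) y k * Q k (z (Fin.last n))

/-- The logarithm of the conditional density of the last output given the previous ones, except for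
the logarithm of the density of column `I`. -/
noncomputable def logRatio (P : Fin l → Fin l → ℂ) (Q : Fin l → ℝ → ℂ) (I : Fin l) (n : ℕ)
    (z : Fin (n + 1) → ℝ) (y : Fin l → ℂ) : ℂ :=
  Complex.log (weightedMean (fun j => Q j (z (Fin.last n)) / Q I (z (Fin.last n)))
    (orbit P Q n (Fin.init z) y))

/-- The integrand of the conditional entropy. -/
noncomputable def entropyIntegrand (P : Fin l → Fin l → ℂ) (Q : Fin l → ℝ → ℂ) (L : ℝ → ℂ)
    (I : Fin l) (n : ℕ) (z : Fin (n + 1) → ℝ) (y : Fin l → ℂ) : ℂ :=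
  outDensity P Q n z y * (L (z (Fin.last n)) + logRatio P Q I n z y)

variable {P : Fin l → Fin l → ℂ} {Q : Fin l → ℝ → ℂ} {L : ℝ → ℂ} {I : Fin l}

/-- The recursion adds the newest output; comparing consecutive conditional entropies instead
requires removing the oldest one, whose whole effect is a change of the initial weights. -/
lemma orbit_cons (a : ℝ) (z : Fin n → ℝ) (y : Fin l → ℂ) :
    orbit P Q (n + 1) (Fin.cons a z) y =
      orbit P Q n z (rowStep (fun i k => Q i a * P i k) y) := by
  induction n with
  | zero => rfl
  | succ n ih =>
    rw [orbit]
    have h1 : Fin.init (Fin.cons a z : Fin (n + 2) → ℝ) = Fin.cons a (Fin.init z) := by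
      ext i
      refine Fin.cases ?_ (fun j => ?_) i
      · rfl
      · simp only [Fin.init, Fin.cons_succ, ← Fin.succ_castSucc]
    have h2 : (Fin.cons a z : Fin (n + 2) → ℝ) (Fin.last (n + 1)) = z (Fin.last n) := by
      rw [← Fin.succ_last, Fin.cons_succ]
    rw [h1, h2, ih]
    rfl

lemma init_cons_last (a : ℝ) (z : Fin (n + 1) → ℝ) :
    Fin.init (Fin.cons a z : Fin (n + 2) → ℝ) = Fin.cons a (Fin.init z) ∧
    (Fin.cons a z : Fin (n + 2) → ℝ) (Fin.last (n + 1)) = z (Fin.last n) := by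
  constructor
  · ext i
    refine Fin.cases ?_ (fun j => ?_) i
    · rfl
    · simp only [Fin.init, Fin.cons_succ, ← Fin.succ_castSucc]
  · rw [← Fin.succ_last, Fin.cons_succ]

lemma outDensity_cons (a : ℝ) (z : Fin (n + 1) → ℝ) (y : Fin l → ℂ) :
    outDensity P Q (n + 1) (Fin.cons a z) y =
      outDensity P Q n z (rowStep (fun i k => Q i a * P i k) y) := by
  rw [outDensity, outDensity, (init_cons_last a z).1, (init_cons_last a z).2, orbit_cons]

lemma logRatio_cons (a : ℝ) (z : Fin (n + 1) → ℝ) (y : Fin l → ℂ) :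
    logRatio P Q I (n + 1) (Fin.cons a z) y =
      logRatio P Q I n z (rowStep (fun i k => Q i a * P i k) y) := by
  rw [logRatio, logRatio, (init_cons_last a z).1, (init_cons_last a z).2, orbit_cons]

lemma entropyIntegrand_cons (a : ℝ) (z : Fin (n + 1) → ℝ) (y : Fin l → ℂ) :
    entropyIntegrand P Q L I (n + 1) (Fin.cons a z) y =
      entropyIntegrand P Q L I n z (rowStep (fun i k => Q i a * P i k) y) := by
  rw [entropyIntegrand, entropyIntegrand, outDensity_cons, logRatio_cons, (init_cons_last a z).2]

lemma orbit_linear (n : ℕ) (z : Fin n → ℝ) : ∃ c : Fin l → Fin l → ℂ, ∀ (y : Fin l → ℂ) k,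
    orbit P Q n z y k = ∑ i, y i * c i k := by
  induction n with
  | zero => exact ⟨fun i k => if i = k then 1 else 0, fun y k => by simp [orbit]⟩
  | succ n ih =>
    obtain ⟨c, hc⟩ := ih (Fin.init z)
    refine ⟨fun i k => ∑ j, c i j * (Q j (z (Fin.last n)) * P j k), fun y k => ?_⟩
    simp only [orbit, rowStep, hc]
    simp_rw [Finset.sum_mul, Finset.mul_sum]
    rw [Finset.sum_comm]
    exact Finset.sum_congr rfl fun i _ => Finset.sum_congr rfl fun j _ => by ring

/-- Linearity in the initial weights lets an integral over the oldest output pass inside to those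
weights. -/
lemma outDensity_linear (n : ℕ) (z : Fin (n + 1) → ℝ) : ∃ c : Fin l → ℂ, ∀ y : Fin l → ℂ,
    outDensity P Q n z y = ∑ i, y i * c i := by
  obtain ⟨c, hc⟩ := orbit_linear (P := P) (Q := Q) n (Fin.init z)
  refine ⟨fun i => ∑ k, c i k * Q k (z (Fin.last n)), fun y => ?_⟩
  simp only [outDensity, hc]
  simp_rw [Finset.sum_mul, Finset.mul_sum]
  rw [Finset.sum_comm]
  exact Finset.sum_congr rfl fun i _ => Finset.sum_congr rfl fun j _ => by ring

section Measurability

variable (hQ : ∀ j, Measurable (Q j))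
include hQ

/-- The orbit depends measurably on the outputs and on measurable initial weights. -/
lemma measurable_orbit {α : Type*} [MeasurableSpace α] {z : α → Fin n → ℝ} {y : α → Fin l → ℂ}
    (hz : Measurable z) (hy : Measurable y) :
    ∀ k, Measurable fun a => orbit P Q n (z a) (y a) k := by
  induction n with
  | zero => exact fun k => measurable_pi_iff.1 hy k
  | succ n ih =>
    intro k
    simp only [orbit, rowStep]
    exact Finset.measurable_fun_sum _ fun i _ => (ih (z := fun a => Fin.init (z a))
      (measurable_pi_lambda _ fun i => measurable_pi_iff.1 hz i.castSucc) i).mul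
      (((hQ i).comp (measurable_pi_iff.1 hz (Fin.last n))).mul_const _)

lemma measurable_rowStep {α : Type*} [MeasurableSpace α] {z : α → ℝ} {y : α → Fin l → ℂ}
    (hz : Measurable z) (hy : Measurable y) :
    Measurable fun a => rowStep (fun i k => Q i (z a) * P i k) (y a) :=
  measurable_pi_lambda _ fun _ => Finset.measurable_fun_sum _ fun i _ =>
    (measurable_pi_iff.1 hy i).mul (((hQ i).comp hz).mul_const _)

lemma measurable_outDensity {α : Type*} [MeasurableSpace α] {z : α → Fin (n + 1) → ℝ}
    {y : α → Fin l → ℂ} (hz : Measurable z) (hy : Measurable y) :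
    Measurable fun a => outDensity P Q n (z a) (y a) :=
  Finset.measurable_fun_sum _ fun k _ => (measurable_orbit hQ
    (measurable_pi_lambda _ fun i => measurable_pi_iff.1 hz i.castSucc) hy k).mul
    ((hQ k).comp (measurable_pi_iff.1 hz _))

lemma measurable_logRatio {α : Type*} [MeasurableSpace α] {z : α → Fin (n + 1) → ℝ}
    {y : α → Fin l → ℂ} (hz : Measurable z) (hy : Measurable y) :
    Measurable fun a => logRatio P Q I n (z a) (y a) := by
  have h := measurable_orbit (P := P) hQ (z := fun a => Fin.init (z a))
    (measurable_pi_lambda _ fun i => measurable_pi_iff.1 hz i.castSucc) hy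
  have hl : ∀ j, Measurable fun a => Q j (z a (Fin.last n)) := fun j =>
    (hQ j).comp (measurable_pi_iff.1 hz _)
  refine Complex.measurable_log.comp (Measurable.div ?_ ?_)
  · exact Finset.measurable_fun_sum _ fun k _ => (h k).mul ((hl k).div (hl I))
  · exact Finset.measurable_fun_sum _ fun k _ => h k

lemma measurable_entropyIntegrand {α : Type*} [MeasurableSpace α] {z : α → Fin (n + 1) → ℝ}
    {y : α → Fin l → ℂ} (hz : Measurable z) (hy : Measurable y) (hL : Measurable L) :
    Measurable fun a => entropyIntegrand P Q L I n (z a) (y a) :=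
  (measurable_outDensity hQ hz hy).mul ((hL.comp (measurable_pi_iff.1 hz _)).add
    (measurable_logRatio hQ hz hy))

end Measurability

/-! ### Growth of the total mass of complexified densities -/

section Mass

variable {A B : ℝ≥0∞}

/-- The total mass of the orbit grows at most geometrically. -/
lemma lintegral_orbit_le (hQ : ∀ j, Measurable (Q j)) (hA : ∀ j, ∫⁻ z, ‖Q j z‖ₑ ≤ A)
    (hB : ∀ i, ∑ k, ‖P i k‖ₑ ≤ B) (n : ℕ) (y : Fin l → ℂ) :
    ∫⁻ z : Fin n → ℝ, ∑ k, ‖orbit P Q n z y k‖ₑ ≤ (A * B) ^ n * ∑ k, ‖y k‖ₑ := by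
  induction n with
  | zero => simp [orbit, volume_pi]
  | succ n ih =>
    have hm : Measurable fun z : Fin (n + 1) → ℝ => ∑ k, ‖orbit P Q (n + 1) z y k‖ₑ :=
      Finset.measurable_fun_sum _ fun k _ =>
        (measurable_orbit hQ measurable_id measurable_const k).enorm
    rw [lintegral_finSnoc hm]
    -- One more output costs a factor `B` for the row of `P` and, after integration over `a`, a
    -- factor `A` for the density.
    have h1 : ∀ (z : Fin n → ℝ) (a : ℝ), ∑ k, ‖orbit P Q (n + 1) (Fin.snoc z a) y k‖ₑ ≤
        ∑ i, ‖orbit P Q n z y i‖ₑ * B * ‖Q i a‖ₑ := by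
      intro z a
      calc _ ≤ ∑ k, ∑ i, ‖orbit P Q n z y i‖ₑ * (‖Q i a‖ₑ * ‖P i k‖ₑ) := by
            refine Finset.sum_le_sum fun k _ => ?_
            simp only [orbit, rowStep, Fin.init_snoc, Fin.snoc_last]
            refine (enorm_sum_le _ _).trans (Finset.sum_le_sum fun i _ => ?_)
            rw [enorm_mul, enorm_mul]
        _ = ∑ i, ‖orbit P Q n z y i‖ₑ * ‖Q i a‖ₑ * ∑ k, ‖P i k‖ₑ := by
            rw [Finset.sum_comm]
            refine Finset.sum_congr rfl fun i _ => ?_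
            rw [Finset.mul_sum]
            exact Finset.sum_congr rfl fun k _ => by ring
        _ ≤ _ := by
            refine Finset.sum_le_sum fun i _ => ?_
            calc _ ≤ ‖orbit P Q n z y i‖ₑ * ‖Q i a‖ₑ * B := by gcongr; exact hB i
              _ = _ := by ring
    calc _ ≤ ∫⁻ z : Fin n → ℝ, (A * B) * ∑ k, ‖orbit P Q n z y k‖ₑ := by
          refine lintegral_mono fun z => ?_
          refine (lintegral_mono (h1 z)).trans ?_
          rw [lintegral_finsetSum _ fun i _ => ((hQ i).enorm.const_mul _), Finset.mul_sum]
          refine Finset.sum_le_sum fun i _ => ?_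
          rw [lintegral_const_mul _ (hQ i).enorm]
          calc _ ≤ ‖orbit P Q n z y i‖ₑ * B * A := by gcongr; exact hA i
            _ = _ := by ring
      _ = (A * B) * ∫⁻ z : Fin n → ℝ, ∑ k, ‖orbit P Q n z y k‖ₑ := by
          rw [lintegral_const_mul]
          exact Finset.measurable_fun_sum _ fun k _ =>
            (measurable_orbit hQ measurable_id measurable_const k).enorm
      _ ≤ (A * B) * ((A * B) ^ n * ∑ k, ‖y k‖ₑ) := by gcongr
      _ = _ := by ring

lemma lintegral_outDensity_le (hQ : ∀ j, Measurable (Q j)) (hA : ∀ j, ∫⁻ z, ‖Q j z‖ₑ ≤ A)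
    (hB : ∀ i, ∑ k, ‖P i k‖ₑ ≤ B) (n : ℕ) (y : Fin l → ℂ) :
    ∫⁻ z : Fin (n + 1) → ℝ, ‖outDensity P Q n z y‖ₑ ≤ A * ((A * B) ^ n * ∑ k, ‖y k‖ₑ) := by
  have hm : Measurable fun z : Fin (n + 1) → ℝ => ‖outDensity P Q n z y‖ₑ :=
    (measurable_outDensity hQ measurable_id measurable_const).enorm
  rw [lintegral_finSnoc hm]
  calc _ ≤ ∫⁻ z : Fin n → ℝ, A * ∑ k, ‖orbit P Q n z y k‖ₑ := by
        refine lintegral_mono fun z => ?_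
        have h1 : ∀ a : ℝ, ‖outDensity P Q n (Fin.snoc z a) y‖ₑ ≤
            ∑ i, ‖orbit P Q n z y i‖ₑ * ‖Q i a‖ₑ := by
          intro a
          simp only [outDensity, Fin.init_snoc, Fin.snoc_last]
          refine (enorm_sum_le _ _).trans (Finset.sum_le_sum fun i _ => ?_)
          rw [enorm_mul]
        refine (lintegral_mono h1).trans ?_
        rw [lintegral_finsetSum _ fun i _ => ((hQ i).enorm.const_mul _), Finset.mul_sum]
        refine Finset.sum_le_sum fun i _ => ?_
        rw [lintegral_const_mul _ (hQ i).enorm, mul_comm]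
        gcongr; exact hA i
    _ = A * ∫⁻ z : Fin n → ℝ, ∑ k, ‖orbit P Q n z y k‖ₑ := by
        rw [lintegral_const_mul]
        exact Finset.measurable_fun_sum _ fun k _ =>
          (measurable_orbit hQ measurable_id measurable_const k).enorm
    _ ≤ _ := by gcongr; exact lintegral_orbit_le hQ hA hB n y

end Mass

section Domination

variable {D : ℝ → ℝ} {b : ℝ}

/-- A pointwise majorant, used for integrability and holomorphy at fixed `n`. The integral of `D`
may be well above 1, so the growth rate in `n` has to come from the mass bounds instead. -/
lemma sum_norm_orbit_le (hD : ∀ j z, ‖Q j z‖ ≤ D z) (hD0 : ∀ z, 0 ≤ D z)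
    (hb : ∀ i, ∑ k, ‖P i k‖ ≤ b) (n : ℕ) (z : Fin n → ℝ) (y : Fin l → ℂ) :
    ∑ k, ‖orbit P Q n z y k‖ ≤ b ^ n * (∏ i, D (z i)) * ∑ k, ‖y k‖ := by
  induction n with
  | zero => simp [orbit]
  | succ n ih =>
    have hstep : ∑ k, ‖orbit P Q (n + 1) z y k‖ ≤
        ∑ i, ‖orbit P Q n (Fin.init z) y i‖ * (D (z (Fin.last n)) * b) := by
      calc _ ≤ ∑ k, ∑ i, ‖orbit P Q n (Fin.init z) y i‖ * (D (z (Fin.last n)) * ‖P i k‖) := by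
            refine Finset.sum_le_sum fun k _ => ?_
            simp only [orbit, rowStep]
            refine norm_sum_le_of_le _ fun i _ => ?_
            rw [norm_mul, norm_mul]
            gcongr
            exact hD _ _
        _ = ∑ i, ‖orbit P Q n (Fin.init z) y i‖ * (D (z (Fin.last n)) * ∑ k, ‖P i k‖) := by
            rw [Finset.sum_comm]
            refine Finset.sum_congr rfl fun i _ => ?_
            rw [← Finset.mul_sum, ← Finset.mul_sum]
        _ ≤ _ := by
            refine Finset.sum_le_sum fun i _ => ?_
            have := hD0 (z (Fin.last n))
            gcongr
            exact hb i
    rw [← Finset.sum_mul] at hstep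
    refine hstep.trans ?_
    -- Without states `b` could be negative; otherwise it bounds a sum of norms.
    by_cases hl : IsEmpty (Fin l)
    · simp
    · rw [not_isEmpty_iff] at hl
      obtain ⟨i⟩ := hl
      have hb0 : 0 ≤ b := (Finset.sum_nonneg fun k _ => norm_nonneg _).trans (hb i)
      refine (mul_le_mul_of_nonneg_right (ih (Fin.init z)) (mul_nonneg (hD0 _) hb0)).trans ?_
      rw [Fin.prod_univ_castSucc (fun i => D (z i))]
      simp only [Fin.init]
      exact (by ring : _ = _).le

/-- A dominating function for the integrand of the conditional entropy. -/
lemma norm_entropyIntegrand_le (hD : ∀ j z, ‖Q j z‖ ≤ D z) (hDL : ∀ j z, ‖Q j z * L z‖ ≤ D z)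
    (hb : ∀ i, ∑ k, ‖P i k‖ ≤ b) {n : ℕ} {z : Fin (n + 1) → ℝ} {y : Fin l → ℂ} {C : ℝ}
    (hC : ‖logRatio P Q I n z y‖ ≤ C) :
    ‖entropyIntegrand P Q L I n z y‖ ≤ b ^ n * (∑ k, ‖y k‖) * (1 + C) * ∏ i, D (z i) := by
  have hD0 : ∀ z, 0 ≤ D z := fun z => (norm_nonneg _).trans (hD I z)
  have hC0 : 0 ≤ C := (norm_nonneg _).trans hC
  have h := sum_norm_orbit_le hD hD0 hb n (Fin.init z) y
  rw [entropyIntegrand, outDensity, Finset.sum_mul]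
  calc _ ≤ ∑ k, ‖orbit P Q n (Fin.init z) y k‖ * (D (z (Fin.last n)) * (1 + C)) := by
        refine norm_sum_le_of_le _ fun k _ => ?_
        rw [mul_assoc, norm_mul, mul_add]
        refine mul_le_mul_of_nonneg_left ((norm_add_le _ _).trans ?_) (norm_nonneg _)
        rw [mul_add, mul_one]
        refine add_le_add (hDL _ _) ?_
        rw [norm_mul]
        exact mul_le_mul (hD _ _) hC (norm_nonneg _) (hD0 _)
    _ ≤ (b ^ n * (∏ i, D (Fin.init z i)) * ∑ k, ‖y k‖) * (D (z (Fin.last n)) * (1 + C)) := by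
        rw [← Finset.sum_mul]
        exact mul_le_mul_of_nonneg_right h (mul_nonneg (hD0 _) (by linarith))
    _ = _ := by
        rw [Fin.prod_univ_castSucc (fun i => D (z i))]
        simp only [Fin.init]
        ring

end Domination

/-- Successive conditional entropies differ little if the conditional densities depend little on
the remote past. -/
theorem norm_integral_entropyIntegrand_sub_le (hQ : ∀ j, Measurable (Q j))
    (hQi : ∀ j, Integrable (Q j)) (hQ1 : ∀ j, ∫ z, Q j z = 1) (hL : Measurable L)
    {v : Fin l → ℂ} (hv : ∀ k, ∑ i, v i * P i k = v k) {τ : ℝ}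
    (hτ : ∀ (a : ℝ) (z : Fin (n + 1) → ℝ),
      ‖logRatio P Q I n z (rowStep (fun i k => Q i a * P i k) v) - logRatio P Q I n z v‖ ≤ τ)
    (hint : Integrable fun z => entropyIntegrand P Q L I (n + 1) z v)
    (hfin : ∫⁻ z : Fin (n + 2) → ℝ, ‖outDensity P Q (n + 1) z v‖ₑ ≠ ∞) :
    ‖(∫ z, entropyIntegrand P Q L I (n + 1) z v) - ∫ z, entropyIntegrand P Q L I n z v‖ ≤
      τ * (∫⁻ z : Fin (n + 2) → ℝ, ‖outDensity P Q (n + 1) z v‖ₑ).toReal := by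
  set s : ℝ → Fin l → ℂ := fun a => rowStep (fun i k => Q i a * P i k) v with hs
  have hsm : Measurable s := measurable_rowStep hQ measurable_id measurable_const
  have hout : Integrable fun z => outDensity P Q (n + 1) z v :=
    ⟨(measurable_outDensity hQ measurable_id measurable_const).aestronglyMeasurable,
      lt_top_iff_ne_top.2 hfin⟩
  have hint' := integrable_finCons.2 hint
  have hout' := integrable_finCons.2 hout
  simp only [outDensity_cons] at hout'
  simp only [entropyIntegrand_cons] at hint'
  -- The hybrid integrand: the density of all `n + 2` outputs, but a logarithm that ignores the
  -- oldest one. The `L` terms agree with those of the full integrand, so the two differ only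
  -- through `logRatio`.
  let K : ℝ × (Fin (n + 1) → ℝ) → ℂ := fun q => outDensity P Q n q.2 (s q.1) *
    (L (q.2 (Fin.last n)) + logRatio P Q I n q.2 v)
  have hdiff : ∀ q : ℝ × (Fin (n + 1) → ℝ),
      entropyIntegrand P Q L I n q.2 (s q.1) - K q = outDensity P Q n q.2 (s q.1) *
        (logRatio P Q I n q.2 (s q.1) - logRatio P Q I n q.2 v) := by
    intro q; simp only [K, entropyIntegrand]; ring
  have hdle : ∀ q : ℝ × (Fin (n + 1) → ℝ),
      ‖entropyIntegrand P Q L I n q.2 (s q.1) - K q‖ ≤ τ * ‖outDensity P Q n q.2 (s q.1)‖ := by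
    intro q
    rw [hdiff, norm_mul, mul_comm]
    exact mul_le_mul_of_nonneg_right (hτ _ _) (norm_nonneg _)
  have hKm : Measurable K := by
    refine (measurable_outDensity hQ measurable_snd (hsm.comp measurable_fst)).mul
      (Measurable.add ?_ (measurable_logRatio hQ measurable_snd measurable_const))
    exact hL.comp ((measurable_pi_apply _).comp measurable_snd)
  have hdint : Integrable fun q : ℝ × (Fin (n + 1) → ℝ) =>
      entropyIntegrand P Q L I n q.2 (s q.1) - K q := by
    refine (hout'.norm.const_mul τ).mono' ?_ (ae_of_all _ hdle)
    exact hint'.1.sub hKm.aestronglyMeasurable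
  have hK : Integrable K := by
    have := hint'.sub hdint
    refine this.congr (ae_of_all _ fun q => ?_)
    simp [hs]
  -- Integrating out the oldest output replaces the weights `s a` by their mean, which is `v P = v`
  -- because each `Q j` integrates to 1. This is stationarity, for complex parameters.
  have hKint : ∫ q, K q = ∫ z, entropyIntegrand P Q L I n z v := by
    rw [Measure.volume_eq_prod, integral_prod_symm _ hK]
    congr 1
    ext z
    simp only [K, entropyIntegrand]
    rw [integral_mul_const]
    congr 1
    obtain ⟨c, hc⟩ := outDensity_linear (P := P) (Q := Q) n z
    simp only [hc, hs, rowStep]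
    simp_rw [Finset.sum_mul]
    have hi : ∀ i k, Integrable fun a => v k * (Q k a * P k i) * c i := fun i k =>
      (((hQi k).mul_const _).const_mul _).mul_const _
    rw [integral_finsetSum _ fun i _ => integrable_finsetSum _ fun k _ => hi i k]
    refine Finset.sum_congr rfl fun i _ => ?_
    rw [integral_finsetSum _ fun k _ => hi i k, ← hv i, Finset.sum_mul]
    refine Finset.sum_congr rfl fun k _ => ?_
    rw [integral_mul_const, integral_const_mul, integral_mul_const, hQ1, one_mul]
  rw [← hKint, ← integral_finCons]
  simp only [entropyIntegrand_cons]
  rw [← integral_sub hint' hK]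
  refine (norm_integral_le_of_norm_le (hout'.norm.const_mul τ) (ae_of_all _ hdle)).trans ?_
  rw [integral_const_mul]
  refine le_of_eq ?_
  congr 1
  rw [integral_norm_eq_lintegral_enorm hout'.1]
  congr 1
  have h := measurePreserving_finCons (n + 1)
  rw [← h.1.lintegral_comp_emb h.2]
  simp only [outDensity_cons]

end HiddenMarkov

/-! ### Uniform geometric convergence of the conditional entropies -/

namespace HiddenMarkov

variable {l n : ℕ}

lemma NearPositive.smul {p δ : ℝ} {y : Fin l → ℂ} (hy : NearPositive p δ y) {a : ℂ} (ha : a ≠ 0) :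
    NearPositive p δ (fun i => a * y i) := by
  obtain ⟨x, c, hc, hx, hxp, hy⟩ := hy
  refine ⟨x, a * c, mul_ne_zero ha hc, hx, hxp, fun i => ?_⟩
  rw [mul_assoc, ← mul_sub, norm_mul, norm_mul]
  have := mul_le_mul_of_nonneg_left (hy i) (norm_nonneg a)
  linarith

lemma ProjClose.smul {t : ℝ} {y y' : Fin l → ℂ} (h : ProjClose t y y') (a : ℂ) :
    ProjClose t (fun i => a * y i) (fun i => a * y' i) := by
  obtain ⟨c, hc, h⟩ := h
  refine ⟨c, hc, fun i => ?_⟩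
  have h1 : a * y' i - c * (a * y i) = a * (y' i - c * y i) := by ring
  rw [h1, norm_mul, norm_mul]
  have := mul_le_mul_of_nonneg_left (h i) (norm_nonneg a)
  linarith

/-- The constants of the perturbation argument: `p` is a lower bound for the entries of the
transition matrix, `δ` the size of the cone, `η` the size of the perturbation and `M` a bound for
the density ratios `R₀`. -/
structure Constants (p δ η M : ℝ) (I : Fin l) (R₀ : Fin l → ℝ → ℝ) : Prop where
  p_pos : 0 < p
  p_le : p ≤ 1
  δ_pos : 0 < δ
  δ_le : 32 * δ ≤ p ^ 6
  η_nonneg : 0 ≤ η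
  η_le : η ≤ 1
  ηδ : 3 * η * l ≤ δ * p ^ 4
  R_nonneg : ∀ j z, 0 ≤ R₀ j z
  R_I : ∀ z, R₀ I z = 1
  R_le : ∀ j z, R₀ j z ≤ M

/-- The complex transition matrix and densities are close to real positive ones. -/
structure IsClose (p η : ℝ) (I : Fin l) (P₀ : Fin l → Fin l → ℝ) (R₀ : Fin l → ℝ → ℝ)
    (P : Fin l → Fin l → ℂ) (Q : Fin l → ℝ → ℂ) : Prop where
  ne : ∀ z, Q I z ≠ 0
  pert : ∀ z, IsPerturbation p η I (fun i k => R₀ i z * P₀ i k) (fun i k => Q i z / Q I z * P i k)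
  ratio : ∀ j z, ‖Q j z / Q I z - R₀ j z‖ ≤ η

variable {p δ η M : ℝ} {I : Fin l} {P₀ : Fin l → Fin l → ℝ} {R₀ : Fin l → ℝ → ℝ}
  {P : Fin l → Fin l → ℂ} {Q : Fin l → ℝ → ℂ} {v : Fin l → ℂ}

lemma Constants.δ_le' (h : Constants p δ η M I R₀) : 6 * δ ≤ p ^ 4 ∧ 8 * δ ≤ 1 ∧ δ ≤ 1 / 2 := by
  have h1 := h.δ_pos
  have h2 := h.δ_le
  have h4 : p ^ 6 ≤ p ^ 4 := pow_le_pow_of_le_one h.p_pos.le h.p_le (by norm_num)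
  have h5 : p ^ 4 ≤ 1 := pow_le_one₀ h.p_pos.le h.p_le
  refine ⟨?_, ?_, ?_⟩ <;> linarith

/-- The scalar `Q I a`, which may be arbitrarily small, is irrelevant projectively; removing it
leaves matrices that are controlled uniformly in `a`. -/
lemma IsClose.rowStep_eq (h : IsClose p η I P₀ R₀ P Q) (a : ℝ) (y : Fin l → ℂ) :
    rowStep (fun i k => Q i a * P i k) y =
      fun k => Q I a * rowStep (fun i k => Q i a / Q I a * P i k) y k := by
  ext k
  rw [rowStep, rowStep, Finset.mul_sum]
  refine Finset.sum_congr rfl fun i _ => ?_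
  have := h.ne a
  field_simp

lemma NearPositive.rowStep (hc : Constants p δ η M I R₀) (h : IsClose p η I P₀ R₀ P Q)
    (hv : NearPositive p δ v) (a : ℝ) :
    NearPositive p δ (rowStep (fun i k => Q i a * P i k) v) := by
  rw [h.rowStep_eq]
  exact (hv.step (h.pert a) hc.p_pos hc.p_le hc.η_nonneg hc.δ_pos hc.δ_le'.2.2 hc.ηδ).smul (h.ne a)

lemma NearPositive.orbit (hc : Constants p δ η M I R₀) (h : IsClose p η I P₀ R₀ P Q)
    (hv : NearPositive p δ v) (n : ℕ) (z : Fin n → ℝ) : NearPositive p δ (orbit P Q n z v) := by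
  induction n with
  | zero => exact hv
  | succ n ih => exact (ih (Fin.init z)).rowStep hc h _

/-- The contraction rate. -/
lemma Constants.rate (h : Constants p δ η M I R₀) : 0 < 1 - p ^ 6 / 4 ∧ 1 - p ^ 6 / 4 < 1 := by
  have h1 := pow_pos h.p_pos 6
  have h2 : p ^ 6 ≤ 1 := pow_le_one₀ h.p_pos.le h.p_le
  constructor <;> linarith

lemma NearPositive.projClose_orbit (hc : Constants p δ η M I R₀) (h : IsClose p η I P₀ R₀ P Q)
    (hv : NearPositive p δ v) {v' : Fin l → ℂ} (hv' : NearPositive p δ v') (n : ℕ)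
    (z : Fin n → ℝ) :
    ProjClose ((1 - p ^ 6 / 4) ^ n * (1 - p ^ 4 / 2)) (HiddenMarkov.orbit P Q n z v)
      (HiddenMarkov.orbit P Q n z v') := by
  have hp4 := pow_pos hc.p_pos 4
  have hp41 : p ^ 4 ≤ 1 := pow_le_one₀ hc.p_pos.le hc.p_le
  induction n with
  | zero => simpa [HiddenMarkov.orbit] using
      hv.projClose hc.p_pos hc.p_le hc.δ_pos hc.δ_le'.1 I hv'
  | succ n ih =>
    have hr := pow_le_one₀ (n := n) hc.rate.1.le hc.rate.2.le
    have hr0 := pow_nonneg hc.rate.1.le n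
    -- The initial distance `1 - p ^ 4 / 2` dictates `σ = p ^ 4 / 2`. Then the contraction factor `1
    -- - p ^ 2 * σ / 2` is `1 - p ^ 6 / 4`, and the required `16 * δ ≤ p ^ 2 * σ` is the assumption
    -- `32 * δ ≤ p ^ 6`.
    have h1 := (ih (Fin.init z)).step (h.pert (z (Fin.last n))) hc.p_pos hc.p_le hc.η_nonneg
      hc.δ_pos (σ := p ^ 4 / 2) (by positivity) (by linarith)
      (by have := hc.δ_le; nlinarith) hc.ηδ (hv.orbit hc h n (Fin.init z))
      (mul_nonneg hr0 (by linarith)) (by nlinarith)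
    have h2 := h1.smul (Q I (z (Fin.last n)))
    rw [← h.rowStep_eq, ← h.rowStep_eq] at h2
    have h3 : (1 - p ^ 6 / 4) ^ (n + 1) * (1 - p ^ 4 / 2) =
        (1 - p ^ 2 * (p ^ 4 / 2) / 2) * ((1 - p ^ 6 / 4) ^ n * (1 - p ^ 4 / 2)) := by ring
    rw [h3]
    exact h2

/-- Confinement to a right half-plane, uniformly in the outputs and in `n`, makes the principal
logarithm holomorphic and bounded along all orbits. -/
lemma IsClose.weightedMean_re (hc : Constants p δ η M I R₀) (h : IsClose p η I P₀ R₀ P Q)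
    {y : Fin l → ℂ} (hy : NearPositive p δ y) (a : ℝ) :
    p / (2 * l) ≤ (weightedMean (fun j => Q j a / Q I a) y).re ∧
      ‖weightedMean (fun j => Q j a / Q I a) y‖ ≤ 2 * M := by
  have hl : (0 : ℝ) < l := by exact_mod_cast (Nat.zero_le _).trans_lt I.2
  obtain ⟨b, hb1, hb2, hb3⟩ := hy.weightedMean_near hc.p_pos hc.p_le hc.δ_pos hc.δ_le'.2.1
    hc.η_nonneg hc.ηδ (fun j => hc.R_nonneg j a) (hc.R_I a) (fun j => hc.R_le j a)
    (fun j => h.ratio j a)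
  have hb0 : 0 < b := lt_of_lt_of_le (div_pos hc.p_pos hl) hb1
  constructor
  · have h1 := Complex.abs_re_le_norm (weightedMean (fun j => Q j a / Q I a) y - b)
    rw [Complex.sub_re, Complex.ofReal_re] at h1
    have h2 := (abs_le.1 (h1.trans hb3)).1
    have h3 : p / (2 * l) = p / l / 2 := by rw [div_div, mul_comm]
    rw [h3]; linarith
  · have h1 := norm_add_le (weightedMean (fun j => Q j a / Q I a) y - b) b
    rw [sub_add_cancel, Complex.norm_real, Real.norm_of_nonneg hb0.le] at h1
    linarith

lemma IsClose.norm_logRatio_le (hc : Constants p δ η M I R₀) (h : IsClose p η I P₀ R₀ P Q)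
    (hv : NearPositive p δ v) (n : ℕ) (z : Fin (n + 1) → ℝ) :
    ‖logRatio P Q I n z v‖ ≤ (p / (2 * l))⁻¹ * (2 * M + 1) := by
  have hl : (1 : ℝ) ≤ l := by exact_mod_cast (Nat.zero_le _).trans_lt I.2
  have h1 := h.weightedMean_re hc (hv.orbit hc h n (Fin.init z)) (z (Fin.last n))
  have hp := hc.p_pos
  refine norm_log_le (by positivity) h1.1 h1.2 ?_
  rw [div_le_one (by positivity)]
  linarith [hc.p_le]

lemma IsClose.norm_logRatio_sub_le (hc : Constants p δ η M I R₀) (h : IsClose p η I P₀ R₀ P Q)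
    (hv : NearPositive p δ v) {v' : Fin l → ℂ} (hv' : NearPositive p δ v') (n : ℕ)
    (z : Fin (n + 1) → ℝ) :
    ‖logRatio P Q I n z v' - logRatio P Q I n z v‖ ≤
      (p / (2 * l))⁻¹ * (8 * (M + 1) / (p ^ 4 / 2)) * (1 - p ^ 6 / 4) ^ n := by
  have hp4 := pow_pos hc.p_pos 4
  have hp41 : p ^ 4 ≤ 1 := pow_le_one₀ hc.p_pos.le hc.p_le
  have hr := pow_le_one₀ (n := n) hc.rate.1.le hc.rate.2.le
  have hr0 := pow_nonneg hc.rate.1.le n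
  have hp := hc.p_pos
  have hM : 0 ≤ M := (hc.R_nonneg I 0).trans (hc.R_le I 0)
  refine ((hv.orbit hc h n (Fin.init z)).norm_log_weightedMean_sub_le hc.p_pos hc.p_le hc.δ_pos
    hc.δ_le'.2.1 hc.η_nonneg hc.η_le hc.ηδ (fun j => hc.R_nonneg j _) (hc.R_I _)
    (fun j => hc.R_le j _) (fun j => h.ratio j (z (Fin.last n))) (hv'.orbit hc h n (Fin.init z))
    (σ := p ^ 4 / 2) (by positivity)
    (mul_nonneg hr0 (by linarith)) (by nlinarith)
    (hv.projClose_orbit hc h hv' n (Fin.init z))).trans ?_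
  refine mul_le_mul_of_nonneg_left ?_ (by positivity)
  nlinarith

/-! ### Holomorphy of the conditional entropies and of their limit -/

section Analytic

variable {E : Type*} [NormedAddCommGroup E] [NormedSpace ℂ E]

lemma differentiableOn_div {U : Set E} {f g : E → ℂ} (hf : DifferentiableOn ℂ f U)
    (hg : DifferentiableOn ℂ g U) (h0 : ∀ e ∈ U, g e ≠ 0) :
    DifferentiableOn ℂ (fun e => f e / g e) U := by
  simp only [div_eq_mul_inv]
  exact hf.mul (hg.fun_inv h0)

lemma differentiableOn_orbit {U : Set E} {P : E → Fin l → Fin l → ℂ} {v : E → Fin l → ℂ}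
    {Q : E → Fin l → ℝ → ℂ} (hP : ∀ i k, DifferentiableOn ℂ (fun e => P e i k) U)
    (hv : ∀ i, DifferentiableOn ℂ (fun e => v e i) U)
    (hQ : ∀ j z, DifferentiableOn ℂ (fun e => Q e j z) U) (n : ℕ) (z : Fin n → ℝ) :
    ∀ k, DifferentiableOn ℂ (fun e => orbit (P e) (Q e) n z (v e) k) U := by
  induction n with
  | zero => exact hv
  | succ n ih =>
    intro k
    simp only [orbit, rowStep]
    exact DifferentiableOn.fun_sum fun i _ => (ih _ i).mul ((hQ i _).mul (hP i k))

lemma differentiableOn_entropyIntegrand {U : Set E} {P : E → Fin l → Fin l → ℂ} {v : E → Fin l → ℂ}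
    {Q : E → Fin l → ℝ → ℂ} {L : E → ℝ → ℂ} (hP : ∀ i k, DifferentiableOn ℂ (fun e => P e i k) U)
    (hv : ∀ i, DifferentiableOn ℂ (fun e => v e i) U)
    (hQ : ∀ j z, DifferentiableOn ℂ (fun e => Q e j z) U)
    (hL : ∀ z, DifferentiableOn ℂ (fun e => L e z) U)
    (hc : Constants p δ η M I R₀) (h : ∀ e ∈ U, IsClose p η I P₀ R₀ (P e) (Q e))
    (hvn : ∀ e ∈ U, NearPositive p δ (v e)) (n : ℕ) (z : Fin (n + 1) → ℝ) :
    DifferentiableOn ℂ (fun e => entropyIntegrand (P e) (Q e) (L e) I n z (v e)) U := by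
  have ho := differentiableOn_orbit hP hv hQ n (Fin.init z)
  refine DifferentiableOn.mul (DifferentiableOn.fun_sum fun k _ => (ho k).mul (hQ k _))
    (DifferentiableOn.add (hL _) (DifferentiableOn.clog ?_ ?_))
  on_goal 1 =>
    refine differentiableOn_div (f := fun e => ∑ j, orbit (P e) (Q e) n (Fin.init z) (v e) j *
      (Q e j (z (Fin.last n)) / Q e I (z (Fin.last n))))
      (g := fun e => ∑ j, orbit (P e) (Q e) n (Fin.init z) (v e) j) ?_ ?_ ?_
  · exact DifferentiableOn.fun_sum fun k _ => (ho k).mul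
      (differentiableOn_div (hQ k _) (hQ I _) fun e he => (h e he).ne _)
  · exact DifferentiableOn.fun_sum fun k _ => ho k
  · intro e he
    have h1 := (hvn e he).orbit hc (h e he) n (Fin.init z)
    rw [← norm_pos_iff]
    have h2 := h1.norm_sum_ge hc.δ_le'.2.1
    have h3 := h1.sum_norm_pos hc.δ_le'.2.1 I
    linarith
  · intro e he
    left
    have hl : (0 : ℝ) < l := by exact_mod_cast (Nat.zero_le _).trans_lt I.2
    have hp := hc.p_pos
    exact lt_of_lt_of_le (by positivity)
      ((h e he).weightedMean_re hc ((hvn e he).orbit hc (h e he) n (Fin.init z)) _).1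

variable [FiniteDimensional ℂ E]

/-- The conditional entropies converge to an analytic function, uniformly on an open set of
complex parameters that are close to real positive ones. -/
theorem exists_analyticOnNhd_limit {U : Set E} (hU : IsOpen U) {P : E → Fin l → Fin l → ℂ}
    {v : E → Fin l → ℂ} {Q : E → Fin l → ℝ → ℂ} {L : E → ℝ → ℂ}
    (hP : ∀ i k, DifferentiableOn ℂ (fun e => P e i k) U)
    (hv : ∀ i, DifferentiableOn ℂ (fun e => v e i) U)
    (hQ : ∀ j z, DifferentiableOn ℂ (fun e => Q e j z) U)
    (hL : ∀ z, DifferentiableOn ℂ (fun e => L e z) U)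
    (hQm : ∀ e ∈ U, ∀ j, Measurable (Q e j)) (hLm : ∀ e ∈ U, Measurable (L e))
    (hvP : ∀ e ∈ U, ∀ k, ∑ i, v e i * P e i k = v e k) (hQ1 : ∀ e ∈ U, ∀ j, ∫ z, Q e j z = 1)
    {D : ℝ → ℝ} (hD : Integrable D) (hQD : ∀ e ∈ U, ∀ j z, ‖Q e j z‖ ≤ D z)
    (hLD : ∀ e ∈ U, ∀ j z, ‖Q e j z * L e z‖ ≤ D z)
    (hc : Constants p δ η M I R₀) (h : ∀ e ∈ U, IsClose p η I P₀ R₀ (P e) (Q e))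
    (hvn : ∀ e ∈ U, NearPositive p δ (v e)) {b : ℝ} (hvb : ∀ e ∈ U, ∑ k, ‖v e k‖ ≤ b)
    {A : ℝ} (hA : 0 ≤ A) (hA1 : A * A * (1 - p ^ 6 / 4) < 1)
    (hQA : ∀ e ∈ U, ∀ j, ∫ z, ‖Q e j z‖ ≤ A) (hPA : ∀ e ∈ U, ∀ i, ∑ k, ‖P e i k‖ ≤ A) :
    (∀ e ∈ U, ∀ n, Integrable fun z => entropyIntegrand (P e) (Q e) (L e) I n z (v e)) ∧
    ∃ F : E → ℂ, AnalyticOnNhd ℂ F U ∧ ∀ e ∈ U, Tendsto (fun n =>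
      ∫ z, entropyIntegrand (P e) (Q e) (L e) I n z (v e)) atTop (𝓝 (F e)) := by
  have hD0 : ∀ z, U.Nonempty → 0 ≤ D z := fun z ⟨e, he⟩ => (norm_nonneg _).trans (hQD e he I z)
  set Cw : ℝ := (p / (2 * l))⁻¹ * (2 * M + 1) with hCw
  have hDn : ∀ n : ℕ, Integrable fun z : Fin (n + 1) → ℝ =>
      A ^ n * b * (1 + Cw) * ∏ i, D (z i) := fun n =>
    (Integrable.fintype_prod fun _ => hD).const_mul _
  have hp := hc.p_pos
  have hM : 0 ≤ M := (hc.R_nonneg I 0).trans (hc.R_le I 0)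
  have hCw0 : 0 ≤ Cw := by positivity
  have hbound : ∀ n : ℕ, ∀ e ∈ U, ∀ z : Fin (n + 1) → ℝ,
      ‖entropyIntegrand (P e) (Q e) (L e) I n z (v e)‖ ≤ A ^ n * b * (1 + Cw) * ∏ i, D (z i) := by
    intro n e he z
    refine (norm_entropyIntegrand_le (hQD e he) (hLD e he) (hPA e he)
      ((h e he).norm_logRatio_le hc (hvn e he) n z)).trans ?_
    refine mul_le_mul_of_nonneg_right (mul_le_mul_of_nonneg_right
      (mul_le_mul_of_nonneg_left (hvb e he) (by positivity)) (by positivity)) ?_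
    exact Finset.prod_nonneg fun i _ => hD0 _ ⟨e, he⟩
  have hmeas : ∀ n : ℕ, ∀ e ∈ U, AEStronglyMeasurable
      (fun z : Fin (n + 1) → ℝ => entropyIntegrand (P e) (Q e) (L e) I n z (v e)) volume :=
    fun n e he => (measurable_entropyIntegrand (hQm e he) measurable_id measurable_const
      (hLm e he)).aestronglyMeasurable
  have hint : ∀ e ∈ U, ∀ n, Integrable fun z => entropyIntegrand (P e) (Q e) (L e) I n z (v e) :=
    fun e he n => (hDn n).mono' (hmeas n e he) (ae_of_all _ (hbound n e he))
  refine ⟨hint, ?_⟩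
  set G : ℕ → E → ℂ := fun n e => ∫ z, entropyIntegrand (P e) (Q e) (L e) I n z (v e) with hG
  have hGan : ∀ n, AnalyticOnNhd ℂ (G n) U := fun n =>
    analyticOnNhd_integral_of_dominated hU (hmeas n)
      (differentiableOn_entropyIntegrand hP hv hQ hL hc h hvn n) (hDn n) (hbound n)
  set ρ := A * A * (1 - p ^ 6 / 4) with hρ
  have hρ0 : 0 ≤ ρ := mul_nonneg (mul_nonneg hA hA) hc.rate.1.le
  set K : ℝ := (p / (2 * l))⁻¹ * (8 * (M + 1) / (p ^ 4 / 2)) with hK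
  have hK0 : 0 ≤ K := by positivity
  -- The decay of the logarithms competes with the mass of `n + 2` complexified outputs, which is at
  -- most `A * (A * A) ^ (n + 1) * b`.
  have hdiff : ∀ n : ℕ, ∀ e ∈ U, ‖G (n + 1) e - G n e‖ ≤ K * A * (A * A) * b * ρ ^ n := by
    intro n e he
    have hQi : ∀ j, Integrable (Q e j) := fun j =>
      hD.mono' (hQm e he j).aestronglyMeasurable (ae_of_all _ (hQD e he j))
    have hA' : ∀ j, ∫⁻ z, ‖Q e j z‖ₑ ≤ ENNReal.ofReal A := by
      intro j
      rw [← ofReal_integral_norm_eq_lintegral_enorm (hQi j)]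
      exact ENNReal.ofReal_le_ofReal (hQA e he j)
    have hsum : ∀ f : Fin l → ℂ, ∑ k, ‖f k‖ₑ = ENNReal.ofReal (∑ k, ‖f k‖) := by
      intro f
      rw [ENNReal.ofReal_sum_of_nonneg fun k _ => norm_nonneg _]
      exact Finset.sum_congr rfl fun k _ => (ofReal_norm _).symm
    have hP' : ∀ i, ∑ k, ‖P e i k‖ₑ ≤ ENNReal.ofReal A := by
      intro i
      rw [hsum]
      exact ENNReal.ofReal_le_ofReal (hPA e he i)
    have hmass := lintegral_outDensity_le (hQm e he) hA' hP' (n + 1) (v e)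
    have hv' : ∑ k, ‖v e k‖ₑ ≤ ENNReal.ofReal b := by
      rw [hsum]; exact ENNReal.ofReal_le_ofReal (hvb e he)
    have hb0 : 0 ≤ b := (Finset.sum_nonneg fun k _ => norm_nonneg _).trans (hvb e he)
    have hmass2 : ∫⁻ z : Fin (n + 2) → ℝ, ‖outDensity (P e) (Q e) (n + 1) z (v e)‖ₑ ≤
        ENNReal.ofReal (A * ((A * A) ^ (n + 1) * b)) := by
      refine hmass.trans ?_
      rw [ENNReal.ofReal_mul hA, ENNReal.ofReal_mul (by positivity), ENNReal.ofReal_pow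
        (by positivity), ENNReal.ofReal_mul hA]
      gcongr
    have h1 := norm_integral_entropyIntegrand_sub_le (hQm e he) hQi (hQ1 e he) (hLm e he)
      (hvP e he) (n := n) (I := I) (L := L e)
      (fun a z => (h e he).norm_logRatio_sub_le hc (hvn e he) ((hvn e he).rowStep hc (h e he) a) n z)
      (hint e he (n + 1)) (ne_top_of_le_ne_top ENNReal.ofReal_ne_top hmass2)
    refine h1.trans ?_
    have h2 := ENNReal.toReal_le_of_le_ofReal (by positivity) hmass2
    have h3 := pow_nonneg hc.rate.1.le n
    calc _ ≤ K * (1 - p ^ 6 / 4) ^ n * (A * ((A * A) ^ (n + 1) * b)) :=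
          mul_le_mul_of_nonneg_left h2 (mul_nonneg hK0 h3)
      _ = _ := by rw [hρ, mul_pow (A * A)]; ring
  have hsumm : Summable fun n : ℕ => K * A * (A * A) * b * ρ ^ n :=
    (summable_geometric_of_lt_one hρ0 hA1).mul_left _
  have hunif := tendstoUniformlyOn_tsum_nat hsumm hdiff
  have hpart : ∀ N e, ∑ n ∈ Finset.range N, (G (n + 1) e - G n e) = G N e - G 0 e := fun N e =>
    Finset.sum_range_sub (fun n => G n e) N
  have hlim := analyticOnNhd_of_tendstoUniformlyOn hU (fun N => by
    simp only [hpart]; exact (hGan N).sub (hGan 0)) hunif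
  refine ⟨fun e => (∑' n, (G (n + 1) e - G n e)) + G 0 e, hlim.add (hGan 0), fun e he => ?_⟩
  have h1 := (hunif.tendsto_at he).add_const (G 0 e)
  refine h1.congr fun N => ?_
  rw [hpart, sub_add_cancel]

end Analytic

end HiddenMarkov

/-! ### The entropy rate as a limit of conditional entropies -/

namespace HiddenMarkov

variable {l : ℕ} {P : Fin l → Fin l → ℝ} {v : Fin l → ℝ} {q : Fin l → ℝ → ℝ} {I : Fin l}

lemma blockDensity_cons (n : ℕ) (a : ℝ) (z : Fin (n + 1) → ℝ) :
    blockDensity P v q (n + 1) (Fin.cons a z) =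
      blockDensity P (fun k => ∑ i, v i * (q i a * P i k)) q n z := by
  unfold blockDensity
  rw [← Fintype.sum_equiv (Fin.consEquiv fun _ : Fin (n + 2) => Fin l) (fun p =>
    (v p.1 * (P p.1 (p.2 0) * ∏ k : Fin n, P (p.2 k.castSucc) (p.2 k.succ))) *
      (q p.1 a * ∏ k : Fin (n + 1), q (p.2 k) (z k)))]
  · rw [Fintype.sum_prod_type, Finset.sum_comm]
    refine Finset.sum_congr rfl fun y _ => ?_
    rw [Finset.sum_mul, Finset.sum_mul]
    exact Finset.sum_congr rfl fun i _ => by ring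
  · rintro ⟨i, y⟩
    have hP : ∏ k : Fin (n + 1), P ((Fin.cons i y : Fin (n + 2) → Fin l) k.castSucc)
        ((Fin.cons i y : Fin (n + 2) → Fin l) k.succ) =
        P i (y 0) * ∏ k : Fin n, P (y k.castSucc) (y k.succ) := by
      rw [Fin.prod_univ_succ]
      simp [← Fin.succ_castSucc, -Fin.castSucc_succ]
    have hq : ∏ k : Fin (n + 2), q ((Fin.cons i y : Fin (n + 2) → Fin l) k)
        ((Fin.cons a z : Fin (n + 2) → ℝ) k) = q i a * ∏ k, q (y k) (z k) := by
      rw [Fin.prod_univ_succ]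
      simp
    simp only [Fin.consEquiv_apply]
    rw [hP, hq, Fin.cons_zero]

/-- The sum over input paths is a product of matrices. The vector `v` is quantified inside the
induction, since removing the first output changes it to one that need not be stationary or
normalized. -/
lemma ofReal_blockDensity (n : ℕ) : ∀ (v : Fin l → ℝ) (z : Fin (n + 1) → ℝ),
    (blockDensity P v q n z : ℂ) = outDensity (fun i k => (P i k : ℂ)) (fun j z => (q j z : ℂ)) n z
      (fun i => (v i : ℂ)) := by
  induction n with
  | zero =>
    intro v z
    simp only [blockDensity, outDensity, orbit]
    push_cast
    rw [Fintype.sum_equiv (Equiv.funUnique (Fin 1) (Fin l))]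
    intro y
    simp
  | succ n ih =>
    intro v z
    rw [← Fin.cons_self_tail z, blockDensity_cons, ih, outDensity_cons]
    congr 1
    ext k
    simp [rowStep]

/-- Orbits of real data are real. -/
noncomputable def realOrbit (P : Fin l → Fin l → ℝ) (v : Fin l → ℝ) (q : Fin l → ℝ → ℝ) (n : ℕ)
    (z : Fin n → ℝ) (k : Fin l) : ℝ :=
  (orbit (fun i k => (P i k : ℂ)) (fun j z => (q j z : ℂ)) n z (fun i => (v i : ℂ)) k).re

lemma ofReal_realOrbit (n : ℕ) (z : Fin n → ℝ) (k : Fin l) :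
    (realOrbit P v q n z k : ℂ) =
      orbit (fun i k => (P i k : ℂ)) (fun j z => (q j z : ℂ)) n z (fun i => (v i : ℂ)) k := by
  induction n generalizing k with
  | zero => simp [realOrbit, orbit]
  | succ n ih =>
    have : orbit (fun i k => (P i k : ℂ)) (fun j z => (q j z : ℂ)) (n + 1) z
        (fun i => (v i : ℂ)) k = ((∑ i, realOrbit P v q n (Fin.init z) i *
          (q i (z (Fin.last n)) * P i k) : ℝ) : ℂ) := by
      simp only [orbit, rowStep]
      push_cast
      exact Finset.sum_congr rfl fun i _ => by rw [ih]
    rw [realOrbit, this, Complex.ofReal_re]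

lemma realOrbit_zero (z : Fin 0 → ℝ) : realOrbit P v q 0 z = v := by
  ext k; simp [realOrbit, orbit]

lemma realOrbit_succ (n : ℕ) (z : Fin (n + 1) → ℝ) (k : Fin l) : realOrbit P v q (n + 1) z k =
    ∑ i, realOrbit P v q n (Fin.init z) i * (q i (z (Fin.last n)) * P i k) := by
  apply Complex.ofReal_injective
  rw [ofReal_realOrbit]
  push_cast
  simp only [ofReal_realOrbit, orbit, rowStep]

lemma blockDensity_eq_realOrbit (n : ℕ) (z : Fin (n + 1) → ℝ) :
    blockDensity P v q n z = ∑ k, realOrbit P v q n (Fin.init z) k * q k (z (Fin.last n)) := by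
  apply Complex.ofReal_injective
  rw [ofReal_blockDensity]
  push_cast
  simp only [ofReal_realOrbit, outDensity]

/-- The rows of `P` sum to one, so the normalizing constant of the filter is the density of the
outputs seen so far. This identifies the logarithm in `entropyIntegrand_ofReal` with that of a
conditional density. -/
lemma realOrbit_sum (hP : ∀ i, ∑ k, P i k = 1) (n : ℕ) (z : Fin (n + 1) → ℝ) :
    ∑ k, realOrbit P v q (n + 1) z k = blockDensity P v q n z := by
  rw [blockDensity_eq_realOrbit]
  simp only [realOrbit_succ]
  rw [Finset.sum_comm]
  refine Finset.sum_congr rfl fun i _ => ?_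
  rw [← Finset.mul_sum, ← Finset.mul_sum, hP, mul_one]

lemma realOrbit_pos (hP : ∀ i k, 0 < P i k) (hv : ∀ i, 0 < v i) (hq : ∀ j z, 0 ≤ q j z)
    (hqI : ∀ z, 0 < q I z) (n : ℕ) (z : Fin n → ℝ) (k : Fin l) : 0 < realOrbit P v q n z k := by
  induction n generalizing k with
  | zero => rw [realOrbit_zero]; exact hv k
  | succ n ih =>
    rw [realOrbit_succ]
    refine Finset.sum_pos' (fun i _ => mul_nonneg (ih _ i).le (mul_nonneg (hq _ _) (hP _ _).le))
      ⟨I, Finset.mem_univ I, mul_pos (ih _ I) (mul_pos (hqI _) (hP _ _))⟩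

lemma blockDensity_pos (hP : ∀ i k, 0 < P i k) (hv : ∀ i, 0 < v i) (hq : ∀ j z, 0 ≤ q j z)
    (hqI : ∀ z, 0 < q I z) (n : ℕ) (z : Fin (n + 1) → ℝ) : 0 < blockDensity P v q n z := by
  rw [blockDensity_eq_realOrbit]
  refine Finset.sum_pos' (fun i _ => mul_nonneg (realOrbit_pos hP hv hq hqI n _ i).le (hq _ _))
      ⟨I, Finset.mem_univ I, mul_pos (realOrbit_pos hP hv hq hqI n _ I) (hqI _)⟩

lemma measurable_realOrbit (hq : ∀ j, Measurable (q j)) (n : ℕ) (k : Fin l) :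
    Measurable fun z => realOrbit P v q n z k :=
  Complex.measurable_re.comp (measurable_orbit (fun j => Complex.measurable_ofReal.comp (hq j))
    measurable_id measurable_const k)

lemma measurable_blockDensity (hq : ∀ j, Measurable (q j)) (n : ℕ) :
    Measurable (blockDensity P v q n) := by
  have : blockDensity P v q n = fun z => ∑ k, realOrbit P v q n (Fin.init z) k *
      q k (z (Fin.last n)) := funext fun z => blockDensity_eq_realOrbit n z
  rw [this]
  refine Finset.measurable_fun_sum _ fun k _ => Measurable.mul ?_
    ((hq k).comp (measurable_pi_apply _))
  exact (measurable_realOrbit hq n k).comp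
    (measurable_pi_lambda _ fun i => measurable_pi_apply i.castSucc)

/-- For real data the integrand of the conditional entropy is real. -/
lemma entropyIntegrand_ofReal (hP : ∀ i k, 0 < P i k) (hv : ∀ i, 0 < v i) (hq : ∀ j z, 0 ≤ q j z)
    (hqI : ∀ z, 0 < q I z) (n : ℕ) (z : Fin (n + 1) → ℝ) :
    entropyIntegrand (fun i k => (P i k : ℂ)) (fun j z => (q j z : ℂ))
      (fun z => (Real.log (q I z) : ℂ)) I n z (fun i => (v i : ℂ)) =
    ((blockDensity P v q n z * (Real.log (blockDensity P v q n z) -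
      Real.log (∑ k, realOrbit P v q n (Fin.init z) k)) : ℝ) : ℂ) := by
  set a := z (Fin.last n)
  set o := realOrbit P v q n (Fin.init z) with ho
  have hopos : ∀ k, 0 < o k := realOrbit_pos hP hv hq hqI n _
  have hS : 0 < ∑ k, o k := Finset.sum_pos (fun k _ => hopos k) ⟨I, Finset.mem_univ I⟩
  have hB := blockDensity_pos hP hv hq hqI n z
  have hw : weightedMean (fun j => (q j a : ℂ) / (q I a : ℂ))
      (orbit (fun i k => (P i k : ℂ)) (fun j z => (q j z : ℂ)) n (Fin.init z)
        (fun i => (v i : ℂ))) = ((blockDensity P v q n z / q I a / ∑ k, o k : ℝ) : ℂ) := by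
    rw [blockDensity_eq_realOrbit, weightedMean]
    simp only [← ofReal_realOrbit]
    push_cast
    congr 1
    rw [Finset.sum_div]
    refine Finset.sum_congr rfl fun k _ => ?_
    rw [mul_div_assoc]
  rw [entropyIntegrand, ← ofReal_blockDensity, logRatio, hw, ← Complex.ofReal_log
    (div_nonneg (div_nonneg hB.le (hqI _).le) hS.le), ← Complex.ofReal_add, ← Complex.ofReal_mul,
    Real.log_div (div_pos hB (hqI _)).ne' hS.ne', Real.log_div hB.ne' (hqI _).ne']
  congr 2
  ring

lemma IsProbDensity.integrable {f : ℝ → ℝ} (hf : IsProbDensity f) : Integrable f := by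
  refine ⟨hf.1.aestronglyMeasurable, ?_⟩
  rw [hasFiniteIntegral_iff_ofReal (ae_of_all _ hf.2.1), hf.2.2]
  exact ENNReal.one_lt_top

lemma IsProbDensity.integral_eq {f : ℝ → ℝ} (hf : IsProbDensity f) : ∫ z, f z = 1 := by
  rw [integral_eq_lintegral_of_nonneg_ae (ae_of_all _ hf.2.1) hf.1.aestronglyMeasurable, hf.2.2,
    ENNReal.toReal_one]

/-- Integrals against a block density of functions of all but the last output. -/
lemma integral_blockDensity_mul_init (hPs : ∀ i, ∑ k, P i k = 1) (hP : ∀ i k, 0 < P i k)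
    (hv : ∀ i, 0 < v i) (hq : ∀ j, IsProbDensity (q j)) (hqI : ∀ z, 0 < q I z) (n : ℕ)
    {g : (Fin (n + 1) → ℝ) → ℝ} (hgm : Measurable g)
    (hg : Integrable fun z => blockDensity P v q n z * g z) :
    Integrable (fun z => blockDensity P v q (n + 1) z * g (Fin.init z)) ∧
    ∫ z, blockDensity P v q (n + 1) z * g (Fin.init z) = ∫ z, blockDensity P v q n z * g z := by
  have hq0 : ∀ j z, 0 ≤ q j z := fun j => (hq j).2.1
  have hsnoc : ∀ (z : Fin (n + 1) → ℝ) (a : ℝ), blockDensity P v q (n + 1) (Fin.snoc z a) =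
      ∑ k, realOrbit P v q (n + 1) z k * q k a := by
    intro z a
    rw [blockDensity_eq_realOrbit, Fin.init_snoc, Fin.snoc_last]
  have hin : ∀ z : Fin (n + 1) → ℝ, Integrable fun a : ℝ =>
      blockDensity P v q (n + 1) (Fin.snoc z a) := by
    intro z
    simp only [hsnoc]
    exact integrable_finsetSum _ fun k _ => (hq k).integrable.const_mul _
  -- Integrating out the newest output recovers the shorter block density, so the block densities
  -- are consistent.
  have hmarg : ∀ z : Fin (n + 1) → ℝ, ∫ a : ℝ, blockDensity P v q (n + 1) (Fin.snoc z a) =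
      blockDensity P v q n z := by
    intro z
    simp only [hsnoc]
    rw [integral_finsetSum _ fun k _ => (hq k).integrable.const_mul _, ← realOrbit_sum hPs]
    refine Finset.sum_congr rfl fun k _ => ?_
    rw [integral_const_mul, (hq k).integral_eq, mul_one]
  have hmeas : Measurable fun p : ℝ × (Fin (n + 1) → ℝ) =>
      blockDensity P v q (n + 1) (Fin.snoc p.2 p.1) * g p.2 :=
    ((measurable_blockDensity (fun j => (hq j).1) (n + 1)).comp
      (measurePreserving_finSnoc (n + 1)).1.measurable).mul (hgm.comp measurable_snd)
  have hint : Integrable fun p : ℝ × (Fin (n + 1) → ℝ) =>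
      blockDensity P v q (n + 1) (Fin.snoc p.2 p.1) * g p.2 := by
    rw [Measure.volume_eq_prod, integrable_prod_iff' hmeas.aestronglyMeasurable]
    refine ⟨ae_of_all _ fun z => (hin z).mul_const (g z), hg.norm.congr (ae_of_all _ fun z => ?_)⟩
    have hb : ∀ a : ℝ, ‖blockDensity P v q (n + 1) (Fin.snoc z a) * g z‖ =
        blockDensity P v q (n + 1) (Fin.snoc z a) * ‖g z‖ := by
      intro a
      rw [norm_mul, Real.norm_of_nonneg (blockDensity_pos hP hv hq0 hqI (n + 1) _).le]
    simp only [hb]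
    rw [integral_mul_const, hmarg, norm_mul,
      Real.norm_of_nonneg (blockDensity_pos hP hv hq0 hqI n z).le]
  have heq : ∀ p : ℝ × (Fin (n + 1) → ℝ), blockDensity P v q (n + 1) (Fin.snoc p.2 p.1) * g p.2 =
      (fun z : Fin (n + 2) → ℝ => blockDensity P v q (n + 1) z * g (Fin.init z))
        (Fin.snoc p.2 p.1) := by
    intro p; simp only [Fin.init_snoc]
  refine ⟨?_, ?_⟩
  · rw [← integrable_finSnoc]
    exact hint.congr (ae_of_all _ heq)
  · rw [← integral_finSnoc, ← integral_congr_ae (ae_of_all _ heq), Measure.volume_eq_prod,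
      integral_prod_symm _ (by rwa [Measure.volume_eq_prod] at hint)]
    congr 1
    ext z
    change ∫ a : ℝ, blockDensity P v q (n + 1) (Fin.snoc z a) * g z = _
    rw [integral_mul_const, hmarg]

/-- If the conditional entropies converge, their limit is the entropy rate. -/
theorem hasEntropyRate_of_tendsto (hPs : ∀ i, ∑ k, P i k = 1) (hP : ∀ i k, 0 < P i k)
    (hv : ∀ i, 0 < v i) (hv1 : ∑ i, v i = 1) (hq : ∀ j, IsProbDensity (q j))
    (hqI : ∀ z, 0 < q I z)
    (hint : ∀ n, Integrable fun z => entropyIntegrand (fun i k => (P i k : ℂ))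
      (fun j z => (q j z : ℂ)) (fun z => (Real.log (q I z) : ℂ)) I n z (fun i => (v i : ℂ)))
    {F : ℂ} (hlim : Tendsto (fun n => ∫ z, entropyIntegrand (fun i k => (P i k : ℂ))
      (fun j z => (q j z : ℂ)) (fun z => (Real.log (q I z) : ℂ)) I n z (fun i => (v i : ℂ)))
      atTop (𝓝 F)) : HasEntropyRate P v q (-F.re) := by
  have hq0 : ∀ j z, 0 ≤ q j z := fun j => (hq j).2.1
  have heq := entropyIntegrand_ofReal hP hv hq0 hqI
  set h : (n : ℕ) → (Fin (n + 1) → ℝ) → ℝ := fun n z => blockDensity P v q n z *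
    (Real.log (blockDensity P v q n z) - Real.log (∑ k, realOrbit P v q n (Fin.init z) k)) with hh
  simp only [heq] at hint hlim
  have hintr : ∀ n, Integrable (h n) := fun n => by
    have := (hint n).re
    simpa using this
  have hcast : ∀ n, ∫ z, ((h n z : ℝ) : ℂ) = ((∫ z, h n z : ℝ) : ℂ) := fun n => integral_ofReal
  have hlimr : Tendsto (fun n => ∫ z, h n z) atTop (𝓝 F.re) := by
    have h1 := (Complex.continuous_re.tendsto F).comp hlim
    refine h1.congr fun n => ?_
    simp only [Function.comp_apply]
    rw [hcast n, Complex.ofReal_re]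
  have key : ∀ n, Integrable (fun z => blockDensity P v q n z * Real.log (blockDensity P v q n z)) ∧
      ∫ z, blockDensity P v q n z * Real.log (blockDensity P v q n z) =
        ∑ k ∈ Finset.range (n + 1), ∫ z, h k z := by
    intro n
    induction n with
    | zero =>
      have h0 : h 0 = fun z => blockDensity P v q 0 z * Real.log (blockDensity P v q 0 z) := by
        ext z; simp only [hh, realOrbit_zero, hv1, Real.log_one, sub_zero]
      rw [← h0]
      exact ⟨hintr 0, by simp⟩
    | succ n ih =>
      have h1 := integral_blockDensity_mul_init hPs hP hv hq hqI n
        (g := fun z => Real.log (blockDensity P v q n z))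
        (Real.measurable_log.comp (measurable_blockDensity (fun j => (hq j).1) n)) ih.1
      -- The chain rule for entropy: the logarithm of the joint density splits into that of the past
      -- and that of the conditional density.
      have h2 : (fun z => blockDensity P v q (n + 1) z * Real.log (blockDensity P v q (n + 1) z)) =
          fun z => blockDensity P v q (n + 1) z * Real.log (blockDensity P v q n (Fin.init z)) +
            h (n + 1) z := by
        ext z
        simp only [hh, realOrbit_sum hPs]
        ring
      rw [h2]
      refine ⟨h1.1.add (hintr (n + 1)), ?_⟩
      rw [integral_add h1.1 (hintr (n + 1)), h1.2, ih.2, Finset.sum_range_succ _ (n + 1)]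
  refine ⟨fun n => (key n).1, ?_⟩
  -- A block with index `n` has `n + 1` outputs, hence the shift by one in the Cesàro means.
  have hces := (hlimr.cesaro.comp (tendsto_add_atTop_nat 1)).neg
  refine hces.congr fun n => ?_
  simp only [Function.comp_apply, blockEntropy, (key n).2]
  push_cast
  ring

end HiddenMarkov

/-! ### The limit near a real parameter -/

namespace HiddenMarkov

variable {l : ℕ}

section LocalLimit

variable {E : Type*} [NormedAddCommGroup E] [NormedSpace ℂ E] [FiniteDimensional ℂ E]

lemma exists_pos_le_of_forall_pos {α : Type*} [Finite α] {f : α → ℝ} (hf : ∀ a, 0 < f a) :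
    ∃ p : ℝ, 0 < p ∧ p ≤ 1 ∧ ∀ a, p ≤ f a := by
  have := Fintype.ofFinite α
  by_cases h : Nonempty α
  · obtain ⟨a, ha⟩ := Finite.exists_min f
    exact ⟨min 1 (f a), lt_min one_pos (hf a), min_le_left _ _,
      fun b => (min_le_right _ _).trans (ha b)⟩
  · exact ⟨1, one_pos, le_rfl, fun a => (h ⟨a⟩).elim⟩

/-- Near a real parameter at which the transition matrix and the densities are positive, the
conditional entropies converge to an analytic function of the complex parameter. -/
theorem exists_analyticAt_limit {U : Set E} (hU : IsOpen U) {e₀ : E} (he₀ : e₀ ∈ U)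
    {P : E → Fin l → Fin l → ℂ} {v : E → Fin l → ℂ} {Q : E → Fin l → ℝ → ℂ} {L : E → ℝ → ℂ}
    (hP : ∀ i k, DifferentiableOn ℂ (fun e => P e i k) U)
    (hv : ∀ i, DifferentiableOn ℂ (fun e => v e i) U)
    (hQ : ∀ j z, DifferentiableOn ℂ (fun e => Q e j z) U)
    (hL : ∀ z, DifferentiableOn ℂ (fun e => L e z) U)
    (hQm : ∀ e ∈ U, ∀ j, Measurable (Q e j)) (hLm : ∀ e ∈ U, Measurable (L e))
    (hvP : ∀ e ∈ U, ∀ k, ∑ i, v e i * P e i k = v e k) (hQ1 : ∀ e ∈ U, ∀ j, ∫ z, Q e j z = 1)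
    {D : ℝ → ℝ} (hD : Integrable D) (hQD : ∀ e ∈ U, ∀ j z, ‖Q e j z‖ ≤ D z)
    (hLD : ∀ e ∈ U, ∀ j z, ‖Q e j z * L e z‖ ≤ D z)
    {I : Fin l} (hQI : ∀ e ∈ U, ∀ z, Q e I z ≠ 0)
    {P₀ : Fin l → Fin l → ℝ} (hP₀ : ∀ i k, P e₀ i k = P₀ i k) (hP₀pos : ∀ i k, 0 < P₀ i k)
    (hP₀1 : ∀ i, ∑ k, P₀ i k = 1)
    {v₀ : Fin l → ℝ} (hv₀ : ∀ i, v e₀ i = v₀ i) (hv₀pos : ∀ i, 0 < v₀ i) (hv₀1 : ∑ i, v₀ i = 1)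
    {q₀ : Fin l → ℝ → ℝ} (hq₀ : ∀ j z, Q e₀ j z = q₀ j z) (hq₀pos : ∀ j z, 0 < q₀ j z)
    {M : ℝ} (hM : ∀ j z, q₀ j z / q₀ I z ≤ M)
    (hR : ∀ η > 0, ∀ᶠ e in 𝓝 e₀, ∀ j z, ‖Q e j z / Q e I z - (q₀ j z / q₀ I z : ℝ)‖ ≤ η) :
    ∃ F : E → ℂ, AnalyticAt ℂ F e₀ ∧ ∀ᶠ e in 𝓝 e₀,
      (∀ n, Integrable fun z => entropyIntegrand (P e) (Q e) (L e) I n z (v e)) ∧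
      Tendsto (fun n => ∫ z, entropyIntegrand (P e) (Q e) (L e) I n z (v e)) atTop (𝓝 (F e)) := by
  have hl : (0 : ℝ) < l := by exact_mod_cast (Nat.zero_le _).trans_lt I.2
  obtain ⟨p, hp, hp1, hpf⟩ := exists_pos_le_of_forall_pos
    (f := fun a : (Fin l × Fin l) ⊕ Fin l => Sum.elim (fun x => P₀ x.1 x.2) v₀ a)
    (by rintro (⟨i, k⟩ | i); exacts [hP₀pos i k, hv₀pos i])
  have hpP : ∀ i k, p ≤ P₀ i k := fun i k => hpf (Sum.inl (i, k))
  have hpv : ∀ i, p ≤ v₀ i := fun i => hpf (Sum.inr i)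
  have hP₀le : ∀ i k, P₀ i k ≤ 1 := fun i k => by
    rw [← hP₀1 i]
    exact Finset.single_le_sum (f := fun k => P₀ i k) (fun k _ => (hP₀pos i k).le)
      (Finset.mem_univ k)
  have hv₀le : ∀ i, v₀ i ≤ 1 := fun i => by
    rw [← hv₀1]
    exact Finset.single_le_sum (f := v₀) (fun k _ => (hv₀pos k).le) (Finset.mem_univ i)
  set R₀ : Fin l → ℝ → ℝ := fun j z => q₀ j z / q₀ I z with hR₀
  have hR₀nn : ∀ j z, 0 ≤ R₀ j z := fun j z => (div_pos (hq₀pos j z) (hq₀pos I z)).le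
  have hR₀I : ∀ z, R₀ I z = 1 := fun z => div_self (hq₀pos I z).ne'
  have hM1 : 1 ≤ M := by rw [← hR₀I 0]; exact hM I 0
  -- `δ` and `η` are the largest values that `Constants` permits.
  set δ : ℝ := p ^ 6 / 32 with hδ
  set η : ℝ := δ * p ^ 4 / (3 * l) with hη
  have hδpos : 0 < δ := by positivity
  have hp6 : p ^ 6 ≤ 1 := pow_le_one₀ hp.le hp1
  have hp4 : p ^ 4 ≤ 1 := pow_le_one₀ hp.le hp1
  have hηpos : 0 < η := by positivity
  have hl1 : (1 : ℝ) ≤ l := by exact_mod_cast (Nat.zero_le _).trans_lt I.2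
  have hη1 : η ≤ 1 := by
    rw [hη, div_le_one (by positivity)]
    have : δ * p ^ 4 ≤ 1 * 1 := mul_le_mul (by linarith) hp4 (by positivity) (by norm_num)
    linarith
  have hc : Constants p δ η M I R₀ :=
    { p_pos := hp, p_le := hp1, δ_pos := hδpos, δ_le := by rw [hδ]; linarith
      η_nonneg := hηpos.le, η_le := hη1
      ηδ := by rw [hη]; field_simp; exact le_rfl
      R_nonneg := hR₀nn, R_I := hR₀I, R_le := hM }
  -- Closeness of the ratios and of `P` separately: the products then differ by at most `2 * η₁ + M
  -- * η₁ = η`, as the ratios are at most `M` and the entries of `P e` at most 2 in norm.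
  set η₁ := η / (M + 2) with hη₁
  have hη₁pos : 0 < η₁ := by positivity
  have hη₁1 : η₁ ≤ η := div_le_self hηpos.le (by linarith)
  -- Admissible growth of the mass: with `x = p ^ 6`, `(1 + x / 8) ^ 2 * (1 - x / 4)` loses its
  -- linear term and stays below 1.
  set A : ℝ := 1 + p ^ 6 / 8 with hA
  have hA1 : 1 < A := by rw [hA]; have := pow_pos hp 6; linarith
  have hAA : A * A * (1 - p ^ 6 / 4) < 1 := by
    have h6 := pow_pos hp 6
    rw [hA, ← sub_pos]
    generalize p ^ 6 = x at h6
    have h : 1 - (1 + x / 8) * (1 + x / 8) * (1 - x / 4) = 3 / 64 * x ^ 2 + x ^ 3 / 256 := by ring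
    rw [h]
    positivity
  have hUn : U ∈ 𝓝 e₀ := hU.mem_nhds he₀
  have hPc : ∀ i k, ContinuousAt (fun e => P e i k) e₀ := fun i k =>
    ((hP i k).differentiableAt hUn).continuousAt
  have hvc : ∀ i, ContinuousAt (fun e => v e i) e₀ := fun i =>
    ((hv i).differentiableAt hUn).continuousAt
  have ev1 : ∀ᶠ e in 𝓝 e₀, ∀ i k, ‖P e i k - P₀ i k‖ ≤ η₁ := by
    simp only [eventually_all]
    intro i k
    have h := (hPc i k).tendsto
    simp only [hP₀] at h
    filter_upwards [(Metric.tendsto_nhds.1 h) η₁ hη₁pos] with e he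
    rw [dist_eq_norm] at he
    exact he.le
  have ev2 : ∀ᶠ e in 𝓝 e₀, ∀ i, ‖v e i - v₀ i‖ ≤ δ * v₀ i := by
    simp only [eventually_all]
    intro i
    have h := (hvc i).tendsto
    simp only [hv₀] at h
    filter_upwards [(Metric.tendsto_nhds.1 h) (δ * v₀ i) (mul_pos hδpos (hv₀pos i))] with e he
    rw [dist_eq_norm] at he
    exact he.le
  have ev3 : ∀ᶠ e in 𝓝 e₀, ∀ i, ∑ k, ‖P e i k‖ ≤ A := by
    simp only [eventually_all]
    intro i
    have h : Tendsto (fun e => ∑ k, ‖P e i k‖) (𝓝 e₀) (𝓝 1) := by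
      have h1 : Tendsto (fun e => ∑ k, ‖P e i k‖) (𝓝 e₀) (𝓝 (∑ k, ‖P e₀ i k‖)) :=
        tendsto_finsetSum _ fun k _ => (hPc i k).tendsto.norm
      have h2 : ∑ k, ‖P e₀ i k‖ = 1 := by
        rw [← hP₀1 i]
        refine Finset.sum_congr rfl fun k _ => ?_
        rw [hP₀, Complex.norm_real, Real.norm_of_nonneg (hP₀pos i k).le]
      rwa [h2] at h1
    exact h.eventually_le_const hA1
  -- At the real parameter this integral is 1, and it is continuous there by dominated convergence.
  have ev4 : ∀ᶠ e in 𝓝 e₀, ∀ j, ∫ z, ‖Q e j z‖ ≤ A := by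
    simp only [eventually_all]
    intro j
    have h1 : Tendsto (fun e => ∫ z, ‖Q e j z‖) (𝓝 e₀) (𝓝 (∫ z, ‖Q e₀ j z‖)) := by
      refine tendsto_integral_filter_of_dominated_convergence D ?_ ?_ hD ?_
      · filter_upwards [hUn] with e he using (hQm e he j).norm.aestronglyMeasurable
      · filter_upwards [hUn] with e he
        exact ae_of_all _ fun z => by rw [norm_norm]; exact hQD e he j z
      · exact ae_of_all _ fun z => ((hQ j z).differentiableAt hUn).continuousAt.tendsto.norm
    have h2 : ∫ z, ‖Q e₀ j z‖ = 1 := by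
      have h3 := hQ1 e₀ he₀ j
      simp only [hq₀] at h3 ⊢
      have h5 : ∫ z, ((q₀ j z : ℝ) : ℂ) = ((∫ z, q₀ j z : ℝ) : ℂ) := integral_ofReal
      rw [h5] at h3
      simp only [Complex.norm_real]
      have h4 : ∀ z, ‖q₀ j z‖ = q₀ j z := fun z => Real.norm_of_nonneg (hq₀pos j z).le
      simp only [h4]
      exact_mod_cast h3
    rw [h2] at h1
    exact h1.eventually_le_const hA1
  obtain ⟨V, hV, hVo, heV⟩ := _root_.eventually_nhds_iff.1
    (((((hU.eventually_mem he₀).and ev1).and ev2).and ev3).and (ev4.and (hR η₁ hη₁pos)))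
  have hVU : V ⊆ U := fun e he => (hV e he).1.1.1.1
  have hclose : ∀ e ∈ V, IsClose p η I P₀ R₀ (P e) (Q e) := by
    intro e he
    have hPe := (hV e he).1.1.1.2
    have hRe := (hV e he).2.2
    refine ⟨hQI e (hVU he), fun z => ⟨fun i k => mul_nonneg (hR₀nn i z) (hP₀pos i k).le, ?_, ?_, ?_⟩,
      fun j z => (hRe j z).trans hη₁1⟩
    · intro i j k
      have h1 : p * P₀ i j ≤ P₀ i k :=
        (mul_le_of_le_one_right hp.le (hP₀le i j)).trans (hpP i k)
      have := mul_le_mul_of_nonneg_left h1 (hR₀nn i z)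
      linarith
    · intro k; rw [hR₀I, one_mul]; exact hpP I k
    · intro i k
      have h1 : Q e i z / Q e I z * P e i k - ((R₀ i z * P₀ i k : ℝ) : ℂ) =
          (Q e i z / Q e I z - (R₀ i z : ℝ)) * P e i k + (R₀ i z : ℝ) * (P e i k - P₀ i k) := by
        push_cast; ring
      have h2 : ‖P e i k‖ ≤ 2 := by
        have h3 := norm_add_le (P e i k - P₀ i k) (P₀ i k)
        rw [sub_add_cancel, Complex.norm_real, Real.norm_of_nonneg (hP₀pos i k).le] at h3
        linarith [hPe i k, hP₀le i k]
      rw [h1]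
      refine (norm_add_le _ _).trans ?_
      rw [norm_mul, norm_mul, Complex.norm_real, Real.norm_of_nonneg (hR₀nn i z)]
      calc _ ≤ η₁ * 2 + M * η₁ := add_le_add
            (mul_le_mul (hRe i z) h2 (norm_nonneg _) hη₁pos.le)
            (mul_le_mul (hM i z) (hPe i k) (norm_nonneg _) (by linarith))
        _ = η := by
            have : M + 2 ≠ 0 := by linarith
            rw [hη₁]; field_simp; ring
  have hnear : ∀ e ∈ V, NearPositive p δ (v e) := by
    intro e he
    refine ⟨v₀, 1, one_ne_zero, hv₀pos, fun i k => ?_, fun i => ?_⟩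
    · exact (mul_le_of_le_one_right hp.le (hv₀le i)).trans (hpv k)
    · have := (hV e he).1.1.2 i
      simpa using this
  have hvb : ∀ e ∈ V, ∑ k, ‖v e k‖ ≤ 1 + δ := by
    intro e he
    have h1 : 1 + δ = ∑ k, (1 + δ) * v₀ k := by rw [← Finset.mul_sum, hv₀1, mul_one]
    rw [h1]
    refine Finset.sum_le_sum fun k _ => ?_
    have h3 := norm_add_le (v e k - v₀ k) (v₀ k)
    rw [sub_add_cancel, Complex.norm_real, Real.norm_of_nonneg (hv₀pos k).le] at h3
    linarith [(hV e he).1.1.2 k]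
  obtain ⟨hint, F, hF, hlim⟩ := exists_analyticOnNhd_limit hVo
    (fun i k => (hP i k).mono hVU) (fun i => (hv i).mono hVU) (fun j z => (hQ j z).mono hVU)
    (fun z => (hL z).mono hVU) (fun e he => hQm e (hVU he)) (fun e he => hLm e (hVU he))
    (fun e he => hvP e (hVU he)) (fun e he => hQ1 e (hVU he)) hD (fun e he => hQD e (hVU he))
    (fun e he => hLD e (hVU he)) hc hclose hnear hvb (by linarith) hAA
    (fun e he => (hV e he).2.1) (fun e he => (hV e he).1.2)
  exact ⟨F, hF e₀ heV, by
    filter_upwards [hVo.mem_nhds heV] with e he using ⟨hint e he, hlim e he⟩⟩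

end LocalLimit

/-! ### The stationary vector as an analytic function of the matrix -/

section Stationary

/-- Normalization of the rows. -/
noncomputable def rowNormalize (A : Fin l → Fin l → ℂ) (i k : Fin l) : ℂ := A i k / ∑ j, A i j

/-- The matrix `1 - P + J`, with `J` the matrix with all entries one. -/
def stationaryMatrix (P : Fin l → Fin l → ℂ) : Matrix (Fin l) (Fin l) ℂ :=
  Matrix.of fun i k => (if i = k then 1 else 0) - P i k + 1

lemma vecMul_stationaryMatrix (P : Fin l → Fin l → ℂ) (u : Fin l → ℂ) (k : Fin l) :
    Matrix.vecMul u (stationaryMatrix P) k = u k - ∑ i, u i * P i k + ∑ i, u i := by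
  simp only [Matrix.vecMul, dotProduct, stationaryMatrix, Matrix.of_apply]
  simp_rw [mul_add, mul_sub]
  rw [Finset.sum_add_distrib, Finset.sum_sub_distrib]
  simp

/-- The stationary vector of a complex matrix. -/
noncomputable def stationaryVector (P : Fin l → Fin l → ℂ) : Fin l → ℂ :=
  Matrix.vecMul 1 ((stationaryMatrix P).det⁻¹ • (stationaryMatrix P).adjugate)

lemma stationaryVector_vecMul {P : Fin l → Fin l → ℂ} (h : (stationaryMatrix P).det ≠ 0) :
    Matrix.vecMul (stationaryVector P) (stationaryMatrix P) = 1 := by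
  rw [stationaryVector, Matrix.vecMul_vecMul, Matrix.smul_mul, Matrix.adjugate_mul, smul_smul,
    inv_mul_cancel₀ h, one_smul, Matrix.vecMul_one]

lemma eq_stationaryVector {P : Fin l → Fin l → ℂ} (h : (stationaryMatrix P).det ≠ 0)
    {w : Fin l → ℂ} (hw : Matrix.vecMul w (stationaryMatrix P) = 1) : w = stationaryVector P := by
  rw [stationaryVector, ← hw, Matrix.vecMul_vecMul, Matrix.mul_smul, Matrix.mul_adjugate, smul_smul,
    inv_mul_cancel₀ h, one_smul, Matrix.vecMul_one]

/-- The sum of the entries of a solution of `u (1 - P + J) = c`. -/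
lemma sum_of_vecMul_stationaryMatrix (hl : l ≠ 0) {P : Fin l → Fin l → ℂ}
    (hP : ∀ i, ∑ k, P i k = 1) {u : Fin l → ℂ} {c : ℂ}
    (hu : ∀ k, Matrix.vecMul u (stationaryMatrix P) k = c) :
    ∑ i, u i = c ∧ ∀ k, u k - ∑ i, u i * P i k = 0 := by
  simp only [vecMul_stationaryMatrix] at hu
  -- Summing over `k`, the part with `1 - P` vanishes because the rows sum to one; only `l` times
  -- the sum of `u` is left.
  have h1 : ∑ k, (u k - ∑ i, u i * P i k + ∑ i, u i) = ∑ _k : Fin l, c :=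
    Finset.sum_congr rfl fun k _ => hu k
  rw [Finset.sum_add_distrib, Finset.sum_sub_distrib, Finset.sum_comm (f := fun k i => u i * P i k)]
    at h1
  simp_rw [← Finset.mul_sum, hP, mul_one, sub_self, zero_add, Finset.sum_const,
    Finset.card_univ, Fintype.card_fin, nsmul_eq_mul] at h1
  have h2 := mul_left_cancel₀ (Nat.cast_ne_zero.2 hl) h1
  refine ⟨h2, fun k => ?_⟩
  have := hu k
  rw [h2] at this
  linear_combination this

lemma stationaryVector_mul (hl : l ≠ 0) {P : Fin l → Fin l → ℂ} (hP : ∀ i, ∑ k, P i k = 1)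
    (h : (stationaryMatrix P).det ≠ 0) (k : Fin l) :
    ∑ i, stationaryVector P i * P i k = stationaryVector P k := by
  have h1 := (sum_of_vecMul_stationaryMatrix hl hP (u := stationaryVector P) (c := 1)
    (fun k => by rw [stationaryVector_vecMul h]; rfl)).2 k
  linear_combination -h1

/-- A positive stochastic matrix has a one-dimensional space of invariant vectors. -/
lemma det_stationaryMatrix_ne_zero (hl : l ≠ 0) {P : Fin l → Fin l → ℝ}
    (hP : ∀ i, ∑ k, P i k = 1) (hpos : ∀ i k, 0 < P i k) :
    (stationaryMatrix fun i k => (P i k : ℂ)).det ≠ 0 := by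
  intro hdet
  obtain ⟨u, hu0, hu⟩ := Matrix.exists_vecMul_eq_zero_iff.2 hdet
  obtain ⟨hsum, hinv⟩ := sum_of_vecMul_stationaryMatrix hl
    (P := fun i k => (P i k : ℂ)) (fun i => by exact_mod_cast hP i) (u := u) (c := 0)
    (fun k => by rw [hu]; rfl)
  obtain ⟨p, hp, -, hpP⟩ := exists_pos_le_of_forall_pos
    (f := fun a : Fin l × Fin l => P a.1 a.2) (fun a => hpos a.1 a.2)
  -- The entries of `u` sum to zero, so `P` may be replaced by `P - p`, which is still nonnegative
  -- but has row sums `1 - l * p`. Invariance under it forces `u = 0`.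
  have hle : ∀ k, ‖u k‖ ≤ ∑ i, ‖u i‖ * (P i k - p) := by
    intro k
    have h1 : u k = ∑ i, u i * ((P i k - p : ℝ) : ℂ) := by
      push_cast
      simp_rw [mul_sub]
      rw [Finset.sum_sub_distrib, ← Finset.sum_mul, hsum, zero_mul, sub_zero]
      linear_combination hinv k
    conv_lhs => rw [h1]
    refine norm_sum_le_of_le _ fun i _ => ?_
    rw [norm_mul, Complex.norm_real, Real.norm_of_nonneg (sub_nonneg.2 (hpP (i, k)))]
  have h2 := Finset.sum_le_sum (s := Finset.univ) fun k _ => hle k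
  rw [Finset.sum_comm] at h2
  simp_rw [← Finset.mul_sum, Finset.sum_sub_distrib, hP, Finset.sum_const, Finset.card_univ,
    Fintype.card_fin, nsmul_eq_mul, ← Finset.sum_mul] at h2
  have hl0 : (0 : ℝ) < l := by exact_mod_cast Nat.pos_of_ne_zero hl
  have h3 : (∑ k, ‖u k‖) * (l * p) ≤ 0 := by linarith
  have h4 : ∑ k, ‖u k‖ ≤ 0 := by
    by_contra! h
    exact absurd h3 (not_le.2 (mul_pos h (mul_pos hl0 hp)))
  refine hu0 (funext fun k => ?_)
  have h5 := (Finset.single_le_sum (f := fun k => ‖u k‖) (fun k _ => norm_nonneg _)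
    (Finset.mem_univ k)).trans h4
  exact norm_le_zero_iff.1 h5

variable {E : Type*} [NormedAddCommGroup E] [NormedSpace ℂ E]

lemma differentiableOn_prod {U : Set E} {β : Type*} (s : Finset β) {f : E → β → ℂ}
    (hf : ∀ b, DifferentiableOn ℂ (fun e => f e b) U) :
    DifferentiableOn ℂ (fun e => ∏ b ∈ s, f e b) U := by
  classical
  induction s using Finset.induction_on with
  | empty => simp only [Finset.prod_empty]; exact differentiableOn_const _
  | insert a s ha ih => simp only [Finset.prod_insert ha]; exact (hf a).mul ih

lemma differentiableOn_det {U : Set E} {m : E → Matrix (Fin l) (Fin l) ℂ}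
    (hm : ∀ i k, DifferentiableOn ℂ (fun e => m e i k) U) :
    DifferentiableOn ℂ (fun e => (m e).det) U := by
  simp only [Matrix.det_apply]
  refine DifferentiableOn.fun_sum fun σ _ => DifferentiableOn.fun_const_smul ?_ _
  exact differentiableOn_prod _ fun i => hm _ _

lemma differentiableOn_stationaryMatrix {U : Set E} {P : E → Fin l → Fin l → ℂ}
    (hP : ∀ i k, DifferentiableOn ℂ (fun e => P e i k) U) (i k : Fin l) :
    DifferentiableOn ℂ (fun e => stationaryMatrix (P e) i k) U := by
  simp only [stationaryMatrix, Matrix.of_apply]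
  exact ((differentiableOn_const _).sub (hP i k)).add_const _

lemma differentiableOn_stationaryVector {U : Set E} {P : E → Fin l → Fin l → ℂ}
    (hP : ∀ i k, DifferentiableOn ℂ (fun e => P e i k) U)
    (h : ∀ e ∈ U, (stationaryMatrix (P e)).det ≠ 0) (k : Fin l) :
    DifferentiableOn ℂ (fun e => stationaryVector (P e) k) U := by
  have hM := differentiableOn_stationaryMatrix hP
  simp only [stationaryVector, Matrix.vecMul, dotProduct, Matrix.smul_apply, smul_eq_mul]
  refine DifferentiableOn.fun_sum fun i _ => (differentiableOn_const _).mul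
    (((differentiableOn_det hM).fun_inv h).mul ?_)
  simp only [Matrix.adjugate_apply]
  refine differentiableOn_det fun a b => ?_
  by_cases hab : a = k
  · subst hab
    simp only [Matrix.updateRow_self]
    exact differentiableOn_const _
  · simp only [Matrix.updateRow_ne hab]
    exact hM a b

/-- Around a positive stochastic matrix, the transition matrix and the stationary vector extend
to complex analytic functions of the entries of the matrix. -/
theorem exists_complex_stationary (hl : l ≠ 0) {P₀ : Fin l → Fin l → ℝ}
    (hP : ∀ i, ∑ k, P₀ i k = 1) (hpos : ∀ i k, 0 < P₀ i k) :
    ∃ W : Set (Fin l → Fin l → ℂ), IsOpen W ∧ (fun i k => (P₀ i k : ℂ)) ∈ W ∧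
      (∀ i k, DifferentiableOn ℂ (fun A => rowNormalize A i k) W) ∧
      (∀ k, DifferentiableOn ℂ (fun A => stationaryVector (rowNormalize A) k) W) ∧
      (∀ A ∈ W, ∀ k, ∑ i, stationaryVector (rowNormalize A) i * rowNormalize A i k =
        stationaryVector (rowNormalize A) k) ∧
      ∀ P : Fin l → Fin l → ℝ, IsStochastic P → (fun i k => (P i k : ℂ)) ∈ W →
        (rowNormalize fun i k => (P i k : ℂ)) = (fun i k => (P i k : ℂ)) ∧
        ∀ w : Fin l → ℝ, IsStationary P w →
          (stationaryVector fun i k => (P i k : ℂ)) = fun i => (w i : ℂ) := by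
  have hreal : ∀ P : Fin l → Fin l → ℝ, (∀ i, ∑ k, P i k = 1) →
      (rowNormalize fun i k => (P i k : ℂ)) = (fun i k => (P i k : ℂ)) := by
    intro P hP
    ext i k
    have : ∑ j, (P i j : ℂ) = 1 := by exact_mod_cast hP i
    rw [rowNormalize, this, div_one]
  -- Matrices whose rows can be normalized. Row sums equal to one are what makes the solution of `u
  -- (1 - P + J) = 1` invariant, and normalization secures them on an open set of complex matrices
  -- while fixing the stochastic ones.
  set S : Set (Fin l → Fin l → ℂ) := {A | ∀ i, ∑ j, A i j ≠ 0} with hS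
  have hSo : IsOpen S := by
    simp only [hS, Set.ofPred_forall]
    exact isOpen_iInter_of_finite fun i => isOpen_ne_fun (by fun_prop) continuous_const
  have hrow : ∀ i k, DifferentiableOn ℂ (fun A : Fin l → Fin l → ℂ => rowNormalize A i k) S := by
    intro i k
    exact differentiableOn_div (by fun_prop) (by fun_prop) fun A hA => hA i
  have hdet : ContinuousOn (fun A : Fin l → Fin l → ℂ =>
      (stationaryMatrix (rowNormalize A)).det) S :=
    (differentiableOn_det (differentiableOn_stationaryMatrix hrow)).continuousOn
  refine ⟨S ∩ (fun A => (stationaryMatrix (rowNormalize A)).det) ⁻¹' {0}ᶜ,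
    hdet.isOpen_inter_preimage hSo isOpen_compl_singleton, ⟨fun i => ?_, ?_⟩,
    fun i k => (hrow i k).mono Set.inter_subset_left,
    differentiableOn_stationaryVector (fun i k => (hrow i k).mono Set.inter_subset_left)
      fun A hA => hA.2, fun A hA => stationaryVector_mul hl (fun i => ?_) hA.2, ?_⟩
  · have : ∑ j, (P₀ i j : ℂ) = 1 := by exact_mod_cast hP i
    simp only [this]; exact one_ne_zero
  · simp only [Set.mem_preimage, Set.mem_compl_iff, Set.mem_singleton_iff]
    rw [hreal P₀ hP]
    exact det_stationaryMatrix_ne_zero hl hP hpos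
  · simp only [rowNormalize]
    rw [← Finset.sum_div, div_self (hA.1 i)]
  · intro P hPs hPW
    have h1 := hreal P hPs.2
    refine ⟨h1, fun w hw => ?_⟩
    have h2 := hPW.2
    simp only [Set.mem_preimage, Set.mem_compl_iff, Set.mem_singleton_iff] at h2
    rw [h1] at h2
    refine (eq_stationaryVector h2 ?_).symm
    ext k
    rw [vecMul_stationaryMatrix]
    have h3 : ∑ i, (w i : ℂ) * (P i k : ℂ) = w k := by exact_mod_cast hw.2.2 k
    have h4 : ∑ i, (w i : ℂ) = 1 := by exact_mod_cast hw.2.1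
    rw [h3, h4]; simp

lemma IsStationary.pos {P : Fin l → Fin l → ℝ} {w : Fin l → ℝ} (hw : IsStationary P w)
    (hP : ∀ i k, 0 < P i k) (k : Fin l) : 0 < w k := by
  have h1 : ∃ i, 0 < w i := by
    by_contra! h
    have := Finset.sum_nonpos (s := Finset.univ) fun i _ => h i
    rw [hw.2.1] at this
    linarith
  obtain ⟨i, hi⟩ := h1
  rw [← hw.2.2 k]
  exact Finset.sum_pos' (fun j _ => mul_nonneg (hw.1 j) (hP j k).le)
    ⟨i, Finset.mem_univ i, mul_pos hi (hP i k)⟩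

end Stationary

end HiddenMarkov

namespace HiddenMarkov

variable {l : ℕ}

/-! ### Complexified channels -/

/-- A family of functions depending continuously on a parameter in a compact set, and bounded by
a function with finite upper integral, has an integrable majorant. -/
lemma exists_integrable_bound {X : Type*} [PseudoMetricSpace X] {K : Set X} (hK : IsCompact K)
    {f : X → ℝ → ℂ} (hc : ∀ z, ContinuousOn (fun x => f x z) K) (hm : ∀ x ∈ K, Measurable (f x))
    {g : ℝ → ℝ≥0∞} (hg : ∫⁻ z, g z < ∞) (hfg : ∀ x ∈ K, ∀ z, ‖f x z‖ₑ ≤ g z) :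
    ∃ D : ℝ → ℝ, Integrable D ∧ (∀ z, 0 ≤ D z) ∧ ∀ x ∈ K, ∀ z, ‖f x z‖ ≤ D z := by
  rcases K.eq_empty_or_nonempty with rfl | hne
  · exact ⟨0, integrable_zero _ _ _, fun _ => le_rfl, by simp⟩
  have : CompactSpace K := isCompact_iff_compactSpace.1 hK
  have : Nonempty K := hne.to_subtype
  -- The supremum over a countable dense set is measurable and, by continuity in the parameter,
  -- bounds all of `K`.
  set u := TopologicalSpace.denseSeq K
  have hu : DenseRange u := TopologicalSpace.denseRange_denseSeq K
  set S : ℝ → ℝ≥0∞ := fun z => ⨆ n, ‖f (u n) z‖ₑ with hS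
  have hSm : Measurable S := Measurable.iSup fun n => (hm _ (u n).2).enorm
  have hle : ∀ x ∈ K, ∀ z, ‖f x z‖ₑ ≤ S z := by
    intro x hx z
    have hcl : IsClosed {y : K | ‖f y z‖ₑ ≤ S z} :=
      isClosed_le (continuousOn_iff_continuous_domRestrict.1 (hc z)).enorm continuous_const
    have hsub : Set.range u ⊆ {y : K | ‖f y z‖ₑ ≤ S z} := by
      rintro _ ⟨n, rfl⟩
      exact le_iSup (fun n => ‖f (u n) z‖ₑ) n
    have := (hcl.closure_subset_iff.2 hsub) (hu ⟨x, hx⟩)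
    exact this
  have hfin : ∀ z, S z ≠ ∞ := by
    intro z
    obtain ⟨C, hC⟩ := hK.exists_bound_of_continuousOn (hc z)
    refine ne_top_of_le_ne_top (ENNReal.ofReal_ne_top (r := C)) (iSup_le fun n => ?_)
    rw [← ofReal_norm]
    exact ENNReal.ofReal_le_ofReal (hC _ (u n).2)
  have hSg : ∀ z, S z ≤ g z := fun z => iSup_le fun n => hfg _ (u n).2 z
  refine ⟨fun z => (S z).toReal, integrable_toReal_of_lintegral_ne_top hSm.aemeasurable
    ((lintegral_mono hSg).trans_lt hg).ne, fun z => ENNReal.toReal_nonneg, fun x hx z => ?_⟩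
  rw [← toReal_enorm]
  exact ENNReal.toReal_mono (hfin z) (hle x hx z)

/-- A continuous family of logarithms of measurable functions that starts with a measurable
function ends with a measurable function. -/
lemma measurable_of_measurable_exp {f : ℝ → ℝ → ℂ}
    (hc : ∀ z, ContinuousOn (fun t => f t z) (Set.Icc 0 1)) (h0 : Measurable (f 0))
    (hm : ∀ t ∈ Set.Icc (0 : ℝ) 1, Measurable fun z => Complex.exp (f t z)) : Measurable (f 1) := by
  have hmem : ∀ N k : ℕ, k ≤ N + 1 → (k : ℝ) / ((N : ℝ) + 1) ∈ Set.Icc (0 : ℝ) 1 := by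
    intro N k hk
    have hN : (0 : ℝ) < (N : ℝ) + 1 := by positivity
    refine ⟨by positivity, (div_le_one hN).2 ?_⟩
    exact_mod_cast hk
  -- The branch of the logarithm is followed along the path in `N + 1` steps by principal logarithms
  -- of successive quotients. For each `z` the sum telescopes to `f 1 z` as soon as every step is
  -- shorter than `π`; the threshold depends on `z`, so `f 1` is obtained as a pointwise limit.
  set G : ℕ → ℝ → ℂ := fun N z => f 0 z + ∑ k ∈ Finset.range (N + 1),
    Complex.log (Complex.exp (f (((k + 1 : ℕ) : ℝ) / ((N : ℝ) + 1)) z) /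
      Complex.exp (f ((k : ℝ) / ((N : ℝ) + 1)) z)) with hG
  have hGm : ∀ N, Measurable (G N) := by
    intro N
    refine h0.add (Finset.measurable_fun_sum _ fun k hk => Complex.measurable_log.comp ?_)
    have hk' := Finset.mem_range.1 hk
    exact (hm _ (hmem N (k + 1) hk')).div (hm _ (hmem N k hk'.le))
  refine measurable_of_tendsto_metrizable hGm (tendsto_pi_nhds.2 fun z => ?_)
  have huc := isCompact_Icc.uniformContinuousOn_of_continuous (hc z)
  obtain ⟨δ, hδ, huc⟩ := Metric.uniformContinuousOn_iff.1 huc Real.pi Real.pi_pos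
  obtain ⟨N₀, hN₀⟩ := exists_nat_one_div_lt hδ
  refine tendsto_const_nhds.congr' ?_
  filter_upwards [eventually_ge_atTop N₀] with N hN
  have hN1 : (0 : ℝ) < (N : ℝ) + 1 := by positivity
  have hstep : 1 / ((N : ℝ) + 1) < δ :=
    (one_div_le_one_div_of_le (by positivity) (by gcongr)).trans_lt hN₀
  have hterm : ∀ k ∈ Finset.range (N + 1),
      Complex.log (Complex.exp (f (((k + 1 : ℕ) : ℝ) / ((N : ℝ) + 1)) z) /
        Complex.exp (f ((k : ℝ) / ((N : ℝ) + 1)) z)) =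
      f (((k + 1 : ℕ) : ℝ) / ((N : ℝ) + 1)) z - f ((k : ℝ) / ((N : ℝ) + 1)) z := by
    intro k hk
    have hk' := Finset.mem_range.1 hk
    have hd := huc _ (hmem N (k + 1) hk') _ (hmem N k hk'.le) (by
      rw [Real.dist_eq, ← sub_div]
      push_cast
      rw [add_sub_cancel_left, abs_of_pos (by positivity)]
      exact hstep)
    rw [dist_eq_norm] at hd
    have him := (Complex.abs_im_le_norm _).trans_lt hd
    rw [abs_lt] at him
    rw [← Complex.exp_sub, Complex.log_exp him.1 him.2.le]
  simp only [hG]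
  rw [Finset.sum_congr rfl hterm,
    Finset.sum_range_sub (fun k : ℕ => f ((k : ℝ) / ((N : ℝ) + 1)) z)]
  have : (((N + 1 : ℕ) : ℝ)) / ((N : ℝ) + 1) = 1 := by
    push_cast; exact div_self hN1.ne'
  rw [this]
  simp

variable {ι : Type} [Fintype ι]

lemma IsComplexExtension.mono {g : EuclideanSpace ℝ ι → ℝ} {G : EuclideanSpace ℂ ι → ℂ}
    {θ₀ : EuclideanSpace ℝ ι} {r s : ℝ} (h : IsComplexExtension g G θ₀ r) (hs : s ≤ r) :
    IsComplexExtension g G θ₀ s :=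
  ⟨h.1.mono (ball_subset_ball hs), fun θ hθ => h.2 θ (ball_subset_ball hs hθ)⟩

/-- The exponential of the extension of the logarithm is the extension of the function. -/
lemma IsComplexExtension.exp_eq {g : EuclideanSpace ℝ ι → ℝ} {G L : EuclideanSpace ℂ ι → ℂ}
    {θ₀ : EuclideanSpace ℝ ι} {r : ℝ} (hr : 0 < r) (hG : IsComplexExtension g G θ₀ r)
    (hL : IsComplexExtension (fun θ => Real.log (g θ)) L θ₀ r) (h0 : 0 < g θ₀) :
    ∀ w ∈ ball (toComplex θ₀) r, Complex.exp (L w) = G w := by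
  have hmem : toComplex θ₀ ∈ ball (toComplex θ₀) r := mem_ball_self hr
  have hcont : ContinuousAt (fun w => (G w).re) (toComplex θ₀) :=
    Complex.continuous_re.continuousAt.comp (hG.1 _ hmem).continuousAt
  have hre : 0 < (G (toComplex θ₀)).re := by rw [hG.2 θ₀ hmem]; exact h0
  obtain ⟨s, hs, hsub⟩ := Metric.eventually_nhds_iff_ball.1 (hcont.eventually_const_lt hre)
  have hE : AnalyticOnNhd ℂ (fun w => Complex.exp (L w) - G w) (ball (toComplex θ₀) r) :=
    fun w hw => ((hL.1 w hw).cexp).sub (hG.1 w hw)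
  have hsr : ball (toComplex θ₀) (min s r) ⊆ ball (toComplex θ₀) r :=
    ball_subset_ball (min_le_right _ _)
  -- Positivity of `g`, needed for `exp (log g) = g`, is known only near `θ₀`. The identity is first
  -- proved on a small ball and then continued to the whole ball.
  have h1 : ∀ w ∈ ball (toComplex θ₀) (min s r), Complex.exp (L w) - G w = 0 := by
    refine eq_zero_of_forall_toComplex (hE.mono hsr).differentiableOn fun θ hθ => ?_
    have h2 := hsub _ (ball_subset_ball (min_le_left _ _) hθ)
    rw [hG.2 θ (hsr hθ), Complex.ofReal_re] at h2
    rw [hG.2 θ (hsr hθ), hL.2 θ (hsr hθ), ← Complex.ofReal_exp, Real.exp_log h2, sub_self]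
  have h3 := hE.eqOn_zero_of_preconnected_of_eventuallyEq_zero
    (convex_ball _ _).isPreconnected hmem (by
      filter_upwards [ball_mem_nhds (toComplex θ₀) (lt_min hs hr)] with w hw using h1 w hw)
  exact fun w hw => sub_eq_zero.1 (h3 hw)

/-- The analytic extension of the logarithm of a measurable function is measurable. -/
lemma measurable_log_extension {g : EuclideanSpace ℝ ι → ℝ → ℝ} {G L : EuclideanSpace ℂ ι → ℝ → ℂ}
    {θ₀ : EuclideanSpace ℝ ι} {r : ℝ} (hr : 0 < r)
    (hG : ∀ z, IsComplexExtension (fun θ => g θ z) (fun w => G w z) θ₀ r)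
    (hL : ∀ z, IsComplexExtension (fun θ => Real.log (g θ z)) (fun w => L w z) θ₀ r)
    (h0 : ∀ z, 0 < g θ₀ z) (hg : Measurable (g θ₀))
    (hGm : ∀ w ∈ ball (toComplex θ₀) r, Measurable (G w)) {w : EuclideanSpace ℂ ι}
    (hw : w ∈ ball (toComplex θ₀) r) : Measurable (L w) := by
  have hmem : toComplex θ₀ ∈ ball (toComplex θ₀) r := mem_ball_self hr
  have hseg : ∀ t ∈ Set.Icc (0 : ℝ) 1,
      AffineMap.lineMap (toComplex θ₀) w t ∈ ball (toComplex θ₀) r := fun t ht =>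
    (convex_ball _ _).segment_subset hmem hw (by
      rw [segment_eq_image_lineMap]; exact Set.mem_image_of_mem _ ht)
  have h := measurable_of_measurable_exp
    (f := fun t z => L (AffineMap.lineMap (toComplex θ₀) w t) z) (fun z => ?_) ?_ fun t ht => ?_
  · simpa using h
  · exact (hL z).1.continuousOn.comp (AffineMap.lineMap_continuous).continuousOn
      fun t ht => hseg t ht
  · simp only [AffineMap.lineMap_apply_zero]
    have : L (toComplex θ₀) = fun z => ((Real.log (g θ₀ z) : ℝ) : ℂ) :=
      funext fun z => (hL z).2 θ₀ hmem
    rw [this]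
    exact Complex.measurable_ofReal.comp (Real.measurable_log.comp hg)
  · have : (fun z => Complex.exp (L (AffineMap.lineMap (toComplex θ₀) w t) z)) =
        G (AffineMap.lineMap (toComplex θ₀) w t) :=
      funext fun z => IsComplexExtension.exp_eq hr (hG z) (hL z) (h0 z) _ (hseg t ht)
    rw [this]
    exact hGm _ (hseg t ht)

/-- The regularity conditions provide everything that the local analysis of the conditional
entropies requires, on a common complex ball. -/
theorem exists_regular_extension {Ω₂ : Set (EuclideanSpace ℝ ι)} (hΩ₂ : IsOpen Ω₂)
    {q : EuclideanSpace ℝ ι → Fin l → ℝ → ℝ} (hq : ∀ θ ∈ Ω₂, ∀ y, IsProbDensity (q θ y))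
    {θ₀ : EuclideanSpace ℝ ι} (hθ₀ : θ₀ ∈ Ω₂) (hpos : ∀ y z, 0 < q θ₀ y z)
    {Q : EuclideanSpace ℂ ι → Fin l → ℝ → ℂ} (hC : ConditionC q Q θ₀) {I : Fin l}
    (hD : ConditionD q Q θ₀ I) (hdom : ColumnDominates Q θ₀ I) :
    ∃ ρ > 0, ∃ (L : EuclideanSpace ℂ ι → ℝ → ℂ) (D : ℝ → ℝ) (M : ℝ),
      (∀ θ, toComplex θ ∈ ball (toComplex θ₀) ρ → θ ∈ Ω₂ ∧ (∀ z, 0 < q θ I z) ∧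
        (∀ j z, Q (toComplex θ) j z = (q θ j z : ℂ)) ∧
        ∀ z, L (toComplex θ) z = (Real.log (q θ I z) : ℂ)) ∧
      (∀ j z, DifferentiableOn ℂ (fun w => Q w j z) (ball (toComplex θ₀) ρ)) ∧
      (∀ z, DifferentiableOn ℂ (fun w => L w z) (ball (toComplex θ₀) ρ)) ∧
      (∀ w ∈ ball (toComplex θ₀) ρ, Measurable (L w) ∧ ∀ j, Measurable (Q w j) ∧
        ∫ z, Q w j z = 1 ∧ ∀ z, Q w I z ≠ 0 ∧ ‖Q w j z‖ ≤ D z ∧ ‖Q w j z * L w z‖ ≤ D z) ∧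
      Integrable D ∧ (∀ j z, q θ₀ j z / q θ₀ I z ≤ M) ∧
      ∀ η > 0, ∀ᶠ w in 𝓝 (toComplex θ₀), ∀ j z,
        ‖Q w j z / Q w I z - (q θ₀ j z / q θ₀ I z : ℝ)‖ ≤ η := by
  obtain ⟨r₁, hr₁, hext, hcont, hsup, -, -⟩ := hC
  obtain ⟨⟨r₂, hr₂, hequi⟩, r₃, hr₃, L, hLext, hLint⟩ := hD
  obtain ⟨r₄, hr₄, hdom⟩ := hdom
  obtain ⟨r₅, hr₅, hball⟩ := Metric.isOpen_iff.1 hΩ₂ θ₀ hθ₀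
  set r := min r₁ (min r₃ r₅) with hrdef
  have hr : 0 < r := lt_min hr₁ (lt_min hr₃ hr₅)
  have hrr₁ : r ≤ r₁ := min_le_left _ _
  have hrr₃ : r ≤ r₃ := (min_le_right _ _).trans (min_le_left _ _)
  have hrr₅ : r ≤ r₅ := (min_le_right _ _).trans (min_le_right _ _)
  set c := toComplex θ₀
  have hc : c ∈ ball c r := mem_ball_self hr
  have hQe : ∀ y z, IsComplexExtension (fun θ => q θ y z) (fun w => Q w y z) θ₀ r := fun y z =>
    (hext y z).mono hrr₁
  have hLe : ∀ z, IsComplexExtension (fun θ => Real.log (q θ I z)) (fun w => L w z) θ₀ r :=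
    fun z => (hLext z).mono hrr₃
  have hexp : ∀ w ∈ ball c r, ∀ z, Complex.exp (L w z) = Q w I z := fun w hw z =>
    IsComplexExtension.exp_eq hr (hQe I z) (hLe z) (hpos I z) w hw
  have hQcont : ∀ w ∈ ball c r, ∀ j, Continuous (Q w j) := by
    intro w hw j
    have h := (hcont j).comp (f := fun z : ℝ => (z, w)) (s := Set.univ) (by fun_prop)
      fun z _ => ⟨Set.mem_univ _, ball_subset_ball hrr₁ hw⟩
    exact continuousOn_univ.1 h
  have hLm : ∀ w ∈ ball c r, Measurable (L w) := fun w hw =>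
    measurable_log_extension (g := fun θ z => q θ I z) (G := fun w z => Q w I z) hr (hQe I) hLe
      (hpos I) (hq θ₀ hθ₀ I).1 (fun w hw => (hQcont w hw I).measurable) hw
  -- Positivity of column `I` at nearby real parameters comes from `hexp`: the density there is the
  -- exponential of a real number.
  have hreal : ∀ θ, toComplex θ ∈ ball c r → θ ∈ Ω₂ ∧ (∀ z, 0 < q θ I z) ∧
      (∀ j z, Q (toComplex θ) j z = (q θ j z : ℂ)) ∧
      ∀ z, L (toComplex θ) z = (Real.log (q θ I z) : ℂ) := by
    intro θ hθ
    refine ⟨hball (ball_subset_ball hrr₅ (toComplex_mem_ball.1 hθ)), fun z => ?_,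
      fun j z => (hQe j z).2 θ hθ, fun z => (hLe z).2 θ hθ⟩
    have h1 := hexp _ hθ z
    have h2 : Q (toComplex θ) I z = (q θ I z : ℂ) := (hQe I z).2 θ hθ
    have h3 : L (toComplex θ) z = (Real.log (q θ I z) : ℂ) := (hLe z).2 θ hθ
    rw [h2, h3, ← Complex.ofReal_exp] at h1
    rw [← Complex.ofReal_inj.1 h1]
    exact Real.exp_pos _
  -- Halving the radius gives the compact parameter set that `exists_integrable_bound` requires.
  have hK : IsCompact (closedBall c (r / 2)) := isCompact_closedBall _ _
  have hKr : closedBall c (r / 2) ⊆ ball c r := closedBall_subset_ball (by linarith)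
  have hbr : ball c (r / 2) ⊆ ball c r := ball_subset_ball (by linarith)
  have hD1 : ∀ j, ∃ D : ℝ → ℝ, Integrable D ∧ (∀ z, 0 ≤ D z) ∧
      ∀ w ∈ closedBall c (r / 2), ∀ z, ‖Q w j z‖ ≤ D z := fun j =>
    exists_integrable_bound hK (f := fun w z => Q w j z)
      (fun z => (hQe j z).1.continuousOn.mono hKr) (fun w hw => (hQcont w (hKr hw) j).measurable)
      hsup fun w hw z => (le_iSup₂ (f := fun w _ => ‖Q w j z‖ₑ) w
        (ball_subset_ball hrr₁ (hKr hw))).trans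
          (le_iSup (fun y => ⨆ θ ∈ ball c r₁, ‖Q θ y z‖ₑ) j)
  have hD2 : ∀ j, ∃ D : ℝ → ℝ, Integrable D ∧ (∀ z, 0 ≤ D z) ∧
      ∀ w ∈ closedBall c (r / 2), ∀ z, ‖Q w j z * L w z‖ ≤ D z := fun j =>
    exists_integrable_bound hK (f := fun w z => Q w j z * L w z)
      (fun z => ((hQe j z).1.continuousOn.mono hKr).mul ((hLe z).1.continuousOn.mono hKr))
      (fun w hw => (hQcont w (hKr hw) j).measurable.mul (hLm w (hKr hw)))
      (hLint j) fun w hw z => le_iSup₂ (f := fun w _ => ‖Q w j z * L w z‖ₑ) w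
        (ball_subset_ball hrr₃ (hKr hw))
  choose D1 hD1i hD1n hD1b using hD1
  choose D2 hD2i hD2n hD2b using hD2
  have hbK : ball c (r / 2) ⊆ closedBall c (r / 2) := ball_subset_closedBall
  have hsum : ∀ j z, D1 j z + D2 j z ≤ ∑ j, (D1 j z + D2 j z) := fun j z =>
    Finset.single_le_sum (f := fun j => D1 j z + D2 j z)
      (fun j _ => add_nonneg (hD1n j z) (hD2n j z)) (Finset.mem_univ j)
  -- The integral is holomorphic in the parameter and equals 1 at real points, hence everywhere.
  have hint1 : ∀ j, ∀ w ∈ ball c (r / 2), ∫ z, Q w j z = 1 := by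
    intro j w hw
    have han : AnalyticOnNhd ℂ (fun w => ∫ z, Q w j z) (ball c (r / 2)) :=
      analyticOnNhd_integral_of_dominated (G := fun w z => Q w j z) isOpen_ball
        (fun w hw => (hQcont w (hbr hw) j).aestronglyMeasurable)
        (fun z => ((hQe j z).1.mono hbr).differentiableOn) (hD1i j)
        fun w hw z => hD1b j w (hbK hw) z
    refine sub_eq_zero.1 (eq_zero_of_forall_toComplex (G := fun w => (∫ z, Q w j z) - 1)
      (han.differentiableOn.sub_const 1) (fun θ hθ => ?_) w hw)
    obtain ⟨hθ₂, -, hQθ, -⟩ := hreal θ (hbr hθ)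
    simp only [hQθ]
    have h5 : ∫ z, ((q θ j z : ℝ) : ℂ) = ((∫ z, q θ j z : ℝ) : ℂ) := integral_ofReal
    rw [h5, (hq θ hθ₂ j).integral_eq]
    simp
  -- Domination bounds the ratios at `θ₀` by 1 off a compact set; continuity in `z` bounds them on
  -- it.
  obtain ⟨S, hS, hSb⟩ := hdom 1 one_pos
  have hQ₀ : ∀ j z, Q c j z = (q θ₀ j z : ℂ) := (hreal θ₀ hc).2.2.1
  have hqc : ∀ j, Continuous (q θ₀ j) := by
    intro j
    have h := Complex.continuous_re.comp (hQcont c hc j)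
    have h2 : Complex.re ∘ Q c j = q θ₀ j := funext fun z => by simp [hQ₀]
    rwa [h2] at h
  have hM : ∃ M : ℝ, ∀ j, ∀ z, q θ₀ j z / q θ₀ I z ≤ M := by
    have hM1 : ∀ j, ∃ M : ℝ, ∀ z ∈ S, ‖q θ₀ j z / q θ₀ I z‖ ≤ M := fun j =>
      hS.exists_bound_of_continuousOn
        ((hqc j).div (hqc I) fun z => (hpos I z).ne').continuousOn
    choose M hM using hM1
    refine ⟨1 + ∑ j, |M j|, fun j z => ?_⟩
    have h1 : |M j| ≤ ∑ j, |M j| :=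
      Finset.single_le_sum (f := fun j => |M j|) (fun j _ => abs_nonneg _) (Finset.mem_univ j)
    by_cases hz : z ∈ S
    · have h2 := (le_abs_self _).trans (hM j z hz)
      linarith [le_abs_self (M j)]
    · have h3 : q θ₀ j z / q θ₀ I z ≤ 1 := by
        by_cases hj : j = I
        · rw [hj, div_self (hpos I z).ne']
        · have h4 := hSb z hz j hj c (mem_ball_self hr₄)
          rw [hQ₀, hQ₀, ← Complex.ofReal_div, Complex.norm_real] at h4
          exact (le_abs_self _).trans h4
      linarith [abs_nonneg (M j)]
  obtain ⟨M, hM⟩ := hM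
  refine ⟨r / 2, half_pos hr, L, fun z => ∑ j, (D1 j z + D2 j z), M, fun θ hθ => hreal θ (hbr hθ),
    fun j z => ((hQe j z).1.mono hbr).differentiableOn,
    fun z => ((hLe z).1.mono hbr).differentiableOn,
    fun w hw => ⟨hLm w (hbr hw), fun j => ⟨(hQcont w (hbr hw) j).measurable, hint1 j w hw,
      fun z => ⟨?_, ?_, ?_⟩⟩⟩, ?_, hM, ?_⟩
  · rw [← hexp w (hbr hw) z]
    exact Complex.exp_ne_zero _
  · linarith [hD1b j w (hbK hw) z, hsum j z, hD2n j z]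
  · linarith [hD2b j w (hbK hw) z, hsum j z, hD1n j z]
  · exact integrable_finsetSum _ fun j _ => (hD1i j).add (hD2i j)
  · intro η hη
    rw [eventually_all]
    intro j
    -- Equicontinuity at the center is what makes the perturbation of the ratios small uniformly in
    -- `z`.
    have h := hequi j c (mem_ball_self hr₂) _ (Metric.dist_mem_uniformity hη)
    rw [isOpen_ball.nhdsWithin_eq (mem_ball_self hr₂)] at h
    filter_upwards [h] with w hw z
    have h1 := hw z
    simp only [hQ₀, ← Complex.ofReal_div] at h1
    rw [dist_comm, dist_eq_norm] at h1
    exact h1.le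

/-- The entropy rate is jointly analytic in the parameters of the input and of the channel, for a
channel with a dominating column. -/
theorem entropyRateAnalyticAt {ι₁ : Type} [Fintype ι₁]
    {Ω₁ : Set (EuclideanSpace ℝ ι₁)} (hΩ₁ : IsOpen Ω₁)
    {P : EuclideanSpace ℝ ι₁ → Fin l → Fin l → ℝ} {v : EuclideanSpace ℝ ι₁ → Fin l → ℝ}
    (hP : ∀ ε ∈ Ω₁, IsStochastic (P ε)) (hv : ∀ ε ∈ Ω₁, IsStationary (P ε) (v ε))
    (hPan : ∀ i j, AnalyticOnNhd ℝ (fun ε => P ε i j) Ω₁)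
    {ε₀ : EuclideanSpace ℝ ι₁} (hε₀ : ε₀ ∈ Ω₁) (hpos : ∀ i j, 0 < P ε₀ i j)
    {Ω₂ : Set (EuclideanSpace ℝ ι)} (hΩ₂ : IsOpen Ω₂)
    {q : EuclideanSpace ℝ ι → Fin l → ℝ → ℝ} (hq : ∀ θ ∈ Ω₂, ∀ y, IsProbDensity (q θ y))
    {θ₀ : EuclideanSpace ℝ ι} (hθ₀ : θ₀ ∈ Ω₂) (hqpos : ∀ y z, 0 < q θ₀ y z)
    {Q : EuclideanSpace ℂ ι → Fin l → ℝ → ℂ} (hC : ConditionC q Q θ₀) {I : Fin l}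
    (hD : ConditionD q Q θ₀ I) (hdom : ColumnDominates Q θ₀ I) :
    EntropyRateAnalyticAt P v q ε₀ θ₀ := by
  have hl : l ≠ 0 := by rintro rfl; exact I.elim0
  obtain ⟨ρ, hρ, L, D, M, hreal, hQd, hLd, hB, hDi, hM, hR⟩ :=
    exists_regular_extension hΩ₂ hq hθ₀ hqpos hC hD hdom
  obtain ⟨W, hWo, hPW, hrow, hst, hinv, hWreal⟩ :=
    exists_complex_stationary hl (hP ε₀ hε₀).2 hpos
  set c := toComplex θ₀ with hcdef
  have hc : c ∈ ball c ρ := mem_ball_self hρ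
  set A : EuclideanSpace ℝ ι₁ → Fin l → Fin l → ℂ := fun ε i k => (P ε i k : ℂ) with hAdef
  have hAε : ∀ ε ∈ Ω₁, A ε ∈ W → rowNormalize (A ε) = A ε ∧
      stationaryVector (A ε) = fun i => (v ε i : ℂ) := fun ε hε hW =>
    ⟨(hWreal (P ε) (hP ε hε) hW).1, (hWreal (P ε) (hP ε hε) hW).2 _ (hv ε hε)⟩
  obtain ⟨hA1, hA2⟩ := hAε ε₀ hε₀ hPW
  have hQ₀ := (hreal θ₀ hc).2.2.1
  -- The complex parameter is a pair of a matrix and a channel parameter, so no complexification of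
  -- `P` in `ε` is needed: `ε` enters through composition with the real analytic map `A`.
  obtain ⟨F, hF, hFev⟩ := exists_analyticAt_limit (E := (Fin l → Fin l → ℂ) × EuclideanSpace ℂ ι)
    (U := W ×ˢ ball c ρ) (hWo.prod isOpen_ball) (e₀ := (A ε₀, c)) ⟨hPW, hc⟩
    (P := fun e => rowNormalize e.1) (v := fun e => stationaryVector (rowNormalize e.1))
    (Q := fun e => Q e.2) (L := fun e => L e.2)
    (fun i k => (hrow i k).comp differentiableOn_fst fun e he => he.1)
    (fun i => (hst i).comp differentiableOn_fst fun e he => he.1)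
    (fun j z => (hQd j z).comp differentiableOn_snd fun e he => he.2)
    (fun z => (hLd z).comp differentiableOn_snd fun e he => he.2)
    (fun e he j => ((hB e.2 he.2).2 j).1) (fun e he => (hB e.2 he.2).1)
    (fun e he k => hinv e.1 he.1 k) (fun e he j => ((hB e.2 he.2).2 j).2.1) hDi
    (fun e he j z => (((hB e.2 he.2).2 j).2.2 z).2.1)
    (fun e he j z => (((hB e.2 he.2).2 j).2.2 z).2.2) (I := I)
    (fun e he z => (((hB e.2 he.2).2 I).2.2 z).1)
    (P₀ := P ε₀) (fun i k => congrFun (congrFun hA1 i) k) hpos (hP ε₀ hε₀).2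
    (v₀ := v ε₀) (fun i => by simp only [hA1, hA2]) (fun i => (hv ε₀ hε₀).pos hpos i)
    (hv ε₀ hε₀).2.1 (q₀ := q θ₀) hQ₀ hqpos hM
    (fun η hη => (continuous_snd.tendsto (A ε₀, c)).eventually (hR η hη))
  have hAan : AnalyticAt ℝ A ε₀ := by
    simp only [hAdef]
    refine AnalyticAt.pi fun i => AnalyticAt.pi fun k => ?_
    exact (Complex.ofRealCLM.analyticAt _).comp (hPan i k ε₀ hε₀)
  have hTan : AnalyticAt ℝ (toComplex : EuclideanSpace ℝ ι → EuclideanSpace ℂ ι) θ₀ := by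
    let T : EuclideanSpace ℝ ι →ₗ[ℝ] EuclideanSpace ℂ ι :=
      { toFun := toComplex
        map_add' := fun x y => by ext i; simp
        map_smul' := fun a x => by ext i; simp }
    exact (LinearMap.toContinuousLinearMap T).analyticAt θ₀
  have hΦ : AnalyticAt ℝ (fun x : EuclideanSpace ℝ ι₁ × EuclideanSpace ℝ ι =>
      (A x.1, toComplex x.2)) (ε₀, θ₀) :=
    (hAan.comp (f := Prod.fst) (x := (ε₀, θ₀)) analyticAt_fst).prod
      (hTan.comp (f := Prod.snd) (x := (ε₀, θ₀)) analyticAt_snd)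
  refine ⟨fun x => -(F (A x.1, toComplex x.2)).re, ?_, ?_⟩
  · exact ((Complex.reCLM.analyticAt _).comp (hF.restrictScalars.comp (x := (ε₀, θ₀)) hΦ)).neg
  · have hev := hΦ.continuousAt.eventually hFev
    have hevU := hΦ.continuousAt.eventually
      ((hWo.prod isOpen_ball).mem_nhds (show (A ε₀, c) ∈ W ×ˢ ball c ρ from ⟨hPW, hc⟩))
    have hevΩ : ∀ᶠ x : EuclideanSpace ℝ ι₁ × EuclideanSpace ℝ ι in 𝓝 (ε₀, θ₀), x.1 ∈ Ω₁ :=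
      continuousAt_fst.eventually (hΩ₁.mem_nhds hε₀)
    have hevP : ∀ᶠ x : EuclideanSpace ℝ ι₁ × EuclideanSpace ℝ ι in 𝓝 (ε₀, θ₀),
        ∀ i k, 0 < P x.1 i k := by
      simp only [eventually_all]
      intro i k
      exact (continuous_fst.tendsto (ε₀, θ₀)).eventually
        ((hPan i k ε₀ hε₀).continuousAt.eventually_const_lt (hpos i k))
    filter_upwards [hev, hevU, hevΩ, hevP] with x hx hxU hxΩ hxP
    obtain ⟨hx1, hx2⟩ := hAε x.1 hxΩ hxU.1
    obtain ⟨hθΩ, hqI, hQθ, hLθ⟩ := hreal x.2 hxU.2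
    have hQ' : Q (toComplex x.2) = fun j z => (q x.2 j z : ℂ) := by ext j z; exact hQθ j z
    have hL' : L (toComplex x.2) = fun z => (Real.log (q x.2 I z) : ℂ) := funext hLθ
    simp only [hx1, hx2, hQ', hL'] at hx
    exact hasEntropyRate_of_tendsto (hP x.1 hxΩ).2 hxP (fun i => (hv x.1 hxΩ).pos hxP i)
      (hv x.1 hxΩ).2.1 (hq x.2 hθΩ) hqI hx.1 hx.2

end HiddenMarkov

namespace HiddenMarkov

variable {l : ℕ}

/-! ### Gaussian channels -/

/-- A uniformly bounded family of holomorphic functions on an open set is equicontinuous. -/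
lemma equicontinuousOn_of_bounded {α E : Type*} [NormedAddCommGroup E] [NormedSpace ℂ E]
    {f : α → E → ℂ} {U : Set E} (hU : IsOpen U) (hf : ∀ a, DifferentiableOn ℂ (f a) U) {M : ℝ}
    (hM : ∀ a, ∀ w ∈ U, ‖f a w‖ ≤ M) : EquicontinuousOn f U := by
  intro w₀ hw₀ u hu
  obtain ⟨η, hη, hηu⟩ := Metric.mem_uniformity_dist.1 hu
  obtain ⟨ρ, hρ, hρU⟩ := Metric.isOpen_iff.1 hU w₀ hw₀
  have hlim : Tendsto (fun w => (M + M) / ρ * dist w w₀) (𝓝 w₀) (𝓝 0) := by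
    have h : Continuous fun w => (M + M) / ρ * dist w w₀ := by fun_prop
    simpa using h.tendsto w₀
  refine mem_nhdsWithin_of_mem_nhds ?_
  filter_upwards [ball_mem_nhds w₀ hρ, hlim.eventually_lt_const hη] with w hw hlt a
  refine hηu ?_
  rw [dist_comm]
  -- By the Schwarz lemma, a common bound yields a common Lipschitz bound at `w₀`: the functions map
  -- a ball around `w₀` into balls of radius `M + M` around their values at `w₀`.
  refine (Complex.dist_le_div_mul_dist_of_mapsTo_ball ((hf a).mono hρU) (fun x hx => ?_) hw).trans_lt
    hlt
  rw [mem_closedBall]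
  exact (dist_le_norm_add_norm _ _).trans (add_le_add (hM a x (hρU hx)) (hM a w₀ hw₀))

/-- A holomorphic function of several complex variables is analytic. -/
lemma analyticOnNhd_of_differentiableOn {E : Type*} [NormedAddCommGroup E] [NormedSpace ℂ E]
    [FiniteDimensional ℂ E] {f : E → ℂ} {U : Set E} (hU : IsOpen U)
    (hf : DifferentiableOn ℂ f U) : AnalyticOnNhd ℂ f U := by
  refine analyticOnNhd_of_continuousOn_of_lines hU hf.continuousOn fun x hx h => ?_
  have h1 : DifferentiableAt ℂ f (x + (0 : ℂ) • h) := by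
    simpa using hf.differentiableAt (hU.mem_nhds hx)
  exact DifferentiableAt.comp (f := fun t : ℂ => x + t • h) 0 h1 (by fun_prop)

lemma abs_log_le_of_mem {x : ℝ≥0∞} {B : ℝ} (h1 : ENNReal.ofReal (Real.exp (-B)) ≤ x)
    (h2 : x ≤ ENNReal.ofReal (Real.exp B)) : (ENNReal.log x).abs ≤ ENNReal.ofReal B := by
  lift x to NNReal using ne_top_of_le_ne_top ENNReal.ofReal_ne_top h2
  rw [← ENNReal.ofReal_coe_nnreal] at h1 h2 ⊢
  have h3 := (ENNReal.ofReal_le_ofReal_iff x.2).1 h1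
  have h4 := (ENNReal.ofReal_le_ofReal_iff (Real.exp_pos _).le).1 h2
  have h5 : (0 : ℝ) < x := (Real.exp_pos _).trans_le h3
  rw [ENNReal.log_ofReal_of_pos h5, EReal.abs_def]
  exact ENNReal.ofReal_le_ofReal (abs_le.2 ⟨(Real.le_log_iff_exp_le h5).2 h3,
    (Real.log_le_iff_le_exp h5).2 h4⟩)

/-- Half of the Gaussian decay absorbs the quadratic factor that comes from the logarithm of the
density. -/
lemma one_add_sq_mul_exp_le {κ : ℝ} (hκ : 0 < κ) (C z : ℝ) :
    Real.exp (C - κ * z ^ 2) * (1 + z ^ 2) ≤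
      Real.exp C * (1 + 2 / κ) * Real.exp (-(κ / 2) * z ^ 2) := by
  have h1 : Real.exp (C - κ * z ^ 2) =
      Real.exp C * (Real.exp (-(κ / 2) * z ^ 2) * Real.exp (-(κ / 2) * z ^ 2)) := by
    rw [← Real.exp_add, ← Real.exp_add]; congr 1; ring
  have h2 : Real.exp (-(κ / 2) * z ^ 2) * (1 + z ^ 2) ≤ 1 + 2 / κ := by
    have h3 : κ / 2 * z ^ 2 + 1 ≤ Real.exp (κ / 2 * z ^ 2) := Real.add_one_le_exp _
    have h4 : Real.exp (-(κ / 2) * z ^ 2) * Real.exp (κ / 2 * z ^ 2) = 1 := by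
      rw [← Real.exp_add]; simp
    have h5 : 1 + z ^ 2 ≤ (1 + 2 / κ) * Real.exp (κ / 2 * z ^ 2) := by
      have h6 : (1 + 2 / κ) * (κ / 2 * z ^ 2 + 1) = κ / 2 * z ^ 2 + 1 + z ^ 2 + 2 / κ := by
        field_simp
        ring
      have h7 : (1 + 2 / κ) * (κ / 2 * z ^ 2 + 1) ≤ (1 + 2 / κ) * Real.exp (κ / 2 * z ^ 2) :=
        mul_le_mul_of_nonneg_left h3 (by positivity)
      have h8 : 0 ≤ κ / 2 * z ^ 2 := by positivity
      have h9 : 0 ≤ 2 / κ := by positivity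
      linarith
    calc _ ≤ Real.exp (-(κ / 2) * z ^ 2) * ((1 + 2 / κ) * Real.exp (κ / 2 * z ^ 2)) :=
          mul_le_mul_of_nonneg_left h5 (Real.exp_pos _).le
      _ = 1 + 2 / κ := by rw [mul_left_comm, h4, mul_one]
  rw [h1]
  calc _ = Real.exp C * (Real.exp (-(κ / 2) * z ^ 2) * (1 + z ^ 2)) *
        Real.exp (-(κ / 2) * z ^ 2) := by ring
    _ ≤ _ := by gcongr

lemma lintegral_exp_mul_lt_top {κ : ℝ} (hκ : 0 < κ) (C : ℝ) :
    ∫⁻ z : ℝ, ENNReal.ofReal (Real.exp (C - κ * z ^ 2) * (1 + z ^ 2)) < ∞ := by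
  have h := (integrable_exp_neg_mul_sq (half_pos hκ)).const_mul (Real.exp C * (1 + 2 / κ))
  exact (lintegral_mono fun z => ENNReal.ofReal_le_ofReal (one_add_sq_mul_exp_le hκ C z)).trans_lt
    h.lintegral_lt_top

/-- The logarithm of the density of the Gaussian channel, at complex parameters. -/
noncomputable def gaussianPhase (w : EuclideanSpace ℂ (Fin l ⊕ Fin l)) (i : Fin l) (z : ℝ) : ℂ :=
  -((z : ℂ) - w (Sum.inr i)) ^ 2 / (2 * w (Sum.inl i) ^ 2) -
    Complex.log ((Real.sqrt (2 * Real.pi) : ℂ) * w (Sum.inl i))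

lemma gaussianChannel_pos {θ : EuclideanSpace ℝ (Fin l ⊕ Fin l)} {i : Fin l}
    (h : 0 < θ (Sum.inl i)) (z : ℝ) : 0 < gaussianChannel θ i z := by
  have := Real.pi_pos
  unfold gaussianChannel
  positivity

lemma gaussianPhase_toComplex {θ : EuclideanSpace ℝ (Fin l ⊕ Fin l)} {i : Fin l}
    (h : 0 < θ (Sum.inl i)) (z : ℝ) :
    gaussianPhase (toComplex θ) i z = (Real.log (gaussianChannel θ i z) : ℂ) := by
  have h1 : 0 < Real.sqrt (2 * Real.pi) * θ (Sum.inl i) :=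
    mul_pos (Real.sqrt_pos.2 Real.two_pi_pos) h
  rw [gaussianChannel, Real.log_mul (one_div_pos.2 h1).ne' (Real.exp_pos _).ne', Real.log_exp,
    one_div, Real.log_inv, gaussianPhase, toComplex_apply, toComplex_apply]
  push_cast [Complex.ofReal_log h1.le]
  ring

lemma isProbDensity_gaussianChannel {θ : EuclideanSpace ℝ (Fin l ⊕ Fin l)} {i : Fin l}
    (h : 0 < θ (Sum.inl i)) : IsProbDensity (gaussianChannel θ i) := by
  have h1 : gaussianChannel θ i = ProbabilityTheory.gaussianPDFReal (θ (Sum.inr i))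
      (θ (Sum.inl i) ^ 2).toNNReal := by
    ext z
    rw [gaussianChannel, ProbabilityTheory.gaussianPDFReal_def,
      Real.coe_toNNReal _ (sq_nonneg _),
      Real.sqrt_mul (by positivity : (0 : ℝ) ≤ 2 * Real.pi), Real.sqrt_sq h.le, one_div]
  rw [h1]
  refine ⟨ProbabilityTheory.measurable_gaussianPDFReal _ _,
    ProbabilityTheory.gaussianPDFReal_nonneg _ _,
    ProbabilityTheory.lintegral_gaussianPDFReal_eq_one _ fun h0 => ?_⟩
  exact (pow_pos h 2).not_ge (Real.toNNReal_eq_zero.1 h0)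

/-- A quadratic polynomial with bounded coefficients and a negative leading coefficient. -/
lemma re_quadratic_le {a b d : ℂ} {κ C : ℝ} (hκ : 0 < κ) (ha : 2 * κ ≤ a.re) (hb : ‖b‖ ≤ C)
    (hd : ‖d‖ ≤ C) (z : ℝ) : (-(a * z ^ 2) + b * z + d).re ≤ C ^ 2 / κ + C - κ * z ^ 2 := by
  have h1 : (-(a * z ^ 2) + b * z + d).re = -(a.re * z ^ 2) + b.re * z + d.re := by
    have : (z : ℂ) ^ 2 = ((z ^ 2 : ℝ) : ℂ) := by push_cast; rfl
    rw [this, Complex.add_re, Complex.add_re, Complex.neg_re, Complex.re_mul_ofReal,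
      Complex.re_mul_ofReal]
  rw [h1]
  have h2 : 2 * κ * z ^ 2 ≤ a.re * z ^ 2 := mul_le_mul_of_nonneg_right ha (sq_nonneg z)
  have h3 : d.re ≤ C := (Complex.re_le_norm d).trans hd
  have h4 : b.re * z ≤ C * |z| := (le_abs_self _).trans (by
    rw [abs_mul]
    exact mul_le_mul_of_nonneg_right ((Complex.abs_re_le_norm b).trans hb) (abs_nonneg z))
  have h5 : C * |z| ≤ C ^ 2 / κ + κ * z ^ 2 := by
    -- Completing the square: half of the leading coefficient pays for the linear term, which is why
    -- `2 * κ` is assumed and `κ` retained.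
    have h6 : C ^ 2 / κ + κ * z ^ 2 - C * |z| = ((C - κ * |z| / 2) ^ 2 + 3 / 4 * (κ * |z|) ^ 2) / κ := by
      rw [← sq_abs z]
      field_simp
      ring
    have : 0 ≤ C ^ 2 / κ + κ * z ^ 2 - C * |z| := by rw [h6]; positivity
    linarith
  linarith

lemma norm_quadratic_le {a b d : ℂ} {C : ℝ} (ha : ‖a‖ ≤ C) (hb : ‖b‖ ≤ C)
    (hd : ‖d‖ ≤ C) (z : ℝ) : ‖-(a * z ^ 2) + b * z + d‖ ≤ 2 * C * (1 + z ^ 2) := by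
  have hC := (norm_nonneg a).trans ha
  have h1 : ‖-(a * z ^ 2) + b * z + d‖ ≤ C * z ^ 2 + C * |z| + C := by
    refine (norm_add₃_le).trans (add_le_add (add_le_add ?_ ?_) hd)
    · rw [norm_neg, norm_mul, norm_pow, Complex.norm_real, Real.norm_eq_abs, sq_abs]
      exact mul_le_mul_of_nonneg_right ha (sq_nonneg z)
    · rw [norm_mul, Complex.norm_real, Real.norm_eq_abs]
      exact mul_le_mul_of_nonneg_right hb (abs_nonneg z)
  have h2 : |z| ≤ 1 + z ^ 2 := by rw [← sq_abs z]; nlinarith [sq_nonneg (|z| - 1), abs_nonneg z]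
  have h3 := mul_le_mul_of_nonneg_left h2 hC
  linarith

/-- Around a Gaussian channel with a unique largest variance, the logarithms of the densities are
analytic in the complexified parameter and have quadratic bounds. -/
theorem exists_gaussianPhase_bounds {θ₀ : EuclideanSpace ℝ (Fin l ⊕ Fin l)}
    (hσ : ∀ i, 0 < θ₀ (Sum.inl i)) {I : Fin l}
    (hI : ∀ j ≠ I, θ₀ (Sum.inl j) < θ₀ (Sum.inl I)) :
    ∃ r > 0, ∃ κ > 0, ∃ C : ℝ,
      (∀ i z, DifferentiableOn ℂ (fun w => gaussianPhase w i z) (ball (toComplex θ₀) r)) ∧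
      (∀ i, ContinuousOn (fun p : ℝ × EuclideanSpace ℂ (Fin l ⊕ Fin l) => gaussianPhase p.2 i p.1)
        (Set.univ ×ˢ ball (toComplex θ₀) r)) ∧
      (∀ θ, toComplex θ ∈ ball (toComplex θ₀) r → ∀ i, 0 < θ (Sum.inl i)) ∧
      ∀ w ∈ ball (toComplex θ₀) r, ∀ i z, ‖gaussianPhase w i z‖ ≤ C * (1 + z ^ 2) ∧
        (gaussianPhase w i z).re ≤ C - κ * z ^ 2 ∧
        (i ≠ I → (gaussianPhase w i z - gaussianPhase w I z).re ≤ C - κ * z ^ 2) := by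
  set c := toComplex θ₀ with hc
  set a : EuclideanSpace ℂ (Fin l ⊕ Fin l) → Fin l → ℂ := fun w i => (2 * w (Sum.inl i) ^ 2)⁻¹
    with ha
  set b : EuclideanSpace ℂ (Fin l ⊕ Fin l) → Fin l → ℂ := fun w i => 2 * w (Sum.inr i) * a w i
    with hb
  set d : EuclideanSpace ℂ (Fin l ⊕ Fin l) → Fin l → ℂ := fun w i =>
    -(w (Sum.inr i) ^ 2 * a w i) - Complex.log ((Real.sqrt (2 * Real.pi) : ℂ) * w (Sum.inl i))
    with hd
  have hphase : ∀ w i (z : ℝ), gaussianPhase w i z = -(a w i * z ^ 2) + b w i * z + d w i := by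
    intro w i z
    simp only [gaussianPhase, hd, hb, ha]
    ring
  have hs : 0 < Real.sqrt (2 * Real.pi) := Real.sqrt_pos.2 Real.two_pi_pos
  have hslit : ∀ x : ℂ, 0 < x.re → (Real.sqrt (2 * Real.pi) : ℂ) * x ∈ Complex.slitPlane := by
    intro x hx
    refine Or.inl ?_
    rw [Complex.re_ofReal_mul]
    exact mul_pos hs hx
  have hne : ∀ x : ℂ, 0 < x.re → 2 * x ^ 2 ≠ 0 := by
    intro x hx
    have : x ≠ 0 := by rintro rfl; simp at hx
    exact mul_ne_zero two_ne_zero (pow_ne_zero 2 this)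
  have hc0 : ∀ i, 0 < (c (Sum.inl i)).re := fun i => by
    rw [hc, toComplex_apply, Complex.ofReal_re]; exact hσ i
  have hcoord : ∀ x : Fin l ⊕ Fin l, Continuous fun w : EuclideanSpace ℂ (Fin l ⊕ Fin l) => w x :=
    fun x => by fun_prop
  have hac : ∀ i, ContinuousAt (fun w => a w i) c := fun i =>
    ContinuousAt.inv₀ (by fun_prop) (hne _ (hc0 i))
  have hbc : ∀ i, ContinuousAt (fun w => b w i) c := fun i =>
    ContinuousAt.mul (by fun_prop) (hac i)
  have hdc : ∀ i, ContinuousAt (fun w => d w i) c := fun i =>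
    ((ContinuousAt.mul (by fun_prop) (hac i)).neg).sub
      (ContinuousAt.clog (by fun_prop) (hslit _ (hc0 i)))
  have hacr : ∀ i, a c i = (((2 * θ₀ (Sum.inl i) ^ 2)⁻¹ : ℝ) : ℂ) := fun i => by
    simp only [ha, hc, toComplex_apply]; push_cast; rfl
  have hapos : ∀ i, 0 < (a c i).re := fun i => by
    rw [hacr, Complex.ofReal_re]
    have := hσ i
    positivity
  -- The leading coefficient is `1 / (2 σ²)`, so the largest variance has the smallest one. The
  -- logarithm of the ratio of column `j` to column `I` is then itself a quadratic polynomial with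
  -- negative leading coefficient.
  have haI : ∀ j, j ≠ I → 0 < (a c j - a c I).re := fun j hj => by
    rw [hacr, hacr, ← Complex.ofReal_sub, Complex.ofReal_re, sub_pos]
    have h1 := hσ j
    exact inv_strictAnti₀ (by positivity) (by gcongr; exact hI j hj)
  obtain ⟨p, hp, -, hpf⟩ := exists_pos_le_of_forall_pos
    (f := fun x : Fin l ⊕ {j // j ≠ I} =>
      Sum.elim (fun i => (a c i).re) (fun j => (a c j.1 - a c I).re) x)
    (by rintro (i | j); exacts [hapos i, haI j.1 j.2])
  have hp1 : ∀ i, p / 2 < (a c i).re := fun i => by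
    have : p ≤ (a c i).re := hpf (Sum.inl i)
    linarith
  have hp2 : ∀ j, j ≠ I → p / 2 < (a c j - a c I).re := fun j hj => by
    have : p ≤ (a c j - a c I).re := hpf (Sum.inr ⟨j, hj⟩)
    linarith
  obtain ⟨K, hK⟩ : ∃ K : ℝ, ∀ i, ‖a c i‖ < K ∧ ‖b c i‖ < K ∧ ‖d c i‖ < K := by
    have h1 : ∀ i, ‖a c i‖ + ‖b c i‖ + ‖d c i‖ ≤ ∑ i, (‖a c i‖ + ‖b c i‖ + ‖d c i‖) := fun i =>
      Finset.single_le_sum (f := fun i => ‖a c i‖ + ‖b c i‖ + ‖d c i‖)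
        (fun i _ => by positivity) (Finset.mem_univ i)
    refine ⟨∑ i, (‖a c i‖ + ‖b c i‖ + ‖d c i‖) + 1, fun i => ?_⟩
    have := h1 i
    have h2 := norm_nonneg (a c i)
    have h3 := norm_nonneg (b c i)
    have h4 := norm_nonneg (d c i)
    exact ⟨by linarith, by linarith, by linarith⟩
  have hev : ∀ᶠ w in 𝓝 c, ∀ i, 0 < (w (Sum.inl i)).re ∧ p / 2 < (a w i).re ∧
      (i ≠ I → p / 2 < (a w i - a w I).re) ∧ ‖a w i‖ < K ∧ ‖b w i‖ < K ∧ ‖d w i‖ < K := by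
    rw [eventually_all]
    intro i
    have e1 : ∀ᶠ w : EuclideanSpace ℂ (Fin l ⊕ Fin l) in 𝓝 c, 0 < (w (Sum.inl i)).re :=
      (Complex.continuous_re.comp (hcoord (Sum.inl i))).continuousAt.eventually_const_lt (hc0 i)
    have e2 : ∀ᶠ w in 𝓝 c, p / 2 < (a w i).re :=
      (Complex.continuous_re.continuousAt.comp (hac i)).eventually_const_lt (hp1 i)
    have e3 : ∀ᶠ w in 𝓝 c, i ≠ I → p / 2 < (a w i - a w I).re := by
      rw [eventually_imp_distrib_left]
      intro hi
      exact (Complex.continuous_re.continuousAt.comp ((hac i).sub (hac I))).eventually_const_lt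
        (hp2 i hi)
    exact e1.and (e2.and (e3.and (((hac i).norm.eventually_lt_const (hK i).1).and
      (((hbc i).norm.eventually_lt_const (hK i).2.1).and
        ((hdc i).norm.eventually_lt_const (hK i).2.2)))))
  obtain ⟨r, hr, hball⟩ := Metric.eventually_nhds_iff_ball.1 hev
  have hK0 : 0 < K := (norm_nonneg _).trans_lt (hK I).1
  -- Leading coefficients have real part above `p / 2 = 2 * κ` near `c`. The constants use `2 * K`
  -- because differences of coefficients occur as well.
  have hκ : 0 < p / 4 := by positivity
  have hle1 : 2 * K ≤ (2 * K) ^ 2 / (p / 4) + 2 * K := by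
    have : 0 ≤ (2 * K) ^ 2 / (p / 4) := by positivity
    linarith
  refine ⟨r, hr, p / 4, hκ, (2 * K) ^ 2 / (p / 4) + 2 * K, fun i z w hw => ?_, fun i x hx => ?_,
    fun θ hθ i => ?_, fun w hw i z => ⟨?_, ?_, fun hi => ?_⟩⟩
  · have h0 := (hball w hw i).1
    have h1 : ∀ x : Fin l ⊕ Fin l,
        DifferentiableAt ℂ (fun w : EuclideanSpace ℂ (Fin l ⊕ Fin l) => w x) w :=
      fun x => (EuclideanSpace.proj (𝕜 := ℂ) x : _ →L[ℂ] ℂ).differentiableAt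
    refine DifferentiableAt.differentiableWithinAt ?_
    simp only [gaussianPhase, div_eq_mul_inv]
    refine ((((h1 _).const_sub _).fun_pow 2).fun_neg.fun_mul
      ((((h1 _).fun_pow 2).const_mul 2).fun_inv (hne _ h0))).fun_sub
      (((h1 _).const_mul _).clog (hslit _ h0))
  · have h0 := (hball x.2 hx.2 i).1
    refine ContinuousAt.continuousWithinAt ?_
    have h1 : ∀ y : Fin l ⊕ Fin l, ContinuousAt
        (fun p : ℝ × EuclideanSpace ℂ (Fin l ⊕ Fin l) => p.2 y) x := fun y => by fun_prop
    have h2 : ContinuousAt (fun p : ℝ × EuclideanSpace ℂ (Fin l ⊕ Fin l) => (p.1 : ℂ)) x := by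
      fun_prop
    exact ((((h2.sub (h1 _)).pow 2).neg).div (continuousAt_const.mul ((h1 _).pow 2))
      (hne _ h0)).sub ((continuousAt_const.mul (h1 _)).clog (hslit _ h0))
  · have := (hball _ hθ i).1
    rwa [toComplex_apply, Complex.ofReal_re] at this
  · rw [hphase]
    obtain ⟨-, -, -, h1, h2, h3⟩ := hball w hw i
    refine (norm_quadratic_le h1.le h2.le h3.le z).trans ?_
    exact mul_le_mul_of_nonneg_right hle1 (by positivity)
  · rw [hphase]
    obtain ⟨-, h0, -, h1, h2, h3⟩ := hball w hw i
    exact re_quadratic_le hκ (by linarith) (by linarith) (by linarith) z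
  · obtain ⟨-, -, h0, h1, h2, h3⟩ := hball w hw i
    obtain ⟨-, -, -, h1', h2', h3'⟩ := hball w hw I
    have h4 : gaussianPhase w i z - gaussianPhase w I z =
        -((a w i - a w I) * z ^ 2) + (b w i - b w I) * z + (d w i - d w I) := by
      rw [hphase, hphase]; ring
    rw [h4]
    exact re_quadratic_le hκ (by linarith [h0 hi])
      ((norm_sub_le _ _).trans (by linarith)) ((norm_sub_le _ _).trans (by linarith)) z

/-- The regularity conditions for a Gaussian channel with a unique largest variance. -/
theorem gaussianChannel_conditions {θ₀ : EuclideanSpace ℝ (Fin l ⊕ Fin l)}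
    (hσ : ∀ i, 0 < θ₀ (Sum.inl i)) {I : Fin l}
    (hI : ∀ j ≠ I, θ₀ (Sum.inl j) < θ₀ (Sum.inl I)) :
    ∃ Q : EuclideanSpace ℂ (Fin l ⊕ Fin l) → Fin l → ℝ → ℂ,
      ConditionC gaussianChannel Q θ₀ ∧ ConditionD gaussianChannel Q θ₀ I ∧
        ColumnDominates Q θ₀ I := by
  obtain ⟨r, hr, κ, hκ, C, hdiff, hcont, hreal, hbd⟩ := exists_gaussianPhase_bounds hσ hI
  set c := toComplex θ₀ with hc
  have hcr : c ∈ ball c r := mem_ball_self hr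
  have hC0 : 0 ≤ C := by
    have h := (norm_nonneg _).trans (hbd c hcr I 0).1
    simpa using h
  set Q : EuclideanSpace ℂ (Fin l ⊕ Fin l) → Fin l → ℝ → ℂ := fun w i z =>
    Complex.exp (gaussianPhase w i z) with hQ
  have hnorm : ∀ w i z, ‖Q w i z‖ = Real.exp (gaussianPhase w i z).re := fun w i z =>
    Complex.norm_exp _
  have hQle : ∀ w ∈ ball c r, ∀ i z, ‖Q w i z‖ ≤ Real.exp (C - κ * z ^ 2) := fun w hw i z => by
    rw [hnorm]; exact Real.exp_le_exp.2 (hbd w hw i z).2.1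
  have hQge : ∀ w ∈ ball c r, ∀ i z, Real.exp (-(C * (1 + z ^ 2))) ≤ ‖Q w i z‖ := fun w hw i z => by
    rw [hnorm]
    refine Real.exp_le_exp.2 ?_
    have h1 := (abs_le.1 ((Complex.abs_re_le_norm _).trans (hbd w hw i z).1)).1
    exact h1
  have hexpn : ∀ z : ℝ, C - κ * z ^ 2 ≤ C * (1 + z ^ 2) := fun z => by
    have h1 : 0 ≤ C * z ^ 2 := by positivity
    have h2 : 0 ≤ κ * z ^ 2 := by positivity
    linarith
  have hexpmul : ∀ z : ℝ, Real.exp (C - κ * z ^ 2) ≤ Real.exp (C - κ * z ^ 2) * (1 + z ^ 2) :=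
    fun z => le_mul_of_one_le_right (Real.exp_pos _).le (by linarith [sq_nonneg z])
  have hsup : ∀ z, supDensity Q θ₀ r z ≤ ENNReal.ofReal (Real.exp (C - κ * z ^ 2)) := fun z =>
    iSup_le fun i => iSup₂_le fun w hw => by
      rw [← ofReal_norm]; exact ENNReal.ofReal_le_ofReal (hQle w hw i z)
  have hsup' : ∀ z, ENNReal.ofReal (Real.exp (-(C * (1 + z ^ 2)))) ≤ supDensity Q θ₀ r z :=
    fun z => by
      refine le_trans ?_ ((le_iSup₂ (f := fun w (_ : w ∈ ball c r) => ‖Q w I z‖ₑ) c hcr).trans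
        (le_iSup (fun y => ⨆ w ∈ ball c r, ‖Q w y z‖ₑ) I))
      rw [← ofReal_norm]; exact ENNReal.ofReal_le_ofReal (hQge c hcr I z)
  have hinf : ∀ z, ENNReal.ofReal (Real.exp (-(C * (1 + z ^ 2)))) ≤ infDensity Q θ₀ r z :=
    fun z => le_iInf fun i => le_iInf₂ fun w hw => by
      rw [← ofReal_norm]; exact ENNReal.ofReal_le_ofReal (hQge w hw i z)
  have hinf' : ∀ z, infDensity Q θ₀ r z ≤ ENNReal.ofReal (Real.exp (C - κ * z ^ 2)) := fun z => by
    refine ((iInf_le (fun y => ⨅ w ∈ ball c r, ‖Q w y z‖ₑ) I).trans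
      (iInf₂_le (f := fun w (_ : w ∈ ball c r) => ‖Q w I z‖ₑ) c hcr)).trans ?_
    rw [← ofReal_norm]; exact ENNReal.ofReal_le_ofReal (hQle c hcr I z)
  have hup : ∀ z : ℝ, ENNReal.ofReal (Real.exp (C - κ * z ^ 2)) ≤
      ENNReal.ofReal (Real.exp (C * (1 + z ^ 2))) := fun z =>
    ENNReal.ofReal_le_ofReal (Real.exp_le_exp.2 (hexpn z))
  have hfin : ∫⁻ z : ℝ, ENNReal.ofReal (Real.exp (C - κ * z ^ 2)) *
      ENNReal.ofReal (C * (1 + z ^ 2)) < ∞ := by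
    have h1 : ∀ z : ℝ, ENNReal.ofReal (Real.exp (C - κ * z ^ 2)) * ENNReal.ofReal (C * (1 + z ^ 2)) =
        ENNReal.ofReal C * ENNReal.ofReal (Real.exp (C - κ * z ^ 2) * (1 + z ^ 2)) := fun z => by
      rw [← ENNReal.ofReal_mul (Real.exp_pos _).le, ← ENNReal.ofReal_mul hC0]
      congr 1; ring
    simp_rw [h1]
    rw [lintegral_const_mul' _ _ ENNReal.ofReal_ne_top]
    exact ENNReal.mul_lt_top ENNReal.ofReal_lt_top (lintegral_exp_mul_lt_top hκ C)
  have hQd : ∀ i z, DifferentiableOn ℂ (fun w => Q w i z) (ball c r) := fun i z =>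
    (hdiff i z).cexp
  refine ⟨Q, ⟨r, hr, fun i z => ⟨analyticOnNhd_of_differentiableOn isOpen_ball (hQd i z), fun θ hθ => ?_⟩, fun i => ?_,
    ?_, ?_, ?_⟩, ⟨⟨r, hr, fun j => ?_⟩, r, hr, fun w z => gaussianPhase w I z,
      fun z => ⟨analyticOnNhd_of_differentiableOn isOpen_ball (hdiff I z), fun θ hθ => ?_⟩, fun j => ?_⟩, r, hr,
      fun δ hδ => ?_⟩
  · have h := hreal θ hθ i
    simp only [hQ]
    rw [gaussianPhase_toComplex h, ← Complex.ofReal_exp, Real.exp_log (gaussianChannel_pos h z)]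
  · exact (hcont i).cexp
  · exact (lintegral_mono fun z => (hsup z).trans
      (ENNReal.ofReal_le_ofReal (hexpmul z))).trans_lt (lintegral_exp_mul_lt_top hκ C)
  · exact (lintegral_mono fun z => mul_le_mul' (hsup z)
      (abs_log_le_of_mem (hinf z) ((hinf' z).trans (hup z)))).trans_lt hfin
  · exact (lintegral_mono fun z => mul_le_mul' (hsup z)
      (abs_log_le_of_mem (hsup' z) ((hsup z).trans (hup z)))).trans_lt hfin
  · have hdiv : ∀ w z, Q w j z / Q w I z = Complex.exp (gaussianPhase w j z - gaussianPhase w I z) :=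
      fun w z => (Complex.exp_sub _ _).symm
    simp only [hdiv]
    -- Column `I` decays slowest, so the ratios are bounded uniformly in `z` and in the complex
    -- parameter; for holomorphic families this suffices.
    refine equicontinuousOn_of_bounded isOpen_ball (M := Real.exp C)
      (fun z => ((hdiff j z).sub (hdiff I z)).cexp) fun z w hw => ?_
    rw [Complex.norm_exp, Real.exp_le_exp]
    by_cases hj : j = I
    · rw [hj, sub_self, Complex.zero_re]; exact hC0
    · have h1 := (hbd w hw j z).2.2 hj
      have h2 : 0 ≤ κ * z ^ 2 := by positivity
      linarith
  · exact gaussianPhase_toComplex (hreal θ hθ I) z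
  · refine (lintegral_mono fun z => iSup₂_le fun w hw => ?_).trans_lt hfin
    rw [← ENNReal.ofReal_mul (Real.exp_pos _).le, ← ofReal_norm, norm_mul]
    exact ENNReal.ofReal_le_ofReal (mul_le_mul (hQle w hw j z) (hbd w hw I z).1 (norm_nonneg _)
      (Real.exp_pos _).le)
  · set R : ℝ := |C - Real.log δ| / κ + 1 with hR
    have hR1 : 1 ≤ R := by
      have : 0 ≤ |C - Real.log δ| / κ := by positivity
      linarith
    refine ⟨Set.Icc (-R) R, isCompact_Icc, fun z hz j hj w hw => ?_⟩
    have hzR : R < |z| := by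
      by_contra! h
      exact hz (abs_le.1 h)
    have h1 : R ≤ z ^ 2 := by
      rw [← sq_abs]
      nlinarith
    have h2 : C - Real.log δ ≤ κ * z ^ 2 := by
      have h3 : κ * R ≤ κ * z ^ 2 := mul_le_mul_of_nonneg_left h1 hκ.le
      have h4 : κ * R = |C - Real.log δ| + κ := by rw [hR]; field_simp
      linarith [le_abs_self (C - Real.log δ)]
    have hdiv : Q w j z / Q w I z = Complex.exp (gaussianPhase w j z - gaussianPhase w I z) :=
      (Complex.exp_sub _ _).symm
    rw [hdiv, Complex.norm_exp, ← Real.exp_log hδ, Real.exp_le_exp]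
    linarith [(hbd w hw j z).2.2 hj]

end HiddenMarkov

/-! ### The general theorem and its Gaussian case -/

theorem theorem3 {l : ℕ} {ι₁ : Type} [Fintype ι₁]
    -- the input Markov chain, analytically parameterized by a bounded domain `Ω₁`
    (Ω₁ : Set (EuclideanSpace ℝ ι₁)) (hΩ₁ : IsOpen Ω₁) (hΩ₁c : IsConnected Ω₁)
    (hΩ₁b : Bornology.IsBounded Ω₁)
    (P : EuclideanSpace ℝ ι₁ → Fin l → Fin l → ℝ) (v : EuclideanSpace ℝ ι₁ → Fin l → ℝ)
    (hP : ∀ ε ∈ Ω₁, HiddenMarkov.IsStochastic (P ε))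
    (hv : ∀ ε ∈ Ω₁, HiddenMarkov.IsStationary (P ε) (v ε))
    (hPan : ∀ i j, AnalyticOnNhd ℝ (fun ε => P ε i j) Ω₁)
    (ε₀ : EuclideanSpace ℝ ι₁) (hε₀ : ε₀ ∈ Ω₁)
    -- (a)
    (hpos : ∀ i j, 0 < P ε₀ i j) :
    -- the general theorem
    (∀ (ι₂ : Type) [Fintype ι₂]
      (Ω₂ : Set (EuclideanSpace ℝ ι₂)) (_ : IsOpen Ω₂) (_ : IsConnected Ω₂)
      (_ : Bornology.IsBounded Ω₂)
      (q : EuclideanSpace ℝ ι₂ → Fin l → ℝ → ℝ)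
      (_ : ∀ θ ∈ Ω₂, ∀ y, HiddenMarkov.IsProbDensity (q θ y))
      (_ : ∀ y z, AnalyticOnNhd ℝ (fun θ => q θ y z) Ω₂)
      (θ₀ : EuclideanSpace ℝ ι₂) (_ : θ₀ ∈ Ω₂)
      -- (b)
      (_ : ∀ y z, 0 < q θ₀ y z)
      -- the complexified densities, with (c) and (d) and the domination by one column
      (Q : EuclideanSpace ℂ ι₂ → Fin l → ℝ → ℂ)
      (_ : HiddenMarkov.ConditionC q Q θ₀)
      (I : Fin l) (_ : HiddenMarkov.ConditionD q Q θ₀ I)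
      (_ : HiddenMarkov.ColumnDominates Q θ₀ I),
      HiddenMarkov.EntropyRateAnalyticAt P v q ε₀ θ₀) ∧
    -- the application to Gaussian channels with a unique largest variance
    (∀ (θ₀ : EuclideanSpace ℝ (Fin l ⊕ Fin l)) (_ : ∀ i, 0 < θ₀ (Sum.inl i))
      (I : Fin l) (_ : ∀ j ≠ I, θ₀ (Sum.inl j) < θ₀ (Sum.inl I)),
      (∃ Q : EuclideanSpace ℂ (Fin l ⊕ Fin l) → Fin l → ℝ → ℂ,
        HiddenMarkov.ConditionC HiddenMarkov.gaussianChannel Q θ₀ ∧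
        HiddenMarkov.ConditionD HiddenMarkov.gaussianChannel Q θ₀ I ∧
        HiddenMarkov.ColumnDominates Q θ₀ I) ∧
      HiddenMarkov.EntropyRateAnalyticAt P v HiddenMarkov.gaussianChannel ε₀ θ₀) := by
  refine ⟨fun ι₂ _ Ω₂ hΩ₂ _ _ q hq _ θ₀ hθ₀ hqpos Q hC I hD hdom =>
    HiddenMarkov.entropyRateAnalyticAt hΩ₁ hP hv hPan hε₀ hpos hΩ₂ hq hθ₀ hqpos hC hD hdom,
    fun θ₀ hσ I hI => ?_⟩
  obtain ⟨Q, hC, hD, hdom⟩ := HiddenMarkov.gaussianChannel_conditions hσ hI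
  -- The parameters with all `σ` positive take the role of `Ω₂`: on them the channel consists of
  -- probability densities.
  have hopen : IsOpen {θ : EuclideanSpace ℝ (Fin l ⊕ Fin l) | ∀ i, 0 < θ (Sum.inl i)} := by
    simp only [Set.ofPred_forall]
    exact isOpen_iInter_of_finite fun i => isOpen_lt continuous_const (by fun_prop)
  exact ⟨⟨Q, hC, hD, hdom⟩, HiddenMarkov.entropyRateAnalyticAt hΩ₁ hP hv hPan hε₀ hpos hopen
    (fun θ hθ i => HiddenMarkov.isProbDensity_gaussianChannel (hθ i)) hσ
    (fun i z => HiddenMarkov.gaussianChannel_pos (hσ i) z) hC hD hdom⟩
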